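/- **Setting.** Let $f_1,f_2\in C^2(\mathbb R^2;\mathbb R)$ have bounded second derivatives. Let $\mathcal H$ be a finite-dimensional complex Hilbert space and $G$ a linear operator on $\mathcal H$. For $u=(u_1,u_2)\in\mathcal H^2$ put $F_j(u)=f_j(\|u_1\|^2,\|u_2\|^2)$, $F(u)u=(F_1(u)u_1,F_2(u)u_2)$, and for $\delta\in\mathbb R$ consider $$-i\,\partial_s u=\begin{pmatrix}s&G\\ G^*&-s\end{pmatrix}u+\delta F(u)u,\qquad s\in\mathbb R. \tag{1}$$ Put $\varphi(s,\lambda)=\frac{s^2}{2}+\frac{\lambda}{2}\ln|s|$. For $\phi\in\mathbb R$, a solution $u$ has the state $\alpha\in\mathcal H^2$ with phase $\phi$ at $-\infty$ if, as $s\to-\infty$, $$u_1(s)=e^{i\delta F_1(\alpha)s+i\varphi(s,GG^*)+i\phi}\alpha_1+O(1/|s|),\qquad u_2(s)=e^{i\delta F_2(\alpha)s-i\varphi(s,G^*G)-i\phi}\alpha_2+O(1/|s|);$$ it has the state $\omega$ at $+\infty$ if, as $s\to+\infty$, the same holds with $\omega$ in place of $\alpha$ and $\phi=0$. The phase $\phi$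 is *admissible* for $(\delta,\alpha)$ if some global solution of (1) has the state $\alpha$ with phase $\phi$ at $-\infty$. The scattering operator $S^\phi_\delta$ maps $\alpha$ to the state $\omega$ at $+\infty$ of that solution; it is *well defined at $\alpha$* if this solution exists and is unique and $\omega$ exists and is unique. Write $S_\delta=S_\delta^0$. The linear scattering operator $S^{\rm lin}$ and the linear scattering states are the same objects for $\delta=0$, $\phi=0$. Let $\theta$ be a smooth cut-off function on $\mathbb R$ with $0\le\theta\le1$, $\theta(x)=0$ for $|x|>1$ and $\theta(x)=1$ for $|x|<1/2$, and for $R>0$ let $\Theta_R=\mathrm{diag}(\theta(GG^*/R^2),\theta(G^*G/R^2))$. **Theorem.** For every $R>0$ there are $\delta_0>0$ and $C$, depending only on $R$ and on $f_1,f_2$, such that the following holds for all $\mathcal H$, $G$, $\theta$ as above and all $\alpha\in\mathcal H^2$ with $\|\alpha\|=1$ and $\Theta_R\alpha=\alpha$. The operator $S^{\rm lin}$ is well defined at $\alpha$, and: 1. If $|\delta|\le\delta_0$, there is an admissible $\phi\in[0,2\pi)$ with $\phi\le C|\delta|$ and $\|S^\phi_\delta(\alpha)-S^{\rm lin}(\alpha)\|\le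 C|\delta|$. Moreover, for every admissible $\phi\in\mathbb R$, $S^\phi_\delta$ is well defined at $\alpha$ and $$\|S^\phi_\delta(\alpha)-S^{\rm lin}(\alpha)\|\le C(|\delta|+|\phi|).$$ In other words, $\phi=O_R(\delta)$ can be chosen, and $S_\delta^\phi=S^{\rm lin}+O_R(\delta)$ uniformly for any such choice. 2. If $F_1=F_2=\underline F$, there are real numbers $\Lambda^\pm$, depending on $\alpha$ but not on $\delta$, such that for every $\delta\in\mathbb R$ the operator $S_\delta$ (with $\phi=0$) is well defined at $\alpha$ and $$S_\delta(\alpha)=e^{i\delta\Lambda^+}S^{\rm lin}\bigl(e^{i\delta\Lambda^-}\alpha\bigr).$$ Here, if $u$ is the solution of (1) with the state $\alpha$ (and phase $0$) at $-\infty$, $u^{\rm lin}$ is the solution of the linear equation (that is, $\delta=0$) with $u^{\rm lin}(0)=u(0)$, and $\alpha^{\rm lin}$, $\omega^{\rm lin}$ are the linear scattering states of $u^{\rm lin}$ at $-\infty$ and $+\infty$ (which exist), then $$\Lambda^-=\int_{-\infty}^0\bigl(\underline F(u^{\rm lin}(\tau))-\underline F(\alpha^{\rm lin})\bigr)d\tau,\qquad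 \Lambda^+=\int_0^{+\infty}\bigl(\underline F(u^{\rm lin}(\tau))-\underline F(\omega^{\rm lin})\bigr)d\tau,$$ as convergent improper integrals, with the same values for all $\delta$. Moreover, for $|\delta|\le\delta_0$, $$\bigl\|S_\delta(\alpha)-S^{\rm lin}(\alpha)-i\delta(\Lambda^++\Lambda^-)S^{\rm lin}(\alpha)\bigr\|\le C\delta^2 .$$ -/

import Mathlib

open Filter Topology Asymptotics

universe u

noncomputable section

namespace LandauZener

/-- The Hilbert space `H × H`, with the `ℓ²` norm. -/
abbrev H2 (H : Type u) : Type u := WithLp 2 (H × H)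

variable {H : Type u} [NormedAddCommGroup H] [InnerProductSpace ℂ H] [CompleteSpace H]

/-- The vector `(x, y)` of `H × H`. -/
def vec (x y : H) : H2 H := WithLp.toLp 2 (x, y)

/-- The operator `G G*`. -/
def GGs (G : H →L[ℂ] H) : H →L[ℂ] H := G * ContinuousLinearMap.adjoint G

/-- The operator `G* G`. -/
def GsG (G : H →L[ℂ] H) : H →L[ℂ] H := ContinuousLinearMap.adjoint G * G

/-- `V(s) u = (s u₁ + G u₂, G* u₁ - s u₂)`. -/
def V (G : H →L[ℂ] H) (s : ℝ) (u : H2 H) : H2 H :=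
  vec ((s : ℂ) • u.fst + G u.snd) (ContinuousLinearMap.adjoint G u.fst - (s : ℂ) • u.snd)

/-- `F(u) = f(‖u₁‖², ‖u₂‖²)`. -/
def nlF (f : ℝ × ℝ → ℝ) (u : H2 H) : ℝ := f (‖u.fst‖ ^ 2, ‖u.snd‖ ^ 2)

/-- `u` is a global solution of `-i u' = V(s) u + δ diag(F₁(u), F₂(u)) u`. -/
def IsSolution (G : H →L[ℂ] H) (f₁ f₂ : ℝ × ℝ → ℝ) (δ : ℝ) (u : ℝ → H2 H) : Prop :=
  ∀ s : ℝ, HasDerivAt u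
    (Complex.I • (V G s (u s) +
      (δ : ℂ) • vec ((nlF f₁ (u s) : ℂ) • (u s).fst) ((nlF f₂ (u s) : ℂ) • (u s).snd))) s

/-- The operator phase `φ(s, A) = s²/2 + (A/2) ln |s|`. -/
def phase (s : ℝ) (A : H →L[ℂ] H) : H →L[ℂ] H :=
  ((s ^ 2 / 2 : ℝ) : ℂ) • (1 : H →L[ℂ] H) + ((Real.log |s| / 2 : ℝ) : ℂ) • A

/-- The asymptotic profile with amplitude `α` and extra phase `ϕ`:
`(e^{iδF₁(α)s + iφ(s,GG*) + iϕ} α₁, e^{iδF₂(α)s - iφ(s,G*G) - iϕ} α₂)`. -/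
def profile (G : H →L[ℂ] H) (f₁ f₂ : ℝ × ℝ → ℝ) (δ ϕ : ℝ) (α : H2 H) (s : ℝ) : H2 H :=
  vec
    (Complex.exp (Complex.I * (δ * nlF f₁ α * s + ϕ)) •
      NormedSpace.exp (Complex.I • phase s (GGs G)) α.fst)
    (Complex.exp (Complex.I * (δ * nlF f₂ α * s - ϕ)) •
      NormedSpace.exp (-(Complex.I • phase s (GsG G))) α.snd)

/-- As `s → -∞`, `u` has the scattering state `α` with extra phase `ϕ`, up to `O(1/|s|)`. -/
def HasPastState (G : H →L[ℂ] H) (f₁ f₂ : ℝ × ℝ → ℝ) (δ ϕ : ℝ) (u : ℝ → H2 H) (α : H2 H) :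
    Prop :=
  (fun s => u s - profile G f₁ f₂ δ ϕ α s) =O[atBot] (fun s : ℝ => 1 / |s|)

/-- As `s → +∞`, `u` has the scattering state `ω`, up to `O(1/s)`. -/
def HasFutureState (G : H →L[ℂ] H) (f₁ f₂ : ℝ × ℝ → ℝ) (δ : ℝ) (u : ℝ → H2 H) (ω : H2 H) :
    Prop :=
  (fun s => u s - profile G f₁ f₂ δ 0 ω s) =O[atTop] (fun s : ℝ => 1 / |s|)

/-- The phase `ϕ` is admissible for `α`: some solution has the state `α`
with extra phase `ϕ` at `-∞`. -/
def Admissible (G : H →L[ℂ] H) (f₁ f₂ : ℝ × ℝ → ℝ) (δ ϕ : ℝ) (α : H2 H) : Prop :=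
  ∃ u, IsSolution G f₁ f₂ δ u ∧ HasPastState G f₁ f₂ δ ϕ u α

/-- Some solution with state `α` and extra phase `ϕ` at `-∞` has the state `ω` at `+∞`. -/
def IsScatteringPair (G : H →L[ℂ] H) (f₁ f₂ : ℝ × ℝ → ℝ) (δ ϕ : ℝ) (α ω : H2 H) : Prop :=
  ∃ u, IsSolution G f₁ f₂ δ u ∧ HasPastState G f₁ f₂ δ ϕ u α ∧ HasFutureState G f₁ f₂ δ u ω

/-- The scattering operator is well defined at `α`: there is exactly one solution with the
state `α` (and extra phase `ϕ`) at `-∞`, and exactly one resulting state at `+∞`. -/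
def ScatteringDefined (G : H →L[ℂ] H) (f₁ f₂ : ℝ × ℝ → ℝ) (δ ϕ : ℝ) (α : H2 H) : Prop :=
  (∃! u, IsSolution G f₁ f₂ δ u ∧ HasPastState G f₁ f₂ δ ϕ u α) ∧
    ∃! ω, IsScatteringPair G f₁ f₂ δ ϕ α ω

/-- The scattering operator `S_δ^ϕ`, mapping `α` to `ω`
(a meaningful value where `ScatteringDefined` holds). -/
def scatteringOp (G : H →L[ℂ] H) (f₁ f₂ : ℝ × ℝ → ℝ) (δ ϕ : ℝ) (α : H2 H) : H2 H :=
  Classical.epsilon (fun ω => IsScatteringPair G f₁ f₂ δ ϕ α ω)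

/-- Global solutions of the linear equation `-i u' = V(s) u`. -/
def IsLinSolution (G : H →L[ℂ] H) (u : ℝ → H2 H) : Prop := IsSolution G 0 0 0 u

/-- Linear scattering states at `-∞`. -/
def HasLinPastState (G : H →L[ℂ] H) (u : ℝ → H2 H) (α : H2 H) : Prop :=
  HasPastState G 0 0 0 0 u α

/-- Linear scattering states at `+∞`. -/
def HasLinFutureState (G : H →L[ℂ] H) (u : ℝ → H2 H) (ω : H2 H) : Prop :=
  HasFutureState G 0 0 0 u ω

/-- The linear scattering operator is well defined at `α`. -/
def LinScatteringDefined (G : H →L[ℂ] H) (α : H2 H) : Prop := ScatteringDefined G 0 0 0 0 α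

/-- The linear scattering operator. -/
def linScatteringOp (G : H →L[ℂ] H) (α : H2 H) : H2 H := scatteringOp G 0 0 0 0 α

/-- Smooth cut-off functions. -/
structure IsCutoff (θ : ℝ → ℝ) : Prop where
  smooth : ContDiff ℝ ((⊤ : ℕ∞) : WithTop ℕ∞) θ
  nonneg : ∀ x, 0 ≤ θ x
  le_one : ∀ x, θ x ≤ 1
  zero_of_one_lt : ∀ x, 1 < |x| → θ x = 0
  one_of_lt_half : ∀ x, |x| < 1 / 2 → θ x = 1

/-- `Θ_R = diag(θ(GG*/R²), θ(G*G/R²))`, by functional calculus. -/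
def Theta (G : H →L[ℂ] H) (θ : ℝ → ℝ) (R : ℝ) (u : H2 H) : H2 H :=
  vec (cfc (fun x : ℝ => θ (x / R ^ 2)) (GGs G) u.fst)
    (cfc (fun x : ℝ => θ (x / R ^ 2)) (GsG G) u.snd)

end LandauZener

end

open LandauZener

/-! The norm of a solution is conserved, so both nonlinearities are functions of the single
population `x = ‖u₁‖²`. Relative to the free phases `e^{± i s²/2}` the off-diagonal coupling
oscillates like `e^{i s²}`, and each integration by parts gains a factor `1/s`. Applied to `x` this
shows that `x` converges with rate `1/|s|` and that `x + ρ/s`, with `ρ = Re ⟪u₁, G u₂⟫`, converges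
with rate `1/s²` (`Pop.exists_limit`). The second order is essential: the profile contains the
frequency `δ F(α)`, which is multiplied by `s`. The term `ρ/s` oscillates as well, hence `∫ F(u) =
F(α) s + κ + O(1/|s|)` (`Pop.exists_phase_limit`). Once these phases are removed, the same
integration by parts makes the amplitudes converge (`Sys.exists_amplitude`), the logarithmic phase
being the resonant second order term. So every solution with `|δ| ≤ 1` has a past state, with
constants depending only on bounds for `‖G‖` and for the nonlinearities
(`IsSolution.exists_pastExpansion`).

Conversely, solutions started at times tending to `-∞` from data matching `x + ρ/s` to second order
have a limit by compactness, and this limit has the prescribed state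
(`exists_solution_of_past_state`). If two solutions share a state and differ by `D/|s|`, then their
populations differ by `O(D/s²)`, and an energy estimate improves `D` to `O(|δ| D)`; for small `δ`
they coincide (`IsSolution.eq_of_past_state`).

For comparison with the linear equation, the nonlinear phases are gauged away. What is left is a
phase factor `e` in the coupling with `|e - 1| = O(|δ| |s|)`; the resulting forcing grows, but it
oscillates, and an explicit corrector leaves a remainder `O(|δ|/s²)`
(`IsSolution.norm_sub_linear_neg_one_le`). Time reversal gives the other half-line
(`norm_futureState_sub_le`). A phase `ϕ` is only a rotation of the state by `twist`.

If the nonlinearities agree, a scalar gauge factor maps linear solutions to nonlinear ones for every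
`δ`, and the limits of `∫ (F(u) - F(α))` at both ends are the phase shifts (`equal_nonlinearities`).

Finally, the cut-off condition places `α` in a spectral subspace invariant under the flow, on which
`G` can be replaced by an operator of norm at most `R` (`exists_reduction`); this makes all
constants uniform in `G` and `H`. -/

noncomputable section
namespace LandauZener

/-! ### Limits at minus infinity and energy inequalities. -/

section Calculus

variable {E : Type*} [NormedAddCommGroup E] [NormedSpace ℝ E]

/-- Mean value inequality with a primitive `b` of the bound. -/
theorem norm_sub_le_of_deriv_bound {y y' : ℝ → E} {b b' : ℝ → ℝ} {s t : ℝ} (hst : s ≤ t)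
    (hy : ∀ r ∈ Set.Icc s t, HasDerivAt y (y' r) r)
    (hb : ∀ r ∈ Set.Icc s t, HasDerivAt b (b' r) r)
    (h : ∀ r ∈ Set.Icc s t, ‖y' r‖ ≤ b' r) : ‖y t - y s‖ ≤ b t - b s := by
  refine image_norm_le_of_norm_deriv_right_le_deriv_boundary' (f := fun r => y r - y s)
    (f' := y') (B := fun r => b r - b s) (B' := b') (a := s) (b := t) ?_ ?_ ?_ ?_ ?_ ?_ ⟨hst, le_rfl⟩
  · exact fun r hr => ((hy r hr).continuousAt.sub continuousAt_const).continuousWithinAt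
  · exact fun r hr => ((hy r ⟨hr.1, hr.2.le⟩).sub_const _).hasDerivWithinAt
  · simp
  · exact fun r hr => ((hb r hr).continuousAt.sub continuousAt_const).continuousWithinAt
  · exact fun r hr => ((hb r ⟨hr.1, hr.2.le⟩).sub_const _).hasDerivWithinAt
  · exact fun r hr => h r ⟨hr.1, hr.2.le⟩

/-- Increments of `y` are dominated by increments of `b`, which are small near `-∞` because `b`
tends to zero; sending the left endpoint to `-∞` gives the rate. It is applied with `b = C/|s|` and
`b = C/s²`. -/
theorem exists_limit_atBot_of_deriv_bound [CompleteSpace E] {y y' : ℝ → E} {b b' : ℝ → ℝ}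
    (hy : ∀ s ≤ -1, HasDerivAt y (y' s) s) (hb : ∀ s ≤ -1, HasDerivAt b (b' s) s)
    (h : ∀ s ≤ -1, ‖y' s‖ ≤ b' s) (hb0 : Tendsto b atBot (𝓝 0)) :
    ∃ l, Tendsto y atBot (𝓝 l) ∧ ∀ s ≤ -1, ‖y s - l‖ ≤ b s := by
  have key : ∀ s t, s ≤ t → t ≤ -1 → ‖y t - y s‖ ≤ b t - b s := fun s t hst ht =>
    norm_sub_le_of_deriv_bound hst (fun r hr => hy r (hr.2.trans ht))
      (fun r hr => hb r (hr.2.trans ht)) (fun r hr => h r (hr.2.trans ht))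
  have hc : Cauchy (map y atBot) := by
    rw [Metric.cauchy_iff]
    refine ⟨inferInstance, fun ε hε => ?_⟩
    have h1 : ∀ᶠ s in atBot, |b s| < ε / 2 := by
      have := (Metric.tendsto_nhds.mp hb0) (ε / 2) (by positivity)
      simpa [Real.dist_eq] using this
    obtain ⟨S, hS⟩ := eventually_atBot.mp (h1.and (eventually_le_atBot (-1)))
    refine ⟨y '' Set.Iic S, image_mem_map (Iic_mem_atBot S), ?_⟩
    have aux : ∀ p q, p ≤ q → q ≤ S → ‖y q - y p‖ < ε := fun p q hpq hq => by
      have h2 := key p q hpq (hS q hq).2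
      have h3 := abs_lt.mp (hS q hq).1
      have h4 := abs_lt.mp (hS p (hpq.trans hq)).1
      linarith
    rintro _ ⟨p, hp, rfl⟩ _ ⟨q, hq, rfl⟩
    rcases le_total p q with hpq | hpq
    · rw [dist_comm, dist_eq_norm]; exact aux p q hpq hq
    · rw [dist_eq_norm]; exact aux q p hpq hp
  obtain ⟨l, hl⟩ := CompleteSpace.complete hc
  refine ⟨l, hl, fun s hs => ?_⟩
  have hl' : Tendsto y atBot (𝓝 l) := hl
  have h1 : Tendsto (fun t => ‖y s - y t‖) atBot (𝓝 ‖y s - l‖) :=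
    (tendsto_const_nhds.sub hl').norm
  have h2 : Tendsto (fun t => b s - b t) atBot (𝓝 (b s - 0)) := tendsto_const_nhds.sub hb0
  rw [sub_zero] at h2
  refine le_of_tendsto_of_tendsto h1 h2 ?_
  filter_upwards [eventually_le_atBot s] with t ht using key t s ht hs

theorem tendsto_const_div_abs_atBot (C : ℝ) : Tendsto (fun s : ℝ => C / |s|) atBot (𝓝 0) :=
  tendsto_const_nhds.div_atTop tendsto_abs_atBot_atTop

theorem tendsto_const_div_sq_atBot (C : ℝ) : Tendsto (fun s : ℝ => C / s ^ 2) atBot (𝓝 0) :=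
  tendsto_const_nhds.div_atTop
    (((tendsto_pow_atTop two_ne_zero).comp (tendsto_abs_atBot_atTop (G := ℝ))).congr
      fun s => sq_abs s)

theorem hasDerivAt_const_div_abs (C : ℝ) {s : ℝ} (hs : s ≤ -1) :
    HasDerivAt (fun s : ℝ => C / |s|) (C / s ^ 2) s := by
  have hs0 : s < 0 := by linarith
  have h := (hasDerivAt_inv hs0.ne).const_mul (-C)
  refine (h.congr_of_eventuallyEq ?_).congr_deriv (by field_simp)
  filter_upwards [Iio_mem_nhds hs0] with t ht
  rw [abs_of_neg ht, div_neg, div_eq_mul_inv, neg_mul]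

theorem hasDerivAt_const_div_sq (C : ℝ) {s : ℝ} (hs : s ≤ -1) :
    HasDerivAt (fun s : ℝ => C / s ^ 2) (2 * C / |s| ^ 3) s := by
  have hs0 : s < 0 := by linarith
  have h := ((hasDerivAt_pow 2 s).fun_inv (pow_ne_zero 2 hs0.ne)).const_mul C
  refine (h.congr_of_eventuallyEq (Eventually.of_forall fun t => div_eq_mul_inv _ _)).congr_deriv ?_
  rw [abs_of_neg hs0]
  have := hs0.ne
  field_simp
  push_cast
  ring

theorem exists_limit_of_deriv_le_sq [CompleteSpace E] {y y' : ℝ → E} {C : ℝ}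
    (hy : ∀ s ≤ -1, HasDerivAt y (y' s) s) (h : ∀ s ≤ -1, ‖y' s‖ ≤ C / s ^ 2) :
    ∃ l, Tendsto y atBot (𝓝 l) ∧ ∀ s ≤ -1, ‖y s - l‖ ≤ C / |s| :=
  exists_limit_atBot_of_deriv_bound hy (fun _ hs => hasDerivAt_const_div_abs C hs) h
    (tendsto_const_div_abs_atBot C)

theorem exists_limit_of_deriv_le_cube [CompleteSpace E] {y y' : ℝ → E} {C : ℝ}
    (hy : ∀ s ≤ -1, HasDerivAt y (y' s) s) (h : ∀ s ≤ -1, ‖y' s‖ ≤ 2 * C / |s| ^ 3) :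
    ∃ l, Tendsto y atBot (𝓝 l) ∧ ∀ s ≤ -1, ‖y s - l‖ ≤ C / s ^ 2 :=
  exists_limit_atBot_of_deriv_bound hy (fun _ hs => hasDerivAt_const_div_sq C hs) h
    (tendsto_const_div_sq_atBot C)

/-- The shift by `ε` makes the root differentiable where the energy vanishes. The bound does not
involve `ε`, so `ε → 0` is possible afterwards. -/
theorem abs_deriv_sqrt_le {e e' ε B : ℝ} (he : 0 ≤ e) (hε : 0 < ε)
    (h : |e'| ≤ 2 * √e * B) (hB : 0 ≤ B) : ‖e' / (2 * √(e + ε))‖ ≤ B := by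
  have h1 : 0 < √(e + ε) := Real.sqrt_pos.mpr (by linarith)
  have h2 : √e ≤ √(e + ε) := Real.sqrt_le_sqrt (by linarith)
  rw [Real.norm_eq_abs, abs_div, abs_of_pos (a := 2 * √(e + ε)) (by positivity),
    div_le_iff₀ (by positivity)]
  calc |e'| ≤ 2 * √e * B := h
    _ ≤ 2 * √(e + ε) * B := by gcongr
    _ = B * (2 * √(e + ε)) := by ring

/-- If `e ≥ 0` tends to `0` at `-∞` and `|e'| ≤ 2 √e C / s²`, then `√e ≤ C / |s|`. -/
theorem sqrt_energy_le_of_tendsto_zero {e e' : ℝ → ℝ} {C : ℝ} (he : ∀ s ≤ -1, 0 ≤ e s)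
    (hd : ∀ s ≤ -1, HasDerivAt e (e' s) s)
    (h : ∀ s ≤ -1, |e' s| ≤ 2 * √(e s) * (C / s ^ 2)) (hC : 0 ≤ C)
    (h0 : Tendsto e atBot (𝓝 0)) {s : ℝ} (hs : s ≤ -1) : √(e s) ≤ C / |s| := by
  have key : ∀ ε > 0, √(e s) ≤ √ε + C / |s| := fun ε hε => by
    obtain ⟨l, hl, hb⟩ := exists_limit_of_deriv_le_sq (y := fun s => √(e s + ε))
      (y' := fun s => e' s / (2 * √(e s + ε))) (C := C)
      (fun s hs => ((hd s hs).add_const ε).sqrt (by have := he s hs; positivity))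
      (fun s hs => abs_deriv_sqrt_le (he s hs) hε (h s hs) (by positivity))
    have hl' : Tendsto (fun s => √(e s + ε)) atBot (𝓝 √(0 + ε)) := (h0.add_const ε).sqrt
    rw [tendsto_nhds_unique hl hl', zero_add] at hb
    have h1 := (abs_le.mp (Real.norm_eq_abs _ ▸ hb s hs)).2
    have h2 : √(e s) ≤ √(e s + ε) := Real.sqrt_le_sqrt (by linarith)
    linarith
  have hlim : Tendsto (fun ε : ℝ => √ε + C / |s|) (𝓝[>] 0) (𝓝 (√0 + C / |s|)) :=
    ((Real.continuous_sqrt.tendsto 0).mono_left nhdsWithin_le_nhds).add_const _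
  rw [Real.sqrt_zero, zero_add] at hlim
  exact ge_of_tendsto hlim (by filter_upwards [self_mem_nhdsWithin] with ε hε using key ε hε)

/-- If `e ≥ 0` and `|e'| ≤ 2 √e B` on `[a, b]`, then `√e` grows at most by `B (b - a)`. -/
theorem sqrt_energy_le_add {e e' : ℝ → ℝ} {a b B : ℝ} (hab : a ≤ b) (he : ∀ s, 0 ≤ e s)
    (hd : ∀ s, HasDerivAt e (e' s) s) (h : ∀ s ∈ Set.Icc a b, |e' s| ≤ 2 * √(e s) * B)
    (hB : 0 ≤ B) : √(e b) ≤ √(e a) + B * (b - a) := by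
  have key : ∀ ε > 0, √(e b) ≤ √(e a + ε) + B * (b - a) := fun ε hε => by
    have hb := norm_sub_le_of_deriv_bound (y := fun s => √(e s + ε)) hab
      (fun s _ => ((hd s).add_const ε).sqrt (by have := he s; positivity))
      (fun s _ => ((hasDerivAt_id s).const_mul B))
      (fun s hs => by rw [mul_one]; exact abs_deriv_sqrt_le (he s) hε (h s hs) hB)
    have h1 := (abs_le.mp (Real.norm_eq_abs _ ▸ hb)).2
    have h2 : √(e b) ≤ √(e b + ε) := Real.sqrt_le_sqrt (by linarith)
    simp only [id] at h1
    linarith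
  have hlim : Tendsto (fun ε : ℝ => √(e a + ε) + B * (b - a)) (𝓝[>] 0)
      (𝓝 (√(e a + 0) + B * (b - a))) := by
    have : Continuous fun ε : ℝ => √(e a + ε) + B * (b - a) := by fun_prop
    exact (this.tendsto 0).mono_left nhdsWithin_le_nhds
  rw [add_zero] at hlim
  exact ge_of_tendsto hlim (by filter_upwards [self_mem_nhdsWithin] with ε hε using key ε hε)

/-- Gronwall inequality in both time directions for an energy. -/
theorem energy_le_exp {e e' : ℝ → ℝ} {a b K : ℝ}
    (hd : ∀ s ∈ Set.Ioo a b, HasDerivAt e (e' s) s) (h : ∀ s ∈ Set.Ioo a b, |e' s| ≤ K * e s)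
    {s t : ℝ} (hs : s ∈ Set.Ioo a b) (ht : t ∈ Set.Ioo a b) :
    e t ≤ Real.exp (K * |t - s|) * e s := by
  rcases le_total s t with hst | hst
  · have hsub : Set.Icc s t ⊆ Set.Ioo a b := fun r hr => ⟨hs.1.trans_le hr.1, hr.2.trans_lt ht.2⟩
    have hE : ∀ r : ℝ, HasDerivAt (fun r => Real.exp (-(K * r))) (Real.exp (-(K * r)) * -K) r :=
      fun r => by simpa using (((hasDerivAt_id r).const_mul K).neg).exp
    have hm : AntitoneOn (fun r => Real.exp (-(K * r)) * e r) (Set.Icc s t) := by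
      refine antitoneOn_of_deriv_nonpos (convex_Icc s t)
        (fun r hr => ((hE r).mul (hd r (hsub hr))).continuousAt.continuousWithinAt)
        (fun r hr => ((hE r).mul (hd r (hsub (interior_subset hr)))).differentiableAt.differentiableWithinAt)
        fun r hr => ?_
      have hr' := hsub (interior_subset hr)
      rw [((hE r).fun_mul (hd r hr')).deriv]
      have := (abs_le.mp (h r hr')).2
      have h2 := Real.exp_pos (-(K * r))
      nlinarith
    have h1 := hm ⟨le_rfl, hst⟩ ⟨hst, le_rfl⟩ hst
    rw [abs_of_nonneg (by linarith)]
    have h2 : e t = Real.exp (K * t) * (Real.exp (-(K * t)) * e t) := by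
      rw [← mul_assoc, ← Real.exp_add]; simp
    have h3 : Real.exp (K * (t - s)) * e s = Real.exp (K * t) * (Real.exp (-(K * s)) * e s) := by
      rw [← mul_assoc, ← Real.exp_add]; ring_nf
    rw [h2, h3]
    exact mul_le_mul_of_nonneg_left h1 (Real.exp_pos _).le
  · have hsub : Set.Icc t s ⊆ Set.Ioo a b := fun r hr => ⟨ht.1.trans_le hr.1, hr.2.trans_lt hs.2⟩
    have hE : ∀ r : ℝ, HasDerivAt (fun r => Real.exp (K * r)) (Real.exp (K * r) * K) r :=
      fun r => by simpa using ((hasDerivAt_id r).const_mul K).exp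
    have hm : MonotoneOn (fun r => Real.exp (K * r) * e r) (Set.Icc t s) := by
      refine monotoneOn_of_deriv_nonneg (convex_Icc t s)
        (fun r hr => ((hE r).mul (hd r (hsub hr))).continuousAt.continuousWithinAt)
        (fun r hr => ((hE r).mul (hd r (hsub (interior_subset hr)))).differentiableAt.differentiableWithinAt)
        fun r hr => ?_
      have hr' := hsub (interior_subset hr)
      rw [((hE r).fun_mul (hd r hr')).deriv]
      have := (abs_le.mp (h r hr')).1
      have h2 := Real.exp_pos (K * r)
      nlinarith
    have h1 := hm ⟨le_rfl, hst⟩ ⟨hst, le_rfl⟩ hst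
    rw [abs_of_nonpos (by linarith)]
    have h2 : e t = Real.exp (-(K * t)) * (Real.exp (K * t) * e t) := by
      rw [← mul_assoc, ← Real.exp_add]; simp
    have h3 : Real.exp (K * -(t - s)) * e s = Real.exp (-(K * t)) * (Real.exp (K * s) * e s) := by
      rw [← mul_assoc, ← Real.exp_add]; ring_nf
    rw [h2, h3]
    exact mul_le_mul_of_nonneg_left h1 (Real.exp_pos _).le

end Calculus

end LandauZener
end

/-! ### The unitary groups, and the convergence of the amplitudes. -/

noncomputable section
namespace LandauZener

variable {H : Type u} [NormedAddCommGroup H] [InnerProductSpace ℂ H] [CompleteSpace H]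

section Rotation

/-- The one-parameter group `e^{i r A}`. -/
def rot (A : H →L[ℂ] H) (r : ℝ) : H →L[ℂ] H := NormedSpace.exp (r • (Complex.I • A))

theorem rot_zero (A : H →L[ℂ] H) : rot A 0 = 1 := by simp [rot, NormedSpace.exp_zero]

theorem rot_add (A : H →L[ℂ] H) (r t : ℝ) : rot A (r + t) = rot A r * rot A t := by
  let _ : NormedAlgebra ℚ (H →L[ℂ] H) := .restrictScalars ℚ ℂ _
  rw [rot, rot, rot, add_smul, NormedSpace.exp_add_of_commute]
  exact ((Commute.refl _).smul_left r).smul_right t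

theorem rot_neg_rot (A : H →L[ℂ] H) (r : ℝ) (x : H) : rot A r (rot A (-r) x) = x := by
  rw [← mul_apply_eq_comp, ← rot_add]; simp [rot_zero]

theorem norm_rot_apply {A : H →L[ℂ] H} (hA : IsSelfAdjoint A) (r : ℝ) (x : H) :
    ‖rot A r x‖ = ‖x‖ := by
  have h : rot A r ∈ unitary (H →L[ℂ] H) := by
    let _ : NormedAlgebra ℚ (H →L[ℂ] H) := .restrictScalars ℚ ℂ _
    refine NormedSpace.exp_mem_unitary_of_mem_skewAdjoint ?_
    rw [skewAdjoint.mem_iff, star_smul, star_smul, hA.star_eq]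
    simp
  exact ContinuousLinearMap.norm_map_of_mem_unitary h x

theorem hasDerivAt_rot_apply (A : H →L[ℂ] H) {r : ℝ → ℝ} {r' s : ℝ} {z : ℝ → H} {z' : H}
    (hr : HasDerivAt r r' s) (hz : HasDerivAt z z' s) :
    HasDerivAt (fun s => rot A (r s) (z s))
      (rot A (r s) ((r' : ℂ) • Complex.I • A (z s) + z')) s := by
  have h1 : HasDerivAt (fun t => rot A (r t)) (r' • (rot A (r s) * (Complex.I • A))) s :=
    (hasDerivAt_exp_smul_const (𝕂 := ℝ) (Complex.I • A) (r s)).scomp s hr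
  have h2 := ((ContinuousLinearMap.restrictScalarsL ℂ H H ℝ ℝ).hasFDerivAt.comp_hasDerivAt s
    h1).clm_apply hz
  refine h2.congr_deriv ?_
  simp [← Complex.coe_smul]

end Rotation


/-- The two-component system with a sign `σ` and given potentials `F₁`, `F₂`. -/
structure Sys (σ : ℝ) (B : H →L[ℂ] H) (δ : ℝ) (F₁ F₂ : ℝ → ℝ) (y₁ y₂ : ℝ → H) : Prop where
  fst : ∀ s, HasDerivAt y₁ (Complex.I • (((σ * s : ℝ) : ℂ) • y₁ s + B (y₂ s) +
    ((δ * F₁ s : ℝ) : ℂ) • y₁ s)) s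
  snd : ∀ s, HasDerivAt y₂ (Complex.I • (ContinuousLinearMap.adjoint B (y₁ s) -
    ((σ * s : ℝ) : ℂ) • y₂ s + ((δ * F₂ s : ℝ) : ℂ) • y₂ s)) s

/-- Exchanging the components reverses the sign `σ`, so each estimate for the first component also
yields the one for the second. -/
theorem Sys.swap {σ : ℝ} {B : H →L[ℂ] H} {δ : ℝ} {F₁ F₂ : ℝ → ℝ} {y₁ y₂ : ℝ → H}
    (h : Sys σ B δ F₁ F₂ y₁ y₂) :
    Sys (-σ) (ContinuousLinearMap.adjoint B) δ F₂ F₁ y₂ y₁ where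
  fst s := (h.snd s).congr_deriv (by push_cast; module)
  snd s := (h.fst s).congr_deriv (by
    rw [ContinuousLinearMap.adjoint_adjoint]; push_cast; module)

theorem norm_cexp_I_mul (x : ℝ) : ‖Complex.exp (Complex.I * x)‖ = 1 := by
  rw [mul_comm, Complex.norm_exp_ofReal_mul_I]

/-- The derivative of the corrected amplitude. -/
theorem Sys.hasDerivAt_amplitude {σ : ℝ} {B : H →L[ℂ] H} {δ : ℝ} {F₁ F₂ : ℝ → ℝ} {y₁ y₂ : ℝ → H}
    (h : Sys σ B δ F₁ F₂ y₁ y₂) (hσ : σ ^ 2 = 1) {Φ : ℝ → ℝ} {Δ' s : ℝ} (hs : s ≤ -1)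
    (hΦ : HasDerivAt Φ (F₁ s) s) (hΔ : HasDerivAt (fun s => F₂ s - F₁ s) Δ' s) :
    HasDerivAt (fun s => Complex.exp (Complex.I * ((-(σ * s ^ 2 / 2 + δ * Φ s) : ℝ) : ℂ)) •
        rot (B * ContinuousLinearMap.adjoint B) (-(σ * (Real.log s / 2)))
        (y₁ s + ((σ / (2 * s) + δ * (F₂ s - F₁ s) / (4 * s ^ 2) : ℝ) : ℂ) • B (y₂ s)))
      (Complex.exp (Complex.I * ((-(σ * s ^ 2 / 2 + δ * Φ s) : ℝ) : ℂ)) •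
        rot (B * ContinuousLinearMap.adjoint B) (-(σ * (Real.log s / 2)))
        ((Complex.I * ((δ * (F₂ s - F₁ s) / (4 * s ^ 2) : ℝ) : ℂ)) •
            B (ContinuousLinearMap.adjoint B (y₁ s)) +
          (Complex.I * ((δ ^ 2 * (F₂ s - F₁ s) ^ 2 / (4 * s ^ 2) : ℝ) : ℂ) +
            ((-σ / (2 * s ^ 2) + δ * Δ' / (4 * s ^ 2) - δ * (F₂ s - F₁ s) / (2 * s ^ 3) : ℝ) : ℂ)) •
            B (y₂ s) +
          (-Complex.I * ((σ / (2 * s) * (σ / (2 * s) + δ * (F₂ s - F₁ s) / (4 * s ^ 2)) : ℝ) : ℂ)) •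
            B (ContinuousLinearMap.adjoint B (B (y₂ s))))) s := by
  have hs0 : s ≠ 0 := by linarith
  have hσ' : (σ : ℂ) ^ 2 = 1 := by exact_mod_cast hσ
  -- The coefficient `ν` solves `i (-2 σ s + δ (F₂ - F₁)) ν + i = 0` up to `O(1/s²)`, which removes
  -- the oscillating term `i B y₂`. Its leading part also produces `i σ/(2s) B B* y₁`; this term is
  -- resonant and is cancelled by the logarithmic rotation.
  have hν : HasDerivAt (fun s => ((σ / (2 * s) + δ * (F₂ s - F₁ s) / (4 * s ^ 2) : ℝ) : ℂ))
      ((-σ / (2 * s ^ 2) + δ * Δ' / (4 * s ^ 2) - δ * (F₂ s - F₁ s) / (2 * s ^ 3) : ℝ) : ℂ) s := by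
    have h1 := ((hasDerivAt_const s σ).fun_div ((hasDerivAt_id s).const_mul 2) (by simpa using hs0))
    have h2 := (hΔ.const_mul δ).fun_div ((hasDerivAt_pow 2 s).const_mul 4) (by positivity)
    refine ((h1.fun_add h2).congr_deriv ?_).ofReal_comp
    simp only [id]
    field_simp
    push_cast
    ring
  have hBy := (B.restrictScalars ℝ).hasFDerivAt.comp_hasDerivAt s (h.snd s)
  have hz := (h.fst s).fun_add (hν.fun_smul hBy)
  have hr : HasDerivAt (fun s => -(σ * (Real.log s / 2))) (-(σ * (s⁻¹ / 2))) s :=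
    (((Real.hasDerivAt_log hs0).div_const 2).const_mul σ).neg
  have hph : HasDerivAt (fun s => Complex.exp (Complex.I * ((-(σ * s ^ 2 / 2 + δ * Φ s) : ℝ) : ℂ)))
      (Complex.exp (Complex.I * ((-(σ * s ^ 2 / 2 + δ * Φ s) : ℝ) : ℂ)) *
        (Complex.I * ((-(σ * s + δ * F₁ s) : ℝ) : ℂ))) s := by
    have h1 := ((((hasDerivAt_pow 2 s).const_mul σ).div_const 2).fun_add (hΦ.const_mul δ)).fun_neg
    refine ((h1.congr_deriv ?_).ofReal_comp.const_mul Complex.I).cexp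
    push_cast; ring
  have hfin := hph.fun_smul (hasDerivAt_rot_apply (B * ContinuousLinearMap.adjoint B) hr hz)
  refine hfin.congr_deriv ?_
  have hs0' : (s : ℂ) ≠ 0 := by exact_mod_cast hs0
  rw [mul_smul, ← smul_add, ← (rot _ _).map_smul, ← map_add]
  congr 2
  simp only [ContinuousLinearMap.coe_restrictScalars', mul_apply_eq_comp, map_add, map_sub,
    map_smul, Function.comp]
  push_cast
  match_scalars
  · ring
  · field_simp
  · field_simp
    ring
  · field_simp
    linear_combination (-(8 * Complex.I * (s : ℂ) ^ 3)) * hσ'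


theorem abs_div_le_of_abs_le {p c q : ℝ} (hq : 0 < q) (h : |p| ≤ c) : |p / q| ≤ c / q := by
  rw [abs_div, abs_of_pos hq]; gcongr

/-- The bound for the convergence of the corrected amplitude. -/
def ampC (R M : ℝ) : ℝ := M * R ^ 2 + 2 * (1 + M) ^ 2 * R + (1 + M) * R ^ 3 + 2 * R * (1 + M)

/-- The corrected amplitude has a derivative of size `1/s²` and therefore a limit. The correction is
itself `O(1/|s|)`, so the uncorrected component has the same asymptotics; this costs the last
summand of `ampC`. -/
theorem Sys.exists_amplitude {σ : ℝ} {B : H →L[ℂ] H} {δ : ℝ} {F₁ F₂ : ℝ → ℝ} {y₁ y₂ : ℝ → H}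
    (h : Sys σ B δ F₁ F₂ y₁ y₂) (hσ : |σ| = 1) (hδ : |δ| ≤ 1) {R M : ℝ} (hM : 0 ≤ M)
    (hB : ‖B‖ ≤ R) (hy₁ : ∀ s, ‖y₁ s‖ ≤ 2) (hy₂ : ∀ s, ‖y₂ s‖ ≤ 2)
    {Φ Δ' : ℝ → ℝ} (hΦ : ∀ s, HasDerivAt Φ (F₁ s) s)
    (hΔ : ∀ s, HasDerivAt (fun s => F₂ s - F₁ s) (Δ' s) s)
    (hΔb : ∀ s, |F₂ s - F₁ s| ≤ 2 * M) (hΔ'b : ∀ s, |Δ' s| ≤ 2 * M) :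
    ∃ a : H, ∀ s ≤ -1, ‖y₁ s - Complex.exp (Complex.I * ((σ * s ^ 2 / 2 + δ * Φ s : ℝ) : ℂ)) •
      rot (B * ContinuousLinearMap.adjoint B) (σ * (Real.log s / 2)) a‖ ≤ ampC R M / |s| := by
  have hσ2 : σ ^ 2 = 1 := by rw [← sq_abs, hσ, one_pow]
  have hR : 0 ≤ R := (norm_nonneg B).trans hB
  have hA : IsSelfAdjoint (B * ContinuousLinearMap.adjoint B) := IsSelfAdjoint.mul_star_self B
  have hBx : ∀ x : H, ‖B x‖ ≤ R * ‖x‖ := fun x =>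
    (B.le_opNorm x).trans (by gcongr)
  have hBsx : ∀ x : H, ‖ContinuousLinearMap.adjoint B x‖ ≤ R * ‖x‖ := fun x =>
    ((ContinuousLinearMap.adjoint B).le_opNorm x).trans (by
      rw [LinearIsometryEquiv.norm_map]; gcongr)
  have hP : ∀ s, ‖B (y₂ s)‖ ≤ 2 * R := fun s => by nlinarith [hBx (y₂ s), hy₂ s]
  have hQ : ∀ s, ‖B (ContinuousLinearMap.adjoint B (y₁ s))‖ ≤ 2 * R ^ 2 := fun s => by
    have h1 := hBx (ContinuousLinearMap.adjoint B (y₁ s))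
    have h2 : ‖ContinuousLinearMap.adjoint B (y₁ s)‖ ≤ 2 * R := by nlinarith [hBsx (y₁ s), hy₁ s]
    nlinarith
  have hS : ∀ s, ‖B (ContinuousLinearMap.adjoint B (B (y₂ s)))‖ ≤ 2 * R ^ 3 := fun s => by
    have h1 := hBx (ContinuousLinearMap.adjoint B (B (y₂ s)))
    have h2 : ‖ContinuousLinearMap.adjoint B (B (y₂ s))‖ ≤ 2 * R ^ 2 := by
      nlinarith [hBsx (B (y₂ s)), hP s]
    nlinarith
  have hδΔ : ∀ s, |δ * (F₂ s - F₁ s)| ≤ 2 * M := fun s => by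
    rw [abs_mul]; nlinarith [hΔb s, abs_nonneg (F₂ s - F₁ s)]
  have hδΔ' : ∀ s, |δ * Δ' s| ≤ 2 * M := fun s => by
    rw [abs_mul]; nlinarith [hΔ'b s, abs_nonneg (Δ' s)]
  have hν : ∀ s ≤ -1, |σ / (2 * s) + δ * (F₂ s - F₁ s) / (4 * s ^ 2)| ≤ (1 + M) / |s| := by
    intro s hs
    have hs1 : 1 ≤ |s| := by rw [abs_of_neg (by linarith)]; linarith
    have hs0 : s ≠ 0 := by linarith
    have hs2 : 0 < s ^ 2 := by positivity
    have h1 : |σ / (2 * s)| = 1 / (2 * |s|) := by rw [abs_div, hσ, abs_mul, abs_two]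
    have h2 : |δ * (F₂ s - F₁ s) / (4 * s ^ 2)| ≤ 2 * M / (4 * s ^ 2) :=
      abs_div_le_of_abs_le (by positivity) (hδΔ s)
    refine (abs_add_le _ _).trans ?_
    rw [h1, ← sq_abs s]
    rw [← sq_abs s] at h2
    have h3 : 2 * M / (4 * |s| ^ 2) ≤ M / |s| := by
      rw [div_le_div_iff₀ (by positivity) (by positivity)]
      nlinarith [mul_nonneg hM (abs_nonneg s), mul_nonneg (mul_nonneg hM (abs_nonneg s)) (sub_nonneg.2 hs1)]
    have h4 : 1 / (2 * |s|) ≤ 1 / |s| := by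
      gcongr; linarith
    rw [add_div]; linarith
  obtain ⟨a, -, ha⟩ := exists_limit_of_deriv_le_sq
    (C := M * R ^ 2 + 2 * (1 + M) ^ 2 * R + (1 + M) * R ^ 3)
    (fun s hs => h.hasDerivAt_amplitude hσ2 hs (hΦ s) (hΔ s)) (fun s hs => by
      rw [norm_smul, norm_cexp_I_mul, one_mul, norm_rot_apply hA]
      have hs1 : 1 ≤ |s| := by rw [abs_of_neg (by linarith)]; linarith
      have hs0 : s ≠ 0 := by linarith
      have hs2 : 0 < s ^ 2 := by positivity
      have ha : |δ * (F₂ s - F₁ s) / (4 * s ^ 2)| ≤ M / 2 / s ^ 2 :=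
        (abs_div_le_of_abs_le (by positivity) (hδΔ s)).trans_eq (by field_simp; ring)
      have hb1 : |δ ^ 2 * (F₂ s - F₁ s) ^ 2 / (4 * s ^ 2)| ≤ M ^ 2 / s ^ 2 :=
        (abs_div_le_of_abs_le (c := (2 * M) ^ 2) (by positivity) (by
          rw [← mul_pow, abs_pow]; gcongr; exact hδΔ s)).trans_eq (by field_simp; ring)
      have hb2 : |-σ / (2 * s ^ 2)| ≤ 1 / 2 / s ^ 2 :=
        (abs_div_le_of_abs_le (c := 1) (by positivity) (by rw [abs_neg, hσ])).trans_eq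
          (by field_simp)
      have hb3 : |δ * Δ' s / (4 * s ^ 2)| ≤ M / 2 / s ^ 2 :=
        (abs_div_le_of_abs_le (by positivity) (hδΔ' s)).trans_eq (by field_simp; ring)
      have hb4 : |δ * (F₂ s - F₁ s) / (2 * s ^ 3)| ≤ M / s ^ 2 := by
        rw [abs_div, abs_mul 2, abs_two, abs_pow, div_le_div_iff₀ (by positivity) hs2, ← sq_abs]
        have h5 : |s| ^ 2 ≤ |s| ^ 3 := pow_le_pow_right₀ hs1 (by norm_num)
        calc |δ * (F₂ s - F₁ s)| * |s| ^ 2 ≤ 2 * M * |s| ^ 3 := by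
              gcongr; exact hδΔ s
          _ = M * (2 * |s| ^ 3) := by ring
      have hc : |σ / (2 * s) * (σ / (2 * s) + δ * (F₂ s - F₁ s) / (4 * s ^ 2))|
          ≤ (1 + M) / 2 / s ^ 2 := by
        rw [abs_mul, abs_div, hσ, abs_mul, abs_two]
        calc 1 / (2 * |s|) * _ ≤ 1 / (2 * |s|) * ((1 + M) / |s|) := by gcongr; exact hν s hs
          _ = (1 + M) / 2 / s ^ 2 := by rw [← sq_abs s]; field_simp
      refine (norm_add_le _ _).trans ((add_le_add_left (norm_add_le _ _) _).trans ?_)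
      simp only [norm_smul, norm_mul, norm_neg, Complex.norm_I, one_mul, Complex.norm_real,
        Real.norm_eq_abs]
      have hb : ‖Complex.I * ((δ ^ 2 * (F₂ s - F₁ s) ^ 2 / (4 * s ^ 2) : ℝ) : ℂ) +
          ((-σ / (2 * s ^ 2) + δ * Δ' s / (4 * s ^ 2) -
            δ * (F₂ s - F₁ s) / (2 * s ^ 3) : ℝ) : ℂ)‖ ≤ (1 + M) ^ 2 / s ^ 2 := by
        refine (norm_add_le _ _).trans ?_
        rw [norm_mul, Complex.norm_I, one_mul, Complex.norm_real, Complex.norm_real,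
          Real.norm_eq_abs, Real.norm_eq_abs]
        have h6 := (abs_sub _ _).trans (add_le_add (abs_add_le _ _) le_rfl) |>.trans
          (add_le_add (add_le_add hb2 hb3) hb4)
        refine (add_le_add hb1 h6).trans ?_
        rw [← add_div, ← add_div, ← add_div]
        gcongr
        nlinarith
      calc _ ≤ M / 2 / s ^ 2 * (2 * R ^ 2) + (1 + M) ^ 2 / s ^ 2 * (2 * R) +
            (1 + M) / 2 / s ^ 2 * (2 * R ^ 3) := by
            gcongr
            exacts [hQ s, hP s, by rw [← abs_mul]; exact hc, hS s]
        _ = _ := by ring)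
  refine ⟨a, fun s hs => ?_⟩
  have h1 := ha s hs
  set E := Complex.exp (Complex.I * ((σ * s ^ 2 / 2 + δ * Φ s : ℝ) : ℂ)) with hE
  set E' := Complex.exp (Complex.I * ((-(σ * s ^ 2 / 2 + δ * Φ s) : ℝ) : ℂ)) with hE'
  have hEE : E * E' = 1 := by
    rw [hE, hE', ← Complex.exp_add, ← mul_add, ← Complex.ofReal_add, add_neg_cancel]; simp
  set A := B * ContinuousLinearMap.adjoint B
  set ν := σ / (2 * s) + δ * (F₂ s - F₁ s) / (4 * s ^ 2) with hν_def
  have h2 : y₁ s - E • rot A (σ * (Real.log s / 2)) a =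
      E • rot A (σ * (Real.log s / 2)) (E' • rot A (-(σ * (Real.log s / 2)))
        (y₁ s + (ν : ℂ) • B (y₂ s)) - a) - (ν : ℂ) • B (y₂ s) := by
    rw [map_sub, map_smul, smul_sub, smul_smul, hEE, one_smul, rot_neg_rot]
    abel
  rw [h2]
  refine (norm_sub_le _ _).trans ?_
  rw [norm_smul, norm_cexp_I_mul, one_mul, norm_rot_apply hA, norm_smul, Complex.norm_real,
    Real.norm_eq_abs]
  calc _ ≤ (M * R ^ 2 + 2 * (1 + M) ^ 2 * R + (1 + M) * R ^ 3) / |s| +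
        (1 + M) / |s| * (2 * R) := by
        gcongr
        exacts [hν s hs, hP s]
    _ = _ := by rw [ampC]; ring

end LandauZener
end

/-! ### Convergence of the population and of the nonlinear phases. -/

noncomputable section
namespace LandauZener

section Population

/-- Evolution of the population `x = ‖u₁‖²` and of the coherence `⟪u₁, G u₂⟫ = ρ + i ι`. -/
structure Pop (δ : ℝ) (k : ℝ → ℝ) (N M W Y : ℝ) (x ρ ι X : ℝ → ℝ) : Prop where
  dx : ∀ s, HasDerivAt x (-2 * ι s) s
  dρ : ∀ s, HasDerivAt ρ (2 * s * ι s - δ * k (x s) * ι s) s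
  dι : ∀ s, HasDerivAt ι (-2 * s * ρ s + X s + δ * k (x s) * ρ s) s
  mem : ∀ s, x s ∈ Set.Icc 0 N
  bρ : ∀ s, |ρ s| ≤ W
  bι : ∀ s, |ι s| ≤ W
  bX : ∀ s, |X s| ≤ Y
  bk : ∀ a ∈ Set.Icc 0 N, |k a| ≤ 2 * M
  ck : Continuous k
  hδ : |δ| ≤ 1
  hN : N ≤ 4
  hM : 0 ≤ M

/-- The constant of the first order convergence of the population. -/
def popC₁ (M W : ℝ) : ℝ := 2 * W + 8 * M

/-- The constant of the second order convergence of the population. -/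
def popC₂ (M W Y : ℝ) : ℝ := 2 * M * popC₁ M W + Y + 2 * M * W + 4 * W

variable {δ : ℝ} {k : ℝ → ℝ} {N M W Y : ℝ} {x ρ ι X : ℝ → ℝ}

theorem Pop.hasDerivAt_integral (h : Pop δ k N M W Y x ρ ι X) (a : ℝ) :
    HasDerivAt (fun a => ∫ t in (0 : ℝ)..a, k t) (k a) a :=
  intervalIntegral.integral_hasDerivAt_right (h.ck.intervalIntegrable _ _)
    (h.ck.stronglyMeasurableAtFilter _ _) h.ck.continuousAt

theorem Pop.abs_integral_sub_le (h : Pop δ k N M W Y x ρ ι X) {a b : ℝ}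
    (ha : a ∈ Set.Icc 0 N) (hb : b ∈ Set.Icc 0 N) :
    |(∫ t in (0 : ℝ)..a, k t) - ∫ t in (0 : ℝ)..b, k t| ≤ 2 * M * |a - b| := by
  rw [intervalIntegral.integral_interval_sub_left (h.ck.intervalIntegrable _ _)
    (h.ck.intervalIntegrable _ _)]
  exact intervalIntegral.norm_integral_le_of_norm_le_const (f := k) fun t ht =>
    h.bk t (Set.uIcc_subset_Icc hb ha (Set.uIoc_subset_uIcc ht))

/-- The primitive which exhibits the oscillations of the population. -/
theorem Pop.hasDerivAt_corrected (h : Pop δ k N M W Y x ρ ι X) {s : ℝ} (hs : s ≤ -1) (c : ℝ) :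
    HasDerivAt (fun s => x s + ρ s / s - δ / 2 * ((∫ t in (0 : ℝ)..x s, k t) - c) / s)
      ((-ρ s + δ / 2 * ((∫ t in (0 : ℝ)..x s, k t) - c)) / s ^ 2) s := by
  have hs0 : s ≠ 0 := by linarith
  -- With `K` a primitive of `k`, `dρ` gives `2ι = (ρ' + δ k ι)/s`, and `δ k ι = -(δ/2) (K(x))'` by
  -- `dx`. Hence `x' = -(ρ' - (δ/2) (K(x))')/s`, and only derivatives of `1/s` remain; the additive
  -- constant `c` in `K` is free.
  have h1 := (h.hasDerivAt_integral (x s)).comp s (h.dx s)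
  have h2 := ((h.dx s).fun_add ((h.dρ s).fun_div (hasDerivAt_id s) hs0)).fun_sub
    (((h1.sub_const c).const_mul (δ / 2)).fun_div (hasDerivAt_id s) hs0)
  refine h2.congr_deriv ?_
  simp only [id, Function.comp]
  field_simp
  ring

theorem one_le_abs_of_le_neg_one {s : ℝ} (hs : s ≤ -1) : 1 ≤ |s| := by
  rw [abs_of_neg (by linarith)]; linarith

/-- The corrected population has a derivative `O(1/s²)`, which gives the limit and the first rate.
For the second rate the constant `c` is adjusted to the limit, so that the integral term becomes
`O(1/|s|)`; the remaining `-ρ/s²` oscillates and is removed by `ι/(2s³)`, because `ι' = -2sρ +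
O(1)`. -/
theorem Pop.exists_limit (h : Pop δ k N M W Y x ρ ι X) :
    ∃ x₀ ∈ Set.Icc 0 N, Tendsto x atBot (𝓝 x₀) ∧ (∀ s ≤ -1, |x s - x₀| ≤ popC₁ M W / |s|) ∧
      ∀ s ≤ -1, |x s + ρ s / s - x₀| ≤ popC₂ M W Y / s ^ 2 := by
  have hN0 : (0 : ℝ) ∈ Set.Icc 0 N := ⟨le_rfl, (h.mem 0).1.trans (h.mem 0).2⟩
  have hM := h.hM
  have hW : 0 ≤ W := (abs_nonneg _).trans (h.bρ 0)
  have hY : 0 ≤ Y := (abs_nonneg _).trans (h.bX 0)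
  have hC₁ : 0 ≤ popC₁ M W := by unfold popC₁; positivity
  have hint : ∀ s, |δ / 2 * ((∫ t in (0 : ℝ)..x s, k t) - 0)| ≤ 4 * M := fun s => by
    have h1 := h.abs_integral_sub_le (h.mem s) hN0
    rw [intervalIntegral.integral_same, sub_zero, sub_zero, abs_of_nonneg (h.mem s).1] at h1
    rw [abs_mul, abs_div, abs_two, sub_zero]
    have h2 := h.hδ
    have h3 : |∫ t in (0 : ℝ)..x s, k t| ≤ 8 * M := by nlinarith [(h.mem s).2, h.hN, (h.mem s).1]
    nlinarith [abs_nonneg (∫ t in (0 : ℝ)..x s, k t), abs_nonneg δ]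
  obtain ⟨x₀, -, hx₀⟩ := exists_limit_of_deriv_le_sq (C := W + 4 * M)
    (fun s hs => h.hasDerivAt_corrected hs 0) (fun s hs => by
      have hs0 : s ≠ 0 := by linarith
      refine abs_div_le_of_abs_le (by positivity) ((abs_add_le _ _).trans ?_)
      rw [abs_neg]
      exact add_le_add (h.bρ s) (hint s))
  have hconv : ∀ s ≤ -1, |x s - x₀| ≤ popC₁ M W / |s| := fun s hs => by
    have h1 : |x s + ρ s / s - δ / 2 * ((∫ t in (0 : ℝ)..x s, k t) - 0) / s - x₀| ≤ _ := hx₀ s hs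
    have h2 : |ρ s / s| ≤ W / |s| := by rw [abs_div]; gcongr; exact h.bρ s
    have h3 : |δ / 2 * ((∫ t in (0 : ℝ)..x s, k t) - 0) / s| ≤ 4 * M / |s| := by
      rw [abs_div]; gcongr; exact hint s
    have h4 : popC₁ M W / |s| = (W + 4 * M) / |s| + W / |s| + 4 * M / |s| := by
      rw [popC₁]; ring
    rw [h4]
    rw [abs_le] at *
    constructor <;> linarith [h1.1, h1.2, h2.1, h2.2, h3.1, h3.2]
  have hlim : Tendsto x atBot (𝓝 x₀) := by
    rw [tendsto_iff_norm_sub_tendsto_zero]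
    refine squeeze_zero' (Eventually.of_forall fun _ => norm_nonneg _) ?_
      (tendsto_const_div_abs_atBot (popC₁ M W))
    filter_upwards [eventually_le_atBot (-1)] with s hs using hconv s hs
  have hx₀N : x₀ ∈ Set.Icc 0 N := isClosed_Icc.mem_of_tendsto hlim (Eventually.of_forall h.mem)
  refine ⟨x₀, hx₀N, hlim, hconv, ?_⟩
  -- Normalising the primitive to vanish at `x₀` makes its value at `x s` as small as `x s - x₀`.
  set c := ∫ t in (0 : ℝ)..x₀, k t
  have hdif : ∀ s ≤ -1, |δ / 2 * ((∫ t in (0 : ℝ)..x s, k t) - c)| ≤ M * popC₁ M W / |s| :=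
    fun s hs => by
      have h1 := h.abs_integral_sub_le (h.mem s) hx₀N
      have h2 := hconv s hs
      rw [abs_mul, abs_div, abs_two]
      calc |δ| / 2 * _ ≤ 1 / 2 * (2 * M * (popC₁ M W / |s|)) := by
            gcongr
            · exact h.hδ
            · exact h1.trans (by gcongr)
        _ = _ := by ring
  have hlast : ∀ s ≤ -1, |ι s / (2 * s ^ 3)| ≤ W / s ^ 2 := fun s hs => by
    have hs1 := one_le_abs_of_le_neg_one hs
    rw [abs_div, abs_mul, abs_two, abs_pow, ← sq_abs s]
    rw [div_le_div_iff₀ (by positivity) (by positivity)]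
    have : |s| ^ 2 ≤ |s| ^ 3 := pow_le_pow_right₀ hs1 (by norm_num)
    calc |ι s| * |s| ^ 2 ≤ W * |s| ^ 3 := by gcongr; exact h.bι s
      _ ≤ W * (2 * |s| ^ 3) := by gcongr; linarith [pow_nonneg (abs_nonneg s) 3]
  obtain ⟨l, hl, hb⟩ := exists_limit_of_deriv_le_cube
    (C := (M * popC₁ M W + Y / 2 + M * W + 3 * W / 2) / 2)
    (y := fun s => (x s + ρ s / s - δ / 2 * ((∫ t in (0 : ℝ)..x s, k t) - c) / s) -
      ι s / (2 * s ^ 3))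
    (y' := fun s => δ / 2 * ((∫ t in (0 : ℝ)..x s, k t) - c) / s ^ 2 -
      (X s + δ * k (x s) * ρ s) / (2 * s ^ 3) + 3 * ι s / (2 * s ^ 4)) (fun s hs => by
      have hs0 : s ≠ 0 := by linarith
      have h2 := (h.hasDerivAt_corrected hs c).fun_sub
        ((h.dι s).fun_div ((hasDerivAt_pow 3 s).const_mul 2) (by positivity))
      refine h2.congr_deriv ?_
      field_simp
      push_cast
      ring) (fun s hs => by
      have hs1 := one_le_abs_of_le_neg_one hs
      have hs3 : |s| ^ 3 ≤ |s| ^ 4 := pow_le_pow_right₀ hs1 (by norm_num)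
      have h1 : |δ / 2 * ((∫ t in (0 : ℝ)..x s, k t) - c) / s ^ 2| ≤ M * popC₁ M W / |s| ^ 3 := by
        rw [abs_div, abs_pow, div_le_iff₀ (by positivity)]
        refine (hdif s hs).trans_eq ?_
        field_simp
      have h2 : |(X s + δ * k (x s) * ρ s) / (2 * s ^ 3)| ≤ (Y / 2 + M * W) / |s| ^ 3 := by
        rw [abs_div, abs_mul, abs_two, abs_pow, div_le_div_iff₀ (by positivity) (by positivity)]
        have h3 : |X s + δ * k (x s) * ρ s| ≤ Y + 2 * M * W := by
          refine (abs_add_le _ _).trans (add_le_add (h.bX s) ?_)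
          rw [abs_mul, abs_mul]
          calc |δ| * |k (x s)| * |ρ s| ≤ 1 * (2 * M) * W := by
                gcongr
                exacts [h.hδ, h.bk _ (h.mem s), h.bρ s]
            _ = _ := by ring
        calc _ ≤ (Y + 2 * M * W) * |s| ^ 3 := by gcongr
          _ = _ := by ring
      have h4 : |3 * ι s / (2 * s ^ 4)| ≤ 3 * W / 2 / |s| ^ 3 := by
        rw [abs_div, abs_mul, abs_mul, abs_two, abs_pow, div_le_div_iff₀ (by positivity)
          (by positivity), abs_of_pos (by norm_num : (0 : ℝ) < 3)]
        calc 3 * |ι s| * |s| ^ 3 ≤ 3 * W * |s| ^ 4 := by gcongr; exact h.bι s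
          _ = _ := by ring
      refine (abs_add_le _ _).trans ((add_le_add (abs_sub _ _) le_rfl).trans
        ((add_le_add (add_le_add h1 h2) h4).trans_eq ?_))
      ring)
  have hl0 : l = x₀ := by
    refine tendsto_nhds_unique hl ?_
    have hsm : ∀ {p : ℝ → ℝ} {C : ℝ}, (∀ s ≤ -1, |p s| ≤ C / |s|) → Tendsto p atBot (𝓝 0) :=
      fun hp => squeeze_zero_norm' (by
        filter_upwards [eventually_le_atBot (-1)] with s hs using hp s hs)
        (tendsto_const_div_abs_atBot _)
    have h1 : Tendsto (fun s => ρ s / s) atBot (𝓝 0) := hsm (C := W) fun s hs => by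
      rw [abs_div]; gcongr; exact h.bρ s
    have h2 : Tendsto (fun s => δ / 2 * ((∫ t in (0 : ℝ)..x s, k t) - c) / s) atBot (𝓝 0) :=
      hsm (C := M * popC₁ M W) fun s hs => by
        have hs1 := one_le_abs_of_le_neg_one hs
        rw [abs_div]; gcongr
        refine (hdif s hs).trans (div_le_self (by positivity) hs1)
    have h3 : Tendsto (fun s => ι s / (2 * s ^ 3)) atBot (𝓝 0) := hsm (C := W) fun s hs => by
      have hs1 := one_le_abs_of_le_neg_one hs
      refine (hlast s hs).trans ?_
      rw [← sq_abs]
      gcongr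
      nlinarith
    simpa using ((hlim.add h1).sub h2).sub h3
  intro s hs
  have hs1 := one_le_abs_of_le_neg_one hs
  have h1 : |(x s + ρ s / s - δ / 2 * ((∫ t in (0 : ℝ)..x s, k t) - c) / s) -
      ι s / (2 * s ^ 3) - l| ≤ _ := hb s hs
  have h2 : |δ / 2 * ((∫ t in (0 : ℝ)..x s, k t) - c) / s| ≤ M * popC₁ M W / s ^ 2 := by
    rw [abs_div, ← sq_abs, div_le_iff₀ (by positivity)]
    refine (hdif s hs).trans_eq ?_
    field_simp
  have h3 := hlast s hs
  have h4 : (M * popC₁ M W + Y / 2 + M * W + 3 * W / 2) / 2 / s ^ 2 + M * popC₁ M W / s ^ 2 +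
      W / s ^ 2 ≤ popC₂ M W Y / s ^ 2 := by
    rw [← add_div, ← add_div]
    gcongr
    rw [popC₂]
    nlinarith [mul_nonneg hM hC₁, mul_nonneg hM hW]
  rw [hl0] at h1
  rw [abs_le] at *
  constructor <;> linarith [h1.1, h1.2, h2.1, h2.2, h3.1, h3.2]

/-- The constant of the convergence of nonlinear phases. -/
def phaseC (M W Y : ℝ) : ℝ :=
  M * popC₁ M W ^ 2 + M * popC₂ M W Y + M * (Y / 2 + M * W) + 2 * M * W

/-- Convergence of the phase `∫ g(x)`, for a function `g` with a second order Taylor bound. -/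
theorem Pop.exists_phase_limit (h : Pop δ k N M W Y x ρ ι X) {x₀ : ℝ}
    (h₁ : ∀ s ≤ -1, |x s - x₀| ≤ popC₁ M W / |s|)
    (h₂ : ∀ s ≤ -1, |x s + ρ s / s - x₀| ≤ popC₂ M W Y / s ^ 2) {g Φ : ℝ → ℝ} {D : ℝ}
    (hD : |D| ≤ M) (hg : ∀ a, |g a - g x₀ - D * (a - x₀)| ≤ M * (a - x₀) ^ 2)
    (hΦ : ∀ s, HasDerivAt Φ (g (x s)) s) :
    ∃ κ, ∀ s ≤ -1, |Φ s - g x₀ * s - κ| ≤ phaseC M W Y / |s| := by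
  have hM := h.hM
  have hW : 0 ≤ W := (abs_nonneg _).trans (h.bρ 0)
  have hY : 0 ≤ Y := (abs_nonneg _).trans (h.bX 0)
  -- To second order `g(x) - g(x₀)` equals `-D ρ/s`, by the Taylor bound and `h₂`. This term is not
  -- integrable in absolute value, but it is the derivative of `D ι/(2s²)` up to `O(1/s²)`.
  obtain ⟨κ, -, hκ⟩ := exists_limit_of_deriv_le_sq
    (C := M * popC₁ M W ^ 2 + M * popC₂ M W Y + M * (Y / 2 + M * W) + M * W)
    (y := fun s => Φ s - g x₀ * s - D * (ι s / (2 * s ^ 2)))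
    (y' := fun s => (g (x s) - g x₀ - D * (x s - x₀)) + D * (x s + ρ s / s - x₀) -
      D * ((X s + δ * k (x s) * ρ s) / (2 * s ^ 2)) + D * (ι s / s ^ 3)) (fun s hs => by
      have hs0 : s ≠ 0 := by linarith
      have h3 := ((hΦ s).fun_sub ((hasDerivAt_id s).const_mul (g x₀))).fun_sub
        (((h.dι s).fun_div ((hasDerivAt_pow 2 s).const_mul 2) (by positivity)).const_mul D)
      refine h3.congr_deriv ?_
      field_simp
      push_cast
      ring) (fun s hs => by
      have hs0 : s ≠ 0 := by linarith
      have hs1 := one_le_abs_of_le_neg_one hs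
      have e1 : |g (x s) - g x₀ - D * (x s - x₀)| ≤ M * popC₁ M W ^ 2 / s ^ 2 := by
        refine (hg (x s)).trans ?_
        rw [mul_div_assoc, ← sq_abs s, ← div_pow, ← sq_abs (x s - x₀)]
        gcongr
        exact h₁ s hs
      have e2 : |D * (x s + ρ s / s - x₀)| ≤ M * popC₂ M W Y / s ^ 2 := by
        rw [abs_mul, mul_div_assoc]
        gcongr
        exact h₂ s hs
      have e3 : |D * ((X s + δ * k (x s) * ρ s) / (2 * s ^ 2))| ≤ M * (Y / 2 + M * W) / s ^ 2 := by
        rw [abs_mul, mul_div_assoc]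
        gcongr
        have h3 : |X s + δ * k (x s) * ρ s| ≤ Y + 2 * M * W := by
          refine (abs_add_le _ _).trans (add_le_add (h.bX s) ?_)
          rw [abs_mul, abs_mul]
          calc |δ| * |k (x s)| * |ρ s| ≤ 1 * (2 * M) * W := by
                gcongr
                exacts [h.hδ, h.bk _ (h.mem s), h.bρ s]
            _ = _ := by ring
        refine (abs_div_le_of_abs_le (by positivity) h3).trans_eq ?_
        field_simp
      have e4 : |D * (ι s / s ^ 3)| ≤ M * W / s ^ 2 := by
        rw [abs_mul, mul_div_assoc, abs_div, abs_pow, ← sq_abs s]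
        have : |s| ^ 2 ≤ |s| ^ 3 := pow_le_pow_right₀ hs1 (by norm_num)
        gcongr
        exact h.bι s
      refine (abs_add_le _ _).trans ((add_le_add ((abs_sub _ _).trans
        (add_le_add (abs_add_le _ _) le_rfl)) le_rfl).trans
        ((add_le_add (add_le_add (add_le_add e1 e2) e3) e4).trans_eq ?_))
      ring)
  refine ⟨κ, fun s hs => ?_⟩
  have hs1 := one_le_abs_of_le_neg_one hs
  have e1 : |Φ s - g x₀ * s - D * (ι s / (2 * s ^ 2)) - κ| ≤ _ := hκ s hs
  have e2 : |D * (ι s / (2 * s ^ 2))| ≤ M * W / |s| := by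
    rw [abs_mul, mul_div_assoc, abs_div, abs_mul, abs_two, abs_pow]
    gcongr
    · exact h.bι s
    · nlinarith
  have e3 : phaseC M W Y / |s| = (M * popC₁ M W ^ 2 + M * popC₂ M W Y + M * (Y / 2 + M * W) +
      M * W) / |s| + M * W / |s| := by rw [phaseC]; ring
  rw [e3]
  rw [abs_le] at *
  constructor <;> linarith [e1.1, e1.2, e2.1, e2.2]

end Population

end LandauZener
end

/-! ### Bounds for the nonlinearities. -/

noncomputable section
namespace LandauZener

section Nonlinearity

/-- Quantitative bounds for the nonlinearity on the relevant square. -/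
structure Nice (f : ℝ × ℝ → ℝ) (M : ℝ) : Prop where
  smooth : ContDiff ℝ 2 f
  nonneg : 0 ≤ M
  bound : ∀ a ∈ Set.Icc (0 : ℝ) 4, ∀ b ∈ Set.Icc (0 : ℝ) 4, |f (a, b)| ≤ M
  lip : ∀ a ∈ Set.Icc (0 : ℝ) 4, ∀ b ∈ Set.Icc (0 : ℝ) 4, ∀ c ∈ Set.Icc (0 : ℝ) 4,
    ∀ d ∈ Set.Icc (0 : ℝ) 4, |f (a, b) - f (c, d)| ≤ M * (|a - c| + |b - d|)
  slope : ∀ a ∈ Set.Icc (0 : ℝ) 4, ∀ b ∈ Set.Icc (0 : ℝ) 4, |fderiv ℝ f (a, b) (1, -1)| ≤ M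
  taylor : ∀ N x y, |f (x, N - x) - f (y, N - y) - fderiv ℝ f (y, N - y) (1, -1) * (x - y)| ≤
    M * (x - y) ^ 2

theorem hasDerivAt_antidiagonal {f : ℝ × ℝ → ℝ} (hf : ContDiff ℝ 2 f) (N x : ℝ) :
    HasDerivAt (fun x => f (x, N - x)) (fderiv ℝ f (x, N - x) (1, -1)) x :=
  ((hf.differentiable two_ne_zero) (x, N - x)).hasFDerivAt.comp_hasDerivAt x
    ((hasDerivAt_id x).prodMk ((hasDerivAt_id x).const_sub N))

/-- Solutions of norm at most `2` have populations in `[0, 4]`, so values and first derivatives are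
only needed on a compact square. The bounded second derivative makes the gradient Lipschitz, hence
the Taylor inequality on whole antidiagonals. All larger constants work too, so `f₁` and `f₂` can
share one. -/
theorem exists_nice {f : ℝ × ℝ → ℝ} (hf : ContDiff ℝ 2 f)
    (hb : ∃ M : ℝ, ∀ x, ‖iteratedFDeriv ℝ 2 f x‖ ≤ M) : ∃ M₀, ∀ M ≥ M₀, Nice f M := by
  obtain ⟨M₂, hM₂⟩ := hb
  have hd := hf.differentiable two_ne_zero
  have hf' : ContDiff ℝ 1 (fderiv ℝ f) := hf.fderiv_right (by norm_num)
  have hK : IsCompact (Set.Icc (0 : ℝ) 4 ×ˢ Set.Icc (0 : ℝ) 4) := isCompact_Icc.prod isCompact_Icc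
  obtain ⟨A, hA⟩ := hK.exists_bound_of_continuousOn hf.continuous.continuousOn
  obtain ⟨B, hB⟩ := hK.exists_bound_of_continuousOn hf'.continuous.continuousOn
  have hlip : ∀ p q, ‖fderiv ℝ f p - fderiv ℝ f q‖ ≤ M₂ * ‖p - q‖ := fun p q =>
    convex_univ.norm_image_sub_le_of_norm_fderiv_le
      (fun x _ => hf'.differentiable one_ne_zero x) (fun x _ => by
        rw [← norm_iteratedFDeriv_one, norm_iteratedFDeriv_fderiv]; exact hM₂ x)
      (Set.mem_univ _) (Set.mem_univ _)
  have hM₂0 : 0 ≤ M₂ := (norm_nonneg _).trans (hM₂ 0)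
  refine ⟨max 0 (max A (max B M₂)), fun M hM => ?_⟩
  simp only [ge_iff_le, max_le_iff] at hM
  obtain ⟨h0, hMA, hMB, hMM⟩ := hM
  have hv : ‖((1 : ℝ), (-1 : ℝ))‖ ≤ 1 := by simp [Prod.norm_def]
  refine ⟨hf, h0, fun a ha b hb => (hA (a, b) ⟨ha, hb⟩).trans hMA, ?_, ?_, ?_⟩
  · intro a ha b hb c hc d hd'
    have h1 := ((convex_Icc (0 : ℝ) 4).prod (convex_Icc (0 : ℝ) 4)).norm_image_sub_le_of_norm_fderiv_le
      (f := f) (C := M) (fun x _ => hd x) (fun x hx => (hB x hx).trans hMB)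
      (Set.mk_mem_prod hc hd') (Set.mk_mem_prod ha hb)
    refine h1.trans ?_
    gcongr
    rw [Prod.norm_def]
    exact max_le (le_add_of_nonneg_right (abs_nonneg _)) (le_add_of_nonneg_left (abs_nonneg _))
  · intro a ha b hb
    calc _ ≤ ‖fderiv ℝ f (a, b)‖ * ‖((1 : ℝ), (-1 : ℝ))‖ := (fderiv ℝ f (a, b)).le_opNorm _
      _ ≤ M * 1 := by
        gcongr
        exact (hB (a, b) ⟨ha, hb⟩).trans hMB
      _ = M := mul_one M
  · intro N x y
    have h1 := (convex_uIcc y x).norm_image_sub_le_of_norm_hasDerivWithin_le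
      (f := fun t => f (t, N - t) - fderiv ℝ f (y, N - y) (1, -1) * t)
      (f' := fun t => fderiv ℝ f (t, N - t) (1, -1) - fderiv ℝ f (y, N - y) (1, -1))
      (C := M₂ * |x - y|) (fun t _ => ((hasDerivAt_antidiagonal hf N t).fun_sub
        ((hasDerivAt_id t).const_mul _)).hasDerivWithinAt.congr_deriv (by simp)) (fun t ht => by
        rw [← sub_apply]
        refine (ContinuousLinearMap.le_opNorm _ _).trans ?_
        calc _ ≤ M₂ * ‖(t, N - t) - (y, N - y)‖ * 1 := by
              gcongr
              exact hlip _ _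
          _ ≤ M₂ * |x - y| := by
              rw [mul_one]
              gcongr
              have h2 := Set.abs_sub_left_of_mem_uIcc ht
              simp only [Prod.mk_sub_mk, Prod.norm_def, Real.norm_eq_abs, sub_sub_sub_cancel_left]
              rw [abs_sub_comm y t, max_self]
              exact h2)
      Set.left_mem_uIcc Set.right_mem_uIcc
    rw [Real.norm_eq_abs, Real.norm_eq_abs] at h1
    calc _ = |f (x, N - x) - fderiv ℝ f (y, N - y) (1, -1) * x -
          (f (y, N - y) - fderiv ℝ f (y, N - y) (1, -1) * y)| := by congr 1; ring
      _ ≤ M₂ * |x - y| * |x - y| := h1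
      _ = M₂ * (x - y) ^ 2 := by rw [mul_assoc, abs_mul_abs_self]; ring
      _ ≤ _ := by gcongr

/-- Treats the linear equation as a case of the nonlinear theory, with the same constants. -/
theorem nice_zero {M : ℝ} (hM : 0 ≤ M) : Nice 0 M where
  smooth := contDiff_const
  nonneg := hM
  bound := by simp [hM]
  lip := by intros; simp; positivity
  slope := by simp [fderiv_zero, hM]
  taylor := by intros; simp [fderiv_zero]; positivity

end Nonlinearity

/-! ### Conservation laws and the population system of a solution. -/

section Solutions

variable {H : Type u} [NormedAddCommGroup H] [InnerProductSpace ℂ H] [CompleteSpace H]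

theorem H2.ext {a b : H2 H} (h₁ : a.fst = b.fst) (h₂ : a.snd = b.snd) : a = b :=
  WithLp.ofLp_injective 2 (Prod.ext h₁ h₂)

@[simp] theorem vec_fst (x y : H) : (vec x y).fst = x := rfl
@[simp] theorem vec_snd (x y : H) : (vec x y).snd = y := rfl

theorem norm_sq_eq (a : H2 H) : ‖a‖ ^ 2 = ‖a.fst‖ ^ 2 + ‖a.snd‖ ^ 2 :=
  WithLp.prod_norm_sq_eq_of_L2 a

theorem norm_fst_le (a : H2 H) : ‖a.fst‖ ≤ ‖a‖ :=
  le_of_sq_le_sq (by rw [norm_sq_eq]; linarith [sq_nonneg ‖a.snd‖]) (norm_nonneg _)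

theorem norm_snd_le (a : H2 H) : ‖a.snd‖ ≤ ‖a‖ :=
  le_of_sq_le_sq (by rw [norm_sq_eq]; linarith [sq_nonneg ‖a.fst‖]) (norm_nonneg _)

theorem norm_le_add (a : H2 H) : ‖a‖ ≤ ‖a.fst‖ + ‖a.snd‖ :=
  le_of_sq_le_sq (by
    rw [norm_sq_eq]; nlinarith [mul_nonneg (norm_nonneg a.fst) (norm_nonneg a.snd)]) (by positivity)

theorem hasDerivAt_H2_iff {u : ℝ → H2 H} {u' : H2 H} {s : ℝ} :
    HasDerivAt u u' s ↔ HasDerivAt (fun s => (u s).fst) u'.fst s ∧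
      HasDerivAt (fun s => (u s).snd) u'.snd s := by
  constructor
  · intro h
    exact ⟨(WithLp.fstL 2 ℝ H H).hasFDerivAt.comp_hasDerivAt s h,
      (WithLp.sndL 2 ℝ H H).hasFDerivAt.comp_hasDerivAt s h⟩
  · rintro ⟨h₁, h₂⟩
    exact (WithLp.prodContinuousLinearEquiv 2 ℝ H H).symm.hasFDerivAt.comp_hasDerivAt s
      (h₁.prodMk h₂)

theorem isSolution_iff_sys {G : H →L[ℂ] H} {f₁ f₂ : ℝ × ℝ → ℝ} {δ : ℝ} {u : ℝ → H2 H} :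
    IsSolution G f₁ f₂ δ u ↔ Sys 1 G δ (fun s => nlF f₁ (u s)) (fun s => nlF f₂ (u s))
      (fun s => (u s).fst) (fun s => (u s).snd) := by
  have e₁ : ∀ s, (Complex.I • (V G s (u s) +
      (δ : ℂ) • vec ((nlF f₁ (u s) : ℂ) • (u s).fst) ((nlF f₂ (u s) : ℂ) • (u s).snd))).fst =
      Complex.I • (((1 * s : ℝ) : ℂ) • (u s).fst + G (u s).snd +
        ((δ * nlF f₁ (u s) : ℝ) : ℂ) • (u s).fst) := fun s => by
    simp only [V, WithLp.smul_fst, WithLp.add_fst, vec_fst]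
    push_cast
    module
  have e₂ : ∀ s, (Complex.I • (V G s (u s) +
      (δ : ℂ) • vec ((nlF f₁ (u s) : ℂ) • (u s).fst) ((nlF f₂ (u s) : ℂ) • (u s).snd))).snd =
      Complex.I • (ContinuousLinearMap.adjoint G (u s).fst - ((1 * s : ℝ) : ℂ) • (u s).snd +
        ((δ * nlF f₂ (u s) : ℝ) : ℂ) • (u s).snd) := fun s => by
    simp only [V, WithLp.smul_snd, WithLp.add_snd, vec_snd]
    push_cast
    module
  constructor
  · intro h
    exact ⟨fun s => (hasDerivAt_H2_iff.mp (h s)).1.congr_deriv (e₁ s),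
      fun s => (hasDerivAt_H2_iff.mp (h s)).2.congr_deriv (e₂ s)⟩
  · intro h s
    exact hasDerivAt_H2_iff.mpr ⟨(h.fst s).congr_deriv (e₁ s).symm,
      (h.snd s).congr_deriv (e₂ s).symm⟩

theorem hasDerivAt_re {w : ℝ → ℂ} {w' : ℂ} {s : ℝ} (h : HasDerivAt w w' s) :
    HasDerivAt (fun s => (w s).re) w'.re s := Complex.reCLM.hasFDerivAt.comp_hasDerivAt s h

theorem hasDerivAt_im {w : ℝ → ℂ} {w' : ℂ} {s : ℝ} (h : HasDerivAt w w' s) :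
    HasDerivAt (fun s => (w s).im) w'.im s := Complex.imCLM.hasFDerivAt.comp_hasDerivAt s h

theorem hasDerivAt_norm_sq {E : Type*} [NormedAddCommGroup E] [InnerProductSpace ℂ E]
    {y : ℝ → E} {y' : E} {s : ℝ} (h : HasDerivAt y y' s) :
    HasDerivAt (fun s => ‖y s‖ ^ 2) (2 * (inner ℂ (y s) y').re) s := by
  have h1 := hasDerivAt_re (h.inner ℂ h)
  have h2 : (fun s => (inner ℂ (y s) (y s)).re) = fun s => ‖y s‖ ^ 2 :=
    funext fun s => inner_self_eq_norm_sq (𝕜 := ℂ) (y s)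
  rw [h2] at h1
  refine h1.congr_deriv ?_
  have h3 : (inner ℂ y' (y s)).re = (inner ℂ (y s) y').re := inner_re_symm (𝕜 := ℂ) y' (y s)
  rw [Complex.add_re, h3]; ring

variable {σ : ℝ} {G : H →L[ℂ] H} {δ : ℝ} {F₁ F₂ : ℝ → ℝ} {y₁ y₂ : ℝ → H}

theorem Sys.hasDerivAt_population (h : Sys σ G δ F₁ F₂ y₁ y₂) (s : ℝ) :
    HasDerivAt (fun s => ‖y₁ s‖ ^ 2) (-2 * (inner ℂ (y₁ s) (G (y₂ s))).im) s := by
  refine (hasDerivAt_norm_sq (h.fst s)).congr_deriv ?_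
  rw [inner_smul_right, inner_add_right, inner_add_right, inner_smul_right, inner_smul_right,
    inner_self_eq_norm_sq_to_K]
  simp [← Complex.ofReal_pow]

theorem Sys.hasDerivAt_norm_sq (h : Sys σ G δ F₁ F₂ y₁ y₂) (s : ℝ) :
    HasDerivAt (fun s => ‖y₁ s‖ ^ 2 + ‖y₂ s‖ ^ 2) 0 s := by
  refine ((h.hasDerivAt_population s).fun_add (h.swap.hasDerivAt_population s)).congr_deriv ?_
  rw [ContinuousLinearMap.adjoint_inner_right, ← inner_conj_symm (y₁ s), Complex.conj_im]
  ring

theorem Sys.hasDerivAt_coherence (h : Sys 1 G δ F₁ F₂ y₁ y₂) (s : ℝ) :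
    HasDerivAt (fun s => inner ℂ (y₁ s) (G (y₂ s)))
      (Complex.I * (-(2 * s : ℝ) * inner ℂ (y₁ s) (G (y₂ s)) +
        ((‖ContinuousLinearMap.adjoint G (y₁ s)‖ ^ 2 - ‖G (y₂ s)‖ ^ 2 : ℝ) : ℂ) +
        (δ * (F₂ s - F₁ s) : ℝ) * inner ℂ (y₁ s) (G (y₂ s)))) s := by
  have hGy := (G.restrictScalars ℝ).hasFDerivAt.comp_hasDerivAt s (h.snd s)
  refine ((h.fst s).inner ℂ hGy).congr_deriv ?_
  simp only [ContinuousLinearMap.coe_restrictScalars', Function.comp, map_add, map_sub,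
    map_smul, inner_add_right, inner_sub_right, inner_smul_right, inner_add_left, inner_smul_left,
    ← ContinuousLinearMap.adjoint_inner_left, inner_self_eq_norm_sq_to_K, Complex.conj_I,
    Complex.conj_ofReal]
  rw [ContinuousLinearMap.adjoint_inner_left, ContinuousLinearMap.adjoint_inner_left,
    inner_self_eq_norm_sq_to_K]
  push_cast
  simp only [Complex.coe_algebraMap]
  ring

theorem IsSolution.norm_eq {f₁ f₂ : ℝ × ℝ → ℝ} {u : ℝ → H2 H} (hu : IsSolution G f₁ f₂ δ u)
    (s t : ℝ) : ‖u s‖ = ‖u t‖ := by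
  have h := (isSolution_iff_sys.mp hu).hasDerivAt_norm_sq
  have h1 : ‖u s‖ ^ 2 = ‖u t‖ ^ 2 := by
    rw [norm_sq_eq, norm_sq_eq]
    exact is_const_of_deriv_eq_zero (fun s => (h s).differentiableAt) (fun s => (h s).deriv) s t
  exact (pow_left_inj₀ (norm_nonneg _) (norm_nonneg _) two_ne_zero).mp h1

theorem norm_apply_le {R : ℝ} (hG : ‖G‖ ≤ R) (x : H) : ‖G x‖ ≤ R * ‖x‖ :=
  (G.le_opNorm x).trans (by gcongr)

theorem norm_adjoint_apply_le {R : ℝ} (hG : ‖G‖ ≤ R) (x : H) :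
    ‖ContinuousLinearMap.adjoint G x‖ ≤ R * ‖x‖ :=
  norm_apply_le (by rwa [LinearIsometryEquiv.norm_map]) x

/-- By norm conservation `‖u₂‖²` is determined by `‖u₁‖²`: along a solution every nonlinearity is a
function of one variable. -/
theorem IsSolution.nlF_eq {f₁ f₂ f : ℝ × ℝ → ℝ} {u : ℝ → H2 H} (hu : IsSolution G f₁ f₂ δ u)
    (s : ℝ) : nlF f (u s) = f (‖(u s).fst‖ ^ 2, ‖u 0‖ ^ 2 - ‖(u s).fst‖ ^ 2) := by
  rw [nlF, hu.norm_eq 0 s, norm_sq_eq (u s)]; congr 2; ring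

theorem IsSolution.pop {f₁ f₂ : ℝ × ℝ → ℝ} {u : ℝ → H2 H} {R M : ℝ}
    (hu : IsSolution G f₁ f₂ δ u) (hf₁ : Nice f₁ M) (hf₂ : Nice f₂ M) (hG : ‖G‖ ≤ R)
    (hδ : |δ| ≤ 1) (h2 : ‖u 0‖ ≤ 2) :
    Pop δ (fun a => f₂ (a, ‖u 0‖ ^ 2 - a) - f₁ (a, ‖u 0‖ ^ 2 - a)) (‖u 0‖ ^ 2) M (4 * R)
      (4 * R ^ 2) (fun s => ‖(u s).fst‖ ^ 2) (fun s => (inner ℂ (u s).fst (G (u s).snd)).re)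
      (fun s => (inner ℂ (u s).fst (G (u s).snd)).im)
      (fun s => ‖ContinuousLinearMap.adjoint G (u s).fst‖ ^ 2 - ‖G (u s).snd‖ ^ 2) := by
  have hS := isSolution_iff_sys.mp hu
  have hR : 0 ≤ R := (norm_nonneg G).trans hG
  have hN : ‖u 0‖ ^ 2 ≤ 4 := by nlinarith [norm_nonneg (u 0)]
  have b₁ : ∀ s, ‖(u s).fst‖ ≤ 2 := fun s => (norm_fst_le _).trans ((hu.norm_eq s 0).trans_le h2)
  have b₂ : ∀ s, ‖(u s).snd‖ ≤ 2 := fun s => (norm_snd_le _).trans ((hu.norm_eq s 0).trans_le h2)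
  have bG : ∀ s, ‖G (u s).snd‖ ≤ 2 * R := fun s =>
    (norm_apply_le hG _).trans (by nlinarith [b₂ s])
  have bG' : ∀ s, ‖ContinuousLinearMap.adjoint G (u s).fst‖ ≤ 2 * R := fun s =>
    (norm_adjoint_apply_le hG _).trans (by nlinarith [b₁ s])
  have hw : ∀ s, ‖inner ℂ (u s).fst (G (u s).snd)‖ ≤ 4 * R := fun s =>
    (norm_inner_le_norm _ _).trans (by nlinarith [b₁ s, bG s, norm_nonneg (u s).fst])
  have hre : ∀ (w : ℂ) (a b c : ℝ), (Complex.I * (-(a : ℂ) * w + b + c * w)).re =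
      a * w.im - c * w.im := fun w a b c => by simp; ring
  have him : ∀ (w : ℂ) (a b c : ℝ), (Complex.I * (-(a : ℂ) * w + b + c * w)).im =
      -a * w.re + b + c * w.re := fun w a b c => by simp
  have hbox : ∀ a ∈ Set.Icc 0 (‖u 0‖ ^ 2), a ∈ Set.Icc (0 : ℝ) 4 ∧ ‖u 0‖ ^ 2 - a ∈ Set.Icc (0 : ℝ) 4 :=
    fun a ha => ⟨⟨ha.1, ha.2.trans hN⟩, by constructor <;> linarith [ha.1, ha.2]⟩
  refine ⟨hS.hasDerivAt_population, fun s => ?_, fun s => ?_, fun s => ⟨sq_nonneg _, ?_⟩,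
    fun s => (Complex.abs_re_le_norm _).trans (hw s), fun s => (Complex.abs_im_le_norm _).trans (hw s),
    fun s => ?_, fun a ha => ?_, ?_, hδ, hN, hf₁.nonneg⟩
  · refine (hasDerivAt_re (hS.hasDerivAt_coherence s)).congr_deriv ?_
    simp only [hu.nlF_eq, hre]
  · refine (hasDerivAt_im (hS.hasDerivAt_coherence s)).congr_deriv ?_
    simp only [hu.nlF_eq, him]
    ring
  · rw [hu.norm_eq 0 s, norm_sq_eq (u s)]; linarith [sq_nonneg ‖(u s).snd‖]
  · have h1 : ‖ContinuousLinearMap.adjoint G (u s).fst‖ ^ 2 ≤ (2 * R) ^ 2 := by gcongr; exact bG' s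
    have h3 : ‖G (u s).snd‖ ^ 2 ≤ (2 * R) ^ 2 := by gcongr; exact bG s
    rw [abs_le]
    constructor <;> nlinarith [sq_nonneg ‖G (u s).snd‖, sq_nonneg ‖ContinuousLinearMap.adjoint G (u s).fst‖]
  · have hb := hbox a ha
    refine (abs_sub _ _).trans ?_
    linarith [hf₂.bound a hb.1 _ hb.2, hf₁.bound a hb.1 _ hb.2]
  · have c₁ := hf₁.smooth.continuous
    have c₂ := hf₂.smooth.continuous
    fun_prop

end Solutions

end LandauZener
end

/-! ### Profiles, and asymptotic completeness at minus infinity. -/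

noncomputable section
namespace LandauZener

variable {H : Type u} [NormedAddCommGroup H] [InnerProductSpace ℂ H] [CompleteSpace H]

theorem norm_cexp_sub_cexp_le (a b : ℝ) :
    ‖Complex.exp (Complex.I * a) - Complex.exp (Complex.I * b)‖ ≤ |a - b| := by
  have h : Complex.exp (Complex.I * a) - Complex.exp (Complex.I * b) =
      Complex.exp (Complex.I * b) * (Complex.exp (Complex.I * ((a - b : ℝ) : ℂ)) - 1) := by
    rw [mul_sub, ← Complex.exp_add, mul_one]; push_cast; ring_nf
  rw [h, norm_mul, norm_cexp_I_mul, one_mul]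
  exact Real.norm_exp_I_mul_ofReal_sub_one_le

theorem exp_smul_one_add (c : ℂ) (X : H →L[ℂ] H) :
    NormedSpace.exp (c • (1 : H →L[ℂ] H) + X) = Complex.exp c • NormedSpace.exp X := by
  let _ : NormedAlgebra ℚ (H →L[ℂ] H) := .restrictScalars ℚ ℂ _
  rw [NormedSpace.exp_add_of_commute ((Commute.one_left X).smul_left c),
    ← Algebra.algebraMap_eq_smul_one, ← NormedSpace.algebraMap_exp_comm, Complex.exp_eq_exp_ℂ,
    Algebra.algebraMap_eq_smul_one, smul_mul_assoc, one_mul]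

theorem exp_I_phase (s : ℝ) (A : H →L[ℂ] H) : NormedSpace.exp (Complex.I • phase s A) =
    Complex.exp (Complex.I * ((s ^ 2 / 2 : ℝ) : ℂ)) • rot A (Real.log s / 2) := by
  rw [rot, ← exp_smul_one_add, phase, Real.log_abs]
  congr 1
  rw [← Complex.coe_smul]
  module

theorem exp_neg_I_phase (s : ℝ) (A : H →L[ℂ] H) : NormedSpace.exp (-(Complex.I • phase s A)) =
    Complex.exp (Complex.I * ((-(s ^ 2 / 2) : ℝ) : ℂ)) • rot A (-(Real.log s / 2)) := by
  rw [rot, ← exp_smul_one_add, phase, Real.log_abs]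
  congr 1
  rw [← Complex.coe_smul]
  push_cast
  module

variable {G : H →L[ℂ] H} {f₁ f₂ : ℝ × ℝ → ℝ} {δ : ℝ}

theorem profile_fst (G : H →L[ℂ] H) (f₁ f₂ : ℝ × ℝ → ℝ) (δ ϕ : ℝ) (α : H2 H) (s : ℝ) :
    (profile G f₁ f₂ δ ϕ α s).fst =
      Complex.exp (Complex.I * ((s ^ 2 / 2 + δ * (nlF f₁ α * s) + ϕ : ℝ) : ℂ)) •
        rot (GGs G) (Real.log s / 2) α.fst := by
  rw [profile, vec_fst, exp_I_phase, smul_apply, smul_smul, ← Complex.exp_add]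
  congr 2
  push_cast
  ring

theorem profile_snd (G : H →L[ℂ] H) (f₁ f₂ : ℝ × ℝ → ℝ) (δ ϕ : ℝ) (α : H2 H) (s : ℝ) :
    (profile G f₁ f₂ δ ϕ α s).snd =
      Complex.exp (Complex.I * ((-(s ^ 2 / 2) + δ * (nlF f₂ α * s) - ϕ : ℝ) : ℂ)) •
        rot (GsG G) (-(Real.log s / 2)) α.snd := by
  rw [profile, vec_snd, exp_neg_I_phase, smul_apply, smul_smul,
    ← Complex.exp_add]
  congr 2
  push_cast
  ring

theorem isSelfAdjoint_GGs (G : H →L[ℂ] H) : IsSelfAdjoint (GGs G) := IsSelfAdjoint.mul_star_self G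

theorem isSelfAdjoint_GsG (G : H →L[ℂ] H) : IsSelfAdjoint (GsG G) := IsSelfAdjoint.star_mul_self G

theorem norm_profile_fst (δ ϕ : ℝ) (α : H2 H) (s : ℝ) :
    ‖(profile G f₁ f₂ δ ϕ α s).fst‖ = ‖α.fst‖ := by
  rw [profile_fst, norm_smul, norm_cexp_I_mul, one_mul, norm_rot_apply (isSelfAdjoint_GGs G)]

theorem norm_profile_snd (δ ϕ : ℝ) (α : H2 H) (s : ℝ) :
    ‖(profile G f₁ f₂ δ ϕ α s).snd‖ = ‖α.snd‖ := by
  rw [profile_snd, norm_smul, norm_cexp_I_mul, one_mul, norm_rot_apply (isSelfAdjoint_GsG G)]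

theorem norm_profile (δ ϕ : ℝ) (α : H2 H) (s : ℝ) : ‖profile G f₁ f₂ δ ϕ α s‖ = ‖α‖ := by
  have h : ‖profile G f₁ f₂ δ ϕ α s‖ ^ 2 = ‖α‖ ^ 2 := by
    rw [norm_sq_eq, norm_sq_eq, norm_profile_fst, norm_profile_snd]
  exact (pow_left_inj₀ (norm_nonneg _) (norm_nonneg _) two_ne_zero).mp h

theorem tendsto_norm_of_norm_sub_le {E : Type*} [SeminormedAddCommGroup E] {l : Filter ℝ}
    {y z : ℝ → E} {c : ℝ} {b : ℝ → ℝ} (h : ∀ᶠ s in l, ‖y s - z s‖ ≤ b s) (hz : ∀ s, ‖z s‖ = c)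
    (hb : Tendsto b l (𝓝 0)) : Tendsto (fun s => ‖y s‖) l (𝓝 c) := by
  rw [tendsto_iff_norm_sub_tendsto_zero]
  refine squeeze_zero' (Eventually.of_forall fun _ => norm_nonneg _) ?_ hb
  filter_upwards [h] with s hs
  rw [← hz s]
  exact (abs_norm_sub_norm_le _ _).trans hs

theorem eventually_atBot_of_le_neg_one {p : ℝ → Prop} (h : ∀ s ≤ -1, p s) : ∀ᶠ s in atBot, p s := by
  filter_upwards [eventually_le_atBot (-1)] with s hs using h s hs

theorem phaseC_nonneg {M W Y : ℝ} (hM : 0 ≤ M) (hW : 0 ≤ W) (hY : 0 ≤ Y) : 0 ≤ phaseC M W Y := by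
  unfold phaseC popC₂ popC₁; positivity

theorem popC₂_nonneg {M W Y : ℝ} (hM : 0 ≤ M) (hW : 0 ≤ W) (hY : 0 ≤ Y) : 0 ≤ popC₂ M W Y := by
  unfold popC₂ popC₁; positivity

theorem ampC_nonneg {R M : ℝ} (hR : 0 ≤ R) (hM : 0 ≤ M) : 0 ≤ ampC R M := by
  unfold ampC; positivity

/-- The constant of the asymptotic expansion at `-∞`. -/
def pastC (R M : ℝ) : ℝ :=
  2 * (ampC R (M + 8 * M * R) + 2 * phaseC M (4 * R) (4 * R ^ 2)) +
    phaseC M (4 * R) (4 * R ^ 2) + popC₂ M (4 * R) (4 * R ^ 2)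

theorem pastC_nonneg {R M : ℝ} (hR : 0 ≤ R) (hM : 0 ≤ M) : 0 ≤ pastC R M := by
  have h1 := phaseC_nonneg hM (W := 4 * R) (by positivity) (Y := 4 * R ^ 2) (by positivity)
  have h2 := popC₂_nonneg hM (W := 4 * R) (by positivity) (Y := 4 * R ^ 2) (by positivity)
  have h3 := ampC_nonneg hR (M := M + 8 * M * R) (by positivity)
  unfold pastC; positivity

/-- The asymptotic description of a solution `u` at `-∞` with state `α`. -/
structure PastExpansion (G : H →L[ℂ] H) (f₁ f₂ : ℝ × ℝ → ℝ) (δ C : ℝ) (u : ℝ → H2 H) (α : H2 H) :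
    Prop where
  norm_eq : ‖α‖ = ‖u 0‖
  sub_profile : ∀ s ≤ -1, ‖u s - profile G f₁ f₂ δ 0 α s‖ ≤ C / |s|
  population : ∀ s ≤ -1, |‖(u s).fst‖ ^ 2 + (inner ℂ (u s).fst (G (u s).snd)).re / s -
    ‖α.fst‖ ^ 2| ≤ C / s ^ 2

theorem IsSolution.continuous {u : ℝ → H2 H} (hu : IsSolution G f₁ f₂ δ u) : Continuous u :=
  continuous_iff_continuousAt.mpr fun s => (hu s).continuousAt

theorem continuous_nlF {f : ℝ × ℝ → ℝ} (hf : Continuous f) {u : ℝ → H2 H} (hu : Continuous u) :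
    Continuous fun s => nlF f (u s) := by
  have h1 : Continuous fun s => (u s).fst := (WithLp.fstL 2 ℝ H H).continuous.comp hu
  have h2 : Continuous fun s => (u s).snd := (WithLp.sndL 2 ℝ H H).continuous.comp hu
  exact hf.comp ((h1.norm.pow 2).prodMk (h2.norm.pow 2))

theorem hasDerivAt_integral_of_continuous {F : ℝ → ℝ} (hF : Continuous F) (s : ℝ) :
    HasDerivAt (fun s => ∫ t in (0 : ℝ)..s, F t) (F s) s :=
  intervalIntegral.integral_hasDerivAt_right (hF.intervalIntegrable _ _)
    (hF.stronglyMeasurableAtFilter _ _) hF.continuousAt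

/-- For any nonlinearity `f`, the phase `∫ f(u)` of a solution has an asymptote. -/
theorem IsSolution.exists_phase {u : ℝ → H2 H} {R M : ℝ}
    (hu : IsSolution G f₁ f₂ δ u) (hf₁ : Nice f₁ M) (hf₂ : Nice f₂ M) (hG : ‖G‖ ≤ R)
    (hδ : |δ| ≤ 1) (h2 : ‖u 0‖ ≤ 2) {f : ℝ × ℝ → ℝ} (hf : Nice f M) {x₀ : ℝ}
    (hx₀ : x₀ ∈ Set.Icc 0 (‖u 0‖ ^ 2))
    (h₁ : ∀ s ≤ -1, |‖(u s).fst‖ ^ 2 - x₀| ≤ popC₁ M (4 * R) / |s|)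
    (hpop : ∀ s ≤ -1, |‖(u s).fst‖ ^ 2 + (inner ℂ (u s).fst (G (u s).snd)).re / s - x₀| ≤
      popC₂ M (4 * R) (4 * R ^ 2) / s ^ 2) :
    ∃ κ, ∀ s ≤ -1, |(∫ t in (0 : ℝ)..s, nlF f (u t)) - f (x₀, ‖u 0‖ ^ 2 - x₀) * s - κ| ≤
      phaseC M (4 * R) (4 * R ^ 2) / |s| := by
  have hN : ‖u 0‖ ^ 2 ≤ 4 := by nlinarith [norm_nonneg (u 0)]
  refine (hu.pop hf₁ hf₂ hG hδ h2).exists_phase_limit h₁ hpop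
    (g := fun a => f (a, ‖u 0‖ ^ 2 - a))
    (hf.slope x₀ ⟨hx₀.1, hx₀.2.trans hN⟩ (‖u 0‖ ^ 2 - x₀) (by constructor <;> linarith [hx₀.1, hx₀.2]))
    (fun a => hf.taylor _ _ _) fun s => ?_
  exact (hasDerivAt_integral_of_continuous (continuous_nlF hf.smooth.continuous hu.continuous)
    s).congr_deriv (hu.nlF_eq s)

theorem IsSolution.hasDerivAt_nlF {u : ℝ → H2 H} (hu : IsSolution G f₁ f₂ δ u)
    {f : ℝ × ℝ → ℝ} (hf : ContDiff ℝ 2 f) (s : ℝ) : HasDerivAt (fun s => nlF f (u s))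
      (fderiv ℝ f (‖(u s).fst‖ ^ 2, ‖u 0‖ ^ 2 - ‖(u s).fst‖ ^ 2) (1, -1) *
        (-2 * (inner ℂ (u s).fst (G (u s).snd)).im)) s := by
  have h1 := (hasDerivAt_antidiagonal hf (‖u 0‖ ^ 2) (‖(u s).fst‖ ^ 2)).comp s
    ((isSolution_iff_sys.mp hu).hasDerivAt_population s)
  have h2 : (fun s => nlF f (u s)) =
    (fun x => f (x, ‖u 0‖ ^ 2 - x)) ∘ fun s => ‖(u s).fst‖ ^ 2 := funext fun s => hu.nlF_eq s
  rw [h2]; exact h1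

theorem IsSolution.abs_nlF_le {u : ℝ → H2 H} (hu : IsSolution G f₁ f₂ δ u) (h2 : ‖u 0‖ ≤ 2)
    {f : ℝ × ℝ → ℝ} {M : ℝ} (hf : Nice f M) (s : ℝ) : |nlF f (u s)| ≤ M := by
  have h1 : ‖u s‖ ≤ 2 := (hu.norm_eq s 0).trans_le h2
  have h3 := norm_fst_le (u s)
  have h4 := norm_snd_le (u s)
  exact hf.bound _ ⟨sq_nonneg _, by nlinarith [norm_nonneg (u s).fst]⟩ _
    ⟨sq_nonneg _, by nlinarith [norm_nonneg (u s).snd]⟩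

/-- Each antidiagonal slope is at most `M` and `|x'| ≤ 8R`. The bound is enlarged by `2M` so that
one constant controls both the difference of the potentials and its derivative in
`Sys.exists_amplitude`. -/
theorem IsSolution.exists_deriv_nlF_sub {u : ℝ → H2 H} {R M : ℝ}
    (hu : IsSolution G f₁ f₂ δ u) (hf₁ : Nice f₁ M) (hf₂ : Nice f₂ M) (hG : ‖G‖ ≤ R)
    (hδ : |δ| ≤ 1) (h2 : ‖u 0‖ ≤ 2) : ∃ Δ' : ℝ → ℝ,
      (∀ s, HasDerivAt (fun s => nlF f₂ (u s) - nlF f₁ (u s)) (Δ' s) s) ∧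
        ∀ s, |Δ' s| ≤ 2 * (M + 8 * M * R) := by
  refine ⟨_, fun s => (hu.hasDerivAt_nlF hf₂.smooth s).fun_sub (hu.hasDerivAt_nlF hf₁.smooth s),
    fun s => ?_⟩
  have hp := hu.pop hf₁ hf₂ hG hδ h2
  have hm := hp.mem s
  have ha : ‖(u s).fst‖ ^ 2 ∈ Set.Icc (0 : ℝ) 4 := ⟨hm.1, hm.2.trans hp.hN⟩
  have hb : ‖u 0‖ ^ 2 - ‖(u s).fst‖ ^ 2 ∈ Set.Icc (0 : ℝ) 4 :=
    ⟨by linarith [hm.2], by linarith [hm.1, hp.hN]⟩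
  have hι := hp.bι s
  have hM := hf₁.nonneg
  rw [← sub_mul, abs_mul, abs_mul]
  calc _ ≤ (M + M) * (|-2| * (4 * R)) := by
        gcongr
        exact (abs_sub _ _).trans (add_le_add (hf₂.slope _ ha _ hb) (hf₁.slope _ ha _ hb))
    _ ≤ _ := by rw [abs_neg, abs_two]; linarith

/-- Asymptotic completeness at `-∞`, with uniform constants. -/
theorem IsSolution.exists_pastExpansion {u : ℝ → H2 H} {R M : ℝ}
    (hu : IsSolution G f₁ f₂ δ u) (hf₁ : Nice f₁ M) (hf₂ : Nice f₂ M) (hG : ‖G‖ ≤ R)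
    (hδ : |δ| ≤ 1) (h2 : ‖u 0‖ ≤ 2) : ∃ α, PastExpansion G f₁ f₂ δ (pastC R M) u α ∧
      ∀ f, Nice f M → ∃ κ, ∀ s ≤ -1,
        |(∫ t in (0 : ℝ)..s, nlF f (u t)) - nlF f α * s - κ| ≤ pastC R M / |s| := by
  have hM := hf₁.nonneg
  have hR : 0 ≤ R := (norm_nonneg G).trans hG
  have hS := isSolution_iff_sys.mp hu
  have hpop := hu.pop hf₁ hf₂ hG hδ h2
  have hph0 := phaseC_nonneg hM (W := 4 * R) (by positivity) (Y := 4 * R ^ 2) (by positivity)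
  have hpo0 := popC₂_nonneg hM (W := 4 * R) (by positivity) (Y := 4 * R ^ 2) (by positivity)
  have ham0 := ampC_nonneg hR (M := M + 8 * M * R) (by positivity)
  obtain ⟨x₀, hx₀, hxlim, hx₁, hx₂⟩ := hpop.exists_limit
  have hphase : ∀ f, Nice f M → ∃ κ, ∀ s ≤ -1,
      |(∫ t in (0 : ℝ)..s, nlF f (u t)) - f (x₀, ‖u 0‖ ^ 2 - x₀) * s - κ| ≤
        phaseC M (4 * R) (4 * R ^ 2) / |s| :=
    fun f hf => hu.exists_phase hf₁ hf₂ hG hδ h2 hf hx₀ hx₁ hx₂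
  have hprim : ∀ f, Nice f M → ∀ κ s,
      HasDerivAt (fun s => (∫ t in (0 : ℝ)..s, nlF f (u t)) - κ) (nlF f (u s)) s := fun f hf κ s =>
    (hasDerivAt_integral_of_continuous (continuous_nlF hf.smooth.continuous hu.continuous)
      s).sub_const κ
  have b₁ : ∀ s, ‖(u s).fst‖ ≤ 2 := fun s => (norm_fst_le _).trans ((hu.norm_eq s 0).trans_le h2)
  have b₂ : ∀ s, ‖(u s).snd‖ ≤ 2 := fun s => (norm_snd_le _).trans ((hu.norm_eq s 0).trans_le h2)
  have hM8 : (0 : ℝ) ≤ 8 * M * R := by positivity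
  obtain ⟨Δ', hΔ, hΔ'⟩ := hu.exists_deriv_nlF_sub hf₁ hf₂ hG hδ h2
  have hΔb : ∀ s, |nlF f₂ (u s) - nlF f₁ (u s)| ≤ 2 * (M + 8 * M * R) := fun s =>
    (abs_sub _ _).trans (by linarith [hu.abs_nlF_le h2 hf₁ s, hu.abs_nlF_le h2 hf₂ s])
  obtain ⟨κ₁, hκ₁⟩ := hphase f₁ hf₁
  obtain ⟨κ₂, hκ₂⟩ := hphase f₂ hf₂
  -- The primitives are normalised by `κ₁` and `κ₂`, so they equal the limiting frequency times `s`
  -- up to `O(1/|s|)`, and the amplitude limits carry no additional constant phase.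
  obtain ⟨a₁, ha₁⟩ := hS.exists_amplitude (by simp) hδ (R := R) (M := M + 8 * M * R) (by positivity) hG b₁ b₂
    (hprim f₁ hf₁ κ₁) hΔ hΔb hΔ'
  obtain ⟨a₂, ha₂⟩ := hS.swap.exists_amplitude (by simp) hδ (R := R) (M := M + 8 * M * R) (by positivity)
    (by rwa [LinearIsometryEquiv.norm_map]) b₂ b₁ (hprim f₂ hf₂ κ₂) (Δ' := fun s => -Δ' s)
    (fun s => (hΔ s).neg.congr_of_eventuallyEq (Eventually.of_forall fun s => by simp))
    (fun s => by rw [abs_sub_comm]; exact hΔb s) (fun s => by rw [abs_neg]; exact hΔ' s)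
  have hlim₁ : Tendsto (fun s => ‖(u s).fst‖) atBot (𝓝 ‖a₁‖) :=
    tendsto_norm_of_norm_sub_le (eventually_atBot_of_le_neg_one ha₁) (fun s => by
      rw [norm_smul, norm_cexp_I_mul, one_mul]; exact norm_rot_apply (isSelfAdjoint_GGs G) _ _)
      (tendsto_const_div_abs_atBot _)
  have hlim₂ : Tendsto (fun s => ‖(u s).snd‖) atBot (𝓝 ‖a₂‖) :=
    tendsto_norm_of_norm_sub_le (eventually_atBot_of_le_neg_one ha₂) (fun s => by
      rw [norm_smul, norm_cexp_I_mul, one_mul]; exact norm_rot_apply (isSelfAdjoint_GGs _) _ _)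
      (tendsto_const_div_abs_atBot _)
  -- The limiting population is that of the state itself, which identifies the limiting frequencies
  -- with the nonlinearities evaluated at the state.
  have hx₀a : x₀ = ‖a₁‖ ^ 2 := tendsto_nhds_unique hxlim (hlim₁.pow 2)
  have hNa : ‖u 0‖ ^ 2 = ‖a₁‖ ^ 2 + ‖a₂‖ ^ 2 := by
    have h3 : Tendsto (fun s => ‖(u s).fst‖ ^ 2 + ‖(u s).snd‖ ^ 2) atBot
      (𝓝 (‖a₁‖ ^ 2 + ‖a₂‖ ^ 2)) := (hlim₁.pow 2).add (hlim₂.pow 2)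
    have h4 : (fun s => ‖(u s).fst‖ ^ 2 + ‖(u s).snd‖ ^ 2) = fun _ => ‖u 0‖ ^ 2 :=
      funext fun s => by rw [← norm_sq_eq, hu.norm_eq s 0]
    rw [h4] at h3
    exact tendsto_nhds_unique tendsto_const_nhds h3
  have hF : ∀ f : ℝ × ℝ → ℝ, f (x₀, ‖u 0‖ ^ 2 - x₀) = nlF f (vec a₁ a₂) := fun f => by
    rw [nlF, vec_fst, vec_snd, hNa, hx₀a, add_sub_cancel_left]
  have hna : ‖vec a₁ a₂‖ = ‖u 0‖ :=
    (pow_left_inj₀ (norm_nonneg _) (norm_nonneg _) two_ne_zero).mp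
      (by rw [norm_sq_eq, hNa, vec_fst, vec_snd])
  have hmono : ∀ {c : ℝ}, c ≤ pastC R M → ∀ s : ℝ, c / |s| ≤ pastC R M / |s| := fun hc s => by
    gcongr
  refine ⟨vec a₁ a₂, ⟨hna, fun s hs => ?_, fun s hs => ?_⟩, fun f hf => ?_⟩
  · have key : ∀ {θ θ' : ℝ} {T a y : H}, ‖T‖ = ‖a‖ → ‖a‖ ≤ 2 →
        |θ - θ'| ≤ phaseC M (4 * R) (4 * R ^ 2) / |s| →
        ‖y - Complex.exp (Complex.I * θ) • T‖ ≤ ampC R (M + 8 * M * R) / |s| →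
        ‖y - Complex.exp (Complex.I * θ') • T‖ ≤ (ampC R (M + 8 * M * R) +
          2 * phaseC M (4 * R) (4 * R ^ 2)) / |s| := fun {θ θ' T a y} hT ha hθ hy => by
      have e : y - Complex.exp (Complex.I * θ') • T = (y - Complex.exp (Complex.I * θ) • T) +
          (Complex.exp (Complex.I * θ) - Complex.exp (Complex.I * θ')) • T := by
        rw [sub_smul]; abel
      rw [e]
      refine (norm_add_le _ _).trans ?_
      rw [norm_smul, hT, add_div]
      refine add_le_add hy ?_
      calc _ ≤ phaseC M (4 * R) (4 * R ^ 2) / |s| * 2 := by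
            gcongr
            exact (norm_cexp_sub_cexp_le _ _).trans hθ
        _ = _ := by ring
    have hδm : ∀ {p q r : ℝ}, |p| ≤ phaseC M (4 * R) (4 * R ^ 2) / |s| → q - r = δ * p →
        |q - r| ≤ phaseC M (4 * R) (4 * R ^ 2) / |s| := fun {p q r} hp hq => by
      rw [hq, abs_mul]
      exact (mul_le_of_le_one_left (abs_nonneg _) hδ).trans hp
    have c₁ := key (T := rot (GGs G) (Real.log s / 2) a₁)
      (θ := 1 * s ^ 2 / 2 + δ * ((∫ t in (0 : ℝ)..s, nlF f₁ (u t)) - κ₁))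
      (θ' := s ^ 2 / 2 + δ * (nlF f₁ (vec a₁ a₂) * s) + 0)
      (norm_rot_apply (isSelfAdjoint_GGs G) _ _)
      (le_of_tendsto hlim₁ (Eventually.of_forall b₁)) (hδm (hκ₁ s hs) (by rw [← hF]; ring))
      (by simpa [GGs] using ha₁ s hs)
    have c₂ := key (T := rot (GsG G) (-(Real.log s / 2)) a₂)
      (θ := -1 * s ^ 2 / 2 + δ * ((∫ t in (0 : ℝ)..s, nlF f₂ (u t)) - κ₂))
      (θ' := -(s ^ 2 / 2) + δ * (nlF f₂ (vec a₁ a₂) * s) - 0)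
      (norm_rot_apply (isSelfAdjoint_GsG G) _ _)
      (le_of_tendsto hlim₂ (Eventually.of_forall b₂)) (hδm (hκ₂ s hs) (by rw [← hF]; ring))
      (by simpa [GsG] using ha₂ s hs)
    refine (norm_le_add _).trans ?_
    rw [WithLp.sub_fst, WithLp.sub_snd, profile_fst, profile_snd]
    refine (add_le_add c₁ c₂).trans ?_
    rw [← add_div]
    refine hmono ?_ s
    unfold pastC; linarith
  · rw [vec_fst, ← hx₀a]
    refine (hx₂ s hs).trans ?_
    gcongr
    unfold pastC; linarith
  · obtain ⟨κ, hκ⟩ := hphase f hf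
    refine ⟨κ, fun s hs => ?_⟩
    rw [← hF]
    refine (hκ s hs).trans (hmono ?_ s)
    unfold pastC; linarith

end LandauZener
end

/-! ### Global existence and continuous dependence. -/

noncomputable section
namespace LandauZener

variable {H : Type u} [NormedAddCommGroup H] [InnerProductSpace ℂ H] [CompleteSpace H]

/-- The time-dependent vector field of the equation. -/
def field (G : H →L[ℂ] H) (f₁ f₂ : ℝ × ℝ → ℝ) (δ s : ℝ) (u : H2 H) : H2 H :=
  Complex.I • (V G s u +
    (δ : ℂ) • vec ((nlF f₁ u : ℂ) • u.fst) ((nlF f₂ u : ℂ) • u.snd))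

theorem inner_H2 (a b : H2 H) : inner ℂ a b = inner ℂ a.fst b.fst + inner ℂ a.snd b.snd := rfl

theorem re_inner_smul_I_self {E : Type*} [NormedAddCommGroup E] [InnerProductSpace ℂ E] (x : E)
    (r : ℝ) : (inner ℂ x (Complex.I • (r : ℂ) • x)).re = 0 := by
  rw [inner_smul_right, inner_smul_right, inner_self_eq_norm_sq_to_K]
  simp [← Complex.ofReal_pow]

theorem re_inner_I_smul_V (G : H →L[ℂ] H) (s : ℝ) (u : H2 H) :
    (inner ℂ u (Complex.I • V G s u)).re = 0 := by
  have h : inner ℂ u.snd (ContinuousLinearMap.adjoint G u.fst) =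
      (starRingEnd ℂ) (inner ℂ u.fst (G u.snd)) := by
    rw [ContinuousLinearMap.adjoint_inner_right, inner_conj_symm]
  rw [inner_smul_right, inner_H2, V, vec_fst, vec_snd, inner_add_right, inner_sub_right,
    inner_smul_right, inner_smul_right, inner_self_eq_norm_sq_to_K, inner_self_eq_norm_sq_to_K, h]
  clear h
  generalize inner ℂ u.fst (G u.snd) = w
  simp [← Complex.ofReal_pow]

theorem V_sub (G : H →L[ℂ] H) (s : ℝ) (u v : H2 H) : V G s (u - v) = V G s u - V G s v := by
  refine H2.ext ?_ ?_
  · simp only [V, vec_fst, WithLp.sub_fst, WithLp.sub_snd, map_sub]; module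
  · simp only [V, vec_snd, WithLp.sub_fst, WithLp.sub_snd, map_sub]; module

/-- `V(s)` is symmetric and the potentials are real, so after multiplication by `i` they do not
contribute. Only the difference of the potentials, acting on `v`, can change `‖u - v‖`; in
particular the growth of `V(s)` in `s` is harmless. -/
theorem abs_re_inner_field_sub_le (G : H →L[ℂ] H) (f₁ f₂ : ℝ × ℝ → ℝ) (δ s : ℝ) (u v : H2 H) :
    |(inner ℂ (u - v) (field G f₁ f₂ δ s u - field G f₁ f₂ δ s v)).re| ≤
      ‖u - v‖ * (|δ| * (|nlF f₁ u - nlF f₁ v| * ‖v.fst‖ + |nlF f₂ u - nlF f₂ v| * ‖v.snd‖)) := by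
  have e : field G f₁ f₂ δ s u - field G f₁ f₂ δ s v = Complex.I • V G s (u - v) +
      (vec (Complex.I • ((δ * nlF f₁ u : ℝ) : ℂ) • (u - v).fst)
        (Complex.I • ((δ * nlF f₂ u : ℝ) : ℂ) • (u - v).snd) +
      vec (Complex.I • ((δ * (nlF f₁ u - nlF f₁ v) : ℝ) : ℂ) • v.fst)
        (Complex.I • ((δ * (nlF f₂ u - nlF f₂ v) : ℝ) : ℂ) • v.snd)) := by
    rw [V_sub]
    refine H2.ext ?_ ?_
    · simp only [field, WithLp.sub_fst, WithLp.smul_fst, WithLp.add_fst, vec_fst]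
      push_cast
      module
    · simp only [field, WithLp.sub_snd, WithLp.smul_snd, WithLp.add_snd, vec_snd]
      push_cast
      module
  have h0 : (inner ℂ (u - v) (vec (Complex.I • ((δ * nlF f₁ u : ℝ) : ℂ) • (u - v).fst)
        (Complex.I • ((δ * nlF f₂ u : ℝ) : ℂ) • (u - v).snd))).re = 0 := by
    rw [inner_H2, Complex.add_re, vec_fst, vec_snd, re_inner_smul_I_self, re_inner_smul_I_self,
      add_zero]
  rw [e, inner_add_right, inner_add_right, Complex.add_re, Complex.add_re, re_inner_I_smul_V, h0,
    zero_add, zero_add]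
  refine (Complex.abs_re_le_norm _).trans ((norm_inner_le_norm _ _).trans ?_)
  gcongr
  refine (norm_le_add _).trans_eq ?_
  rw [vec_fst, vec_snd]
  simp only [norm_smul, Complex.norm_I, one_mul, Complex.norm_real, Real.norm_eq_abs, abs_mul]
  ring

theorem abs_norm_sq_sub_le {E : Type*} [SeminormedAddCommGroup E] {a b : E} (ha : ‖a‖ ≤ 2)
    (hb : ‖b‖ ≤ 2) : |‖a‖ ^ 2 - ‖b‖ ^ 2| ≤ 4 * ‖a - b‖ := by
  rw [sq_sub_sq, abs_mul, abs_of_nonneg (by positivity)]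
  have := abs_norm_sub_norm_le a b
  nlinarith [norm_nonneg a, norm_nonneg b, norm_nonneg (a - b), abs_nonneg (‖a‖ - ‖b‖)]

theorem sq_norm_mem_Icc {E : Type*} [SeminormedAddCommGroup E] {a : E} (ha : ‖a‖ ≤ 2) :
    ‖a‖ ^ 2 ∈ Set.Icc (0 : ℝ) 4 := ⟨sq_nonneg _, by nlinarith [norm_nonneg a]⟩

theorem Nice.abs_nlF_sub_le {f : ℝ × ℝ → ℝ} {M : ℝ} (hf : Nice f M) {u v : H2 H} (hu : ‖u‖ ≤ 2)
    (hv : ‖v‖ ≤ 2) : |nlF f u - nlF f v| ≤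
      M * (|‖u.fst‖ ^ 2 - ‖v.fst‖ ^ 2| + |‖u.snd‖ ^ 2 - ‖v.snd‖ ^ 2|) :=
  hf.lip _ (sq_norm_mem_Icc ((norm_fst_le u).trans hu)) _
    (sq_norm_mem_Icc ((norm_snd_le u).trans hu)) _ (sq_norm_mem_Icc ((norm_fst_le v).trans hv)) _
    (sq_norm_mem_Icc ((norm_snd_le v).trans hv))

theorem Nice.abs_nlF_sub_le' {f : ℝ × ℝ → ℝ} {M : ℝ} (hf : Nice f M) {u v : H2 H} (hu : ‖u‖ ≤ 2)
    (hv : ‖v‖ ≤ 2) : |nlF f u - nlF f v| ≤ 8 * M * ‖u - v‖ := by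
  have hM := hf.nonneg
  have h1 := abs_norm_sq_sub_le ((norm_fst_le u).trans hu) ((norm_fst_le v).trans hv)
  have h2 := abs_norm_sq_sub_le ((norm_snd_le u).trans hu) ((norm_snd_le v).trans hv)
  rw [← WithLp.sub_fst] at h1
  rw [← WithLp.sub_snd] at h2
  refine (hf.abs_nlF_sub_le hu hv).trans ?_
  have h3 := norm_fst_le (u - v)
  have h4 := norm_snd_le (u - v)
  calc _ ≤ M * (4 * ‖u - v‖ + 4 * ‖u - v‖) := by gcongr <;> linarith
    _ = _ := by ring

variable {G : H →L[ℂ] H} {f₁ f₂ : ℝ × ℝ → ℝ} {δ M : ℝ}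

/-- Continuous dependence of solutions on the data, on any open interval. -/
theorem norm_sq_sub_le_exp (hf₁ : Nice f₁ M) (hf₂ : Nice f₂ M) (hδ : |δ| ≤ 1) {a b : ℝ}
    {u v : ℝ → H2 H} (hu : ∀ s ∈ Set.Ioo a b, HasDerivAt u (field G f₁ f₂ δ s (u s)) s)
    (hv : ∀ s ∈ Set.Ioo a b, HasDerivAt v (field G f₁ f₂ δ s (v s)) s)
    (hu2 : ∀ s ∈ Set.Ioo a b, ‖u s‖ ≤ 2) (hv2 : ∀ s ∈ Set.Ioo a b, ‖v s‖ ≤ 2) {s t : ℝ}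
    (hs : s ∈ Set.Ioo a b) (ht : t ∈ Set.Ioo a b) :
    ‖u t - v t‖ ^ 2 ≤ Real.exp (64 * M * |t - s|) * ‖u s - v s‖ ^ 2 := by
  have hM := hf₁.nonneg
  refine energy_le_exp (e := fun s => ‖u s - v s‖ ^ 2)
    (fun r hr => hasDerivAt_norm_sq ((hu r hr).fun_sub (hv r hr))) (fun r hr => ?_) hs ht
  have h1 := abs_re_inner_field_sub_le G f₁ f₂ δ r (u r) (v r)
  have h2 := hf₁.abs_nlF_sub_le' (hu2 r hr) (hv2 r hr)
  have h3 := hf₂.abs_nlF_sub_le' (hu2 r hr) (hv2 r hr)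
  rw [abs_mul, abs_two]
  calc _ ≤ 2 * (‖u r - v r‖ * (1 * (8 * M * ‖u r - v r‖ * 2 + 8 * M * ‖u r - v r‖ * 2))) := by
        refine mul_le_mul_of_nonneg_left (h1.trans ?_) (by norm_num)
        gcongr
        · exact (norm_fst_le _).trans (hv2 r hr)
        · exact (norm_snd_le _).trans (hv2 r hr)
    _ = 64 * M * ‖u r - v r‖ ^ 2 := by ring

theorem re_inner_field_self (s : ℝ) (u : H2 H) : (inner ℂ u (field G f₁ f₂ δ s u)).re = 0 := by
  have e : field G f₁ f₂ δ s u = Complex.I • V G s u +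
      vec (Complex.I • ((δ * nlF f₁ u : ℝ) : ℂ) • u.fst)
        (Complex.I • ((δ * nlF f₂ u : ℝ) : ℂ) • u.snd) := by
    refine H2.ext ?_ ?_
    · simp only [field, WithLp.smul_fst, WithLp.add_fst, vec_fst]
      push_cast
      module
    · simp only [field, WithLp.smul_snd, WithLp.add_snd, vec_snd]
      push_cast
      module
  rw [e, inner_add_right, Complex.add_re, re_inner_I_smul_V, inner_H2, Complex.add_re, vec_fst,
    vec_snd, re_inner_smul_I_self, re_inner_smul_I_self, add_zero, add_zero]

theorem contDiff_field (hf₁ : ContDiff ℝ 1 f₁) (hf₂ : ContDiff ℝ 1 f₂) :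
    ContDiff ℝ 1 (fun p : ℝ × H2 H => field G f₁ f₂ δ p.1 p.2) := by
  have c₁ : ContDiff ℝ 1 (fun p : ℝ × H2 H => p.2.fst) :=
    ((WithLp.fstL 2 ℝ H H).contDiff).comp contDiff_snd
  have c₂ : ContDiff ℝ 1 (fun p : ℝ × H2 H => p.2.snd) :=
    ((WithLp.sndL 2 ℝ H H).contDiff).comp contDiff_snd
  have cs : ContDiff ℝ 1 (fun p : ℝ × H2 H => ((p.1 : ℝ) : ℂ)) :=
    Complex.ofRealCLM.contDiff.comp contDiff_fst
  have cn : ContDiff ℝ 1 (fun p : ℝ × H2 H => (‖p.2.fst‖ ^ 2, ‖p.2.snd‖ ^ 2)) :=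
    (c₁.norm_sq ℂ).prodMk (c₂.norm_sq ℂ)
  have g₁ : ContDiff ℝ 1 (fun p : ℝ × H2 H => ((nlF f₁ p.2 : ℝ) : ℂ)) :=
    Complex.ofRealCLM.contDiff.comp (hf₁.comp cn)
  have g₂ : ContDiff ℝ 1 (fun p : ℝ × H2 H => ((nlF f₂ p.2 : ℝ) : ℂ)) :=
    Complex.ofRealCLM.contDiff.comp (hf₂.comp cn)
  have hG : ContDiff ℝ 1 (fun p : ℝ × H2 H => G p.2.snd) :=
    (G.restrictScalars ℝ).contDiff.comp c₂
  have hG' : ContDiff ℝ 1 (fun p : ℝ × H2 H => ContinuousLinearMap.adjoint G p.2.fst) :=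
    ((ContinuousLinearMap.adjoint G).restrictScalars ℝ).contDiff.comp c₁
  have hvec : ∀ {a b : ℝ × H2 H → H}, ContDiff ℝ 1 a → ContDiff ℝ 1 b →
      ContDiff ℝ 1 fun p => vec (a p) (b p) := fun ha hb =>
    (WithLp.prodContinuousLinearEquiv 2 ℝ H H).symm.contDiff.comp (ha.prodMk hb)
  exact ((hvec ((cs.smul c₁).add hG) (hG'.sub (cs.smul c₂))).add
    ((hvec (g₁.smul c₁) (g₂.smul c₂)).const_smul (δ : ℂ))).const_smul Complex.I

/-- The factor `χ` is `1` for `‖u‖² ≤ 5` and `0` for `‖u‖² ≥ 6`. It bounds the field on the whole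
space, so Picard-Lindelöf applies on an interval of any prescribed length. Being real, it does not
destroy norm conservation, so the solution stays where `χ = 1`. -/
theorem exists_local_solution [FiniteDimensional ℂ H] (hf₁ : Nice f₁ M) (hf₂ : Nice f₂ M) {T : ℝ}
    (hT : 0 < T) (t₀ : ℝ) {u₀ : H2 H} (hu₀ : ‖u₀‖ ≤ 2) : ∃ u : ℝ → H2 H, u t₀ = u₀ ∧
      ∀ t ∈ Set.Ioo (t₀ - T) (t₀ + T), HasDerivAt u (field G f₁ f₂ δ t (u t)) t ∧ ‖u t‖ ≤ 2 := by
  have : ProperSpace (H2 H) := FiniteDimensional.proper ℂ (H2 H)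
  set χ : H2 H → ℝ := fun u => Real.smoothTransition (6 - ‖u‖ ^ 2)
  have hX : ContDiff ℝ 1 (fun p : ℝ × H2 H => ((χ p.2 : ℝ) : ℂ) • field G f₁ f₂ δ p.1 p.2) := by
    have h1 : ContDiff ℝ 1 (fun p : ℝ × H2 H => ((χ p.2 : ℝ) : ℂ)) := by
      refine Complex.ofRealCLM.contDiff.comp
        ((Real.smoothTransition.contDiff (n := 1)).comp (contDiff_const.sub ?_))
      exact contDiff_snd.norm_sq ℂ
    exact h1.smul (contDiff_field (hf₁.smooth.of_le one_le_two) (hf₂.smooth.of_le one_le_two))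
  have hJ : IsCompact (Set.Icc (t₀ - T) (t₀ + T)) := isCompact_Icc
  obtain ⟨B, hB⟩ := (hJ.prod (isCompact_closedBall (0 : H2 H) 3)).exists_bound_of_continuousOn
    hX.continuous.continuousOn
  have hB' : ∀ t ∈ Set.Icc (t₀ - T) (t₀ + T), ∀ x : H2 H,
      ‖((χ x : ℝ) : ℂ) • field G f₁ f₂ δ t x‖ ≤ max B 0 := fun t ht x => by
    rcases le_or_gt ‖x‖ 3 with hx | hx
    · exact (hB (t, x) ⟨ht, by simpa using hx⟩).trans (le_max_left _ _)
    · have : χ x = 0 := Real.smoothTransition.zero_of_nonpos (by nlinarith)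
      rw [this]; simp
  have hT0 : t₀ ∈ Set.Icc (t₀ - T) (t₀ + T) := ⟨by linarith, by linarith⟩
  set L : NNReal := ⟨max B 0, le_max_right _ _⟩
  -- With speed at most `L`, a solution cannot leave the ball of this radius within time `T`.
  set a : NNReal := L * ⟨T, hT.le⟩
  obtain ⟨K, hK⟩ := (hX.locallyLipschitz.locallyLipschitzOn
    (s := Set.Icc (t₀ - T) (t₀ + T) ×ˢ Metric.closedBall u₀ (a : ℝ))).exists_lipschitzOnWith_of_compact
      (hJ.prod (isCompact_closedBall u₀ (a : ℝ)))
  have hPL : IsPicardLindelof (fun t x => ((χ x : ℝ) : ℂ) • field G f₁ f₂ δ t x)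
      (⟨t₀, hT0⟩ : Set.Icc (t₀ - T) (t₀ + T)) u₀ a 0 L K := by
    refine ⟨fun t ht => LipschitzOnWith.of_dist_le_mul fun x hx y hy => ?_, fun x _ => ?_,
      fun t ht x _ => hB' t ht x, ?_⟩
    · simpa [Prod.dist_eq] using hK.dist_le_mul (t, x) ⟨ht, hx⟩ (t, y) ⟨ht, hy⟩
    · exact (hX.continuous.comp (Continuous.prodMk_left x)).continuousOn
    · simp only [add_sub_cancel_left, sub_sub_cancel, max_self, NNReal.coe_zero, sub_zero]
      exact le_rfl
  obtain ⟨u, hu0, hu⟩ := hPL.exists_eq_forall_mem_Icc_hasDerivWithinAt₀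
  have hu' : ∀ t ∈ Set.Ioo (t₀ - T) (t₀ + T),
      HasDerivAt u (((χ (u t) : ℝ) : ℂ) • field G f₁ f₂ δ t (u t)) t := fun t ht =>
    (hu t (Set.Ioo_subset_Icc_self ht)).hasDerivAt (Icc_mem_nhds ht.1 ht.2)
  have hnorm : ∀ t ∈ Set.Ioo (t₀ - T) (t₀ + T), ‖u t‖ ^ 2 ≤ 4 := fun t ht => by
    have h1 := energy_le_exp (e := fun t => ‖u t‖ ^ 2) (K := 0)
      (fun r hr => hasDerivAt_norm_sq (hu' r hr)) (fun r hr => by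
        rw [inner_smul_right, Complex.re_ofReal_mul, re_inner_field_self]; simp)
      (s := t₀) (t := t) ⟨by linarith, by linarith⟩ ht
    rw [zero_mul, Real.exp_zero, one_mul] at h1
    have h2 : u t₀ = u₀ := hu0
    rw [h2] at h1
    nlinarith [norm_nonneg u₀]
  refine ⟨u, hu0, fun t ht => ⟨?_, ?_⟩⟩
  · refine (hu' t ht).congr_deriv ?_
    have : χ (u t) = 1 := Real.smoothTransition.one_of_one_le (by linarith [hnorm t ht])
    rw [this]; simp
  · nlinarith [hnorm t ht, norm_nonneg (u t)]

/-- Solutions on growing intervals agree on their overlaps by continuous dependence, so they can be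
glued. -/
theorem exists_solution [FiniteDimensional ℂ H] (G : H →L[ℂ] H) (hf₁ : Nice f₁ M) (hf₂ : Nice f₂ M)
    (hδ : |δ| ≤ 1) (t₀ : ℝ) {u₀ : H2 H} (hu₀ : ‖u₀‖ ≤ 2) :
    ∃ u : ℝ → H2 H, IsSolution G f₁ f₂ δ u ∧ u t₀ = u₀ := by
  have hex : ∀ n : ℕ, ∃ u : ℝ → H2 H, u t₀ = u₀ ∧ ∀ t ∈ Set.Ioo (t₀ - ((n : ℝ) + 1)) (t₀ + (n + 1)),
      HasDerivAt u (field G f₁ f₂ δ t (u t)) t ∧ ‖u t‖ ≤ 2 := fun n =>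
    exists_local_solution hf₁ hf₂ (by positivity) t₀ hu₀
  choose U hU0 hU using hex
  have hle : ∀ m n : ℕ, m ≤ n → ∀ t ∈ Set.Ioo (t₀ - ((m : ℝ) + 1)) (t₀ + (m + 1)), U m t = U n t := by
    intro m n hmn t ht
    have hmn' : (m : ℝ) ≤ n := by exact_mod_cast hmn
    have hsub : ∀ t ∈ Set.Ioo (t₀ - ((m : ℝ) + 1)) (t₀ + (m + 1)),
        t ∈ Set.Ioo (t₀ - ((n : ℝ) + 1)) (t₀ + (n + 1)) := fun t ht =>
      ⟨by linarith [ht.1], by linarith [ht.2]⟩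
    have h1 := norm_sq_sub_le_exp hf₁ hf₂ hδ (fun s hs => (hU m s hs).1)
      (fun s hs => (hU n s (hsub s hs)).1) (fun s hs => (hU m s hs).2)
      (fun s hs => (hU n s (hsub s hs)).2) (s := t₀)
      ⟨by linarith [(Nat.cast_nonneg m : (0 : ℝ) ≤ m)], by linarith [(Nat.cast_nonneg m : (0 : ℝ) ≤ m)]⟩ ht
    rw [hU0, hU0, sub_self, norm_zero, zero_pow two_ne_zero, mul_zero] at h1
    exact sub_eq_zero.mp (norm_eq_zero.mp (pow_eq_zero_iff two_ne_zero |>.mp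
      (le_antisymm h1 (sq_nonneg _))))
  have hmem : ∀ {n : ℕ} {t : ℝ}, |t - t₀| < n + 1 →
      t ∈ Set.Ioo (t₀ - ((n : ℝ) + 1)) (t₀ + (n + 1)) := fun {n t} h => by
    rw [abs_lt] at h; exact ⟨by linarith [h.1], by linarith [h.2]⟩
  -- The interval of index `n` has half-length `n + 1`, so the ceiling always selects one containing
  -- `t` in its interior.
  refine ⟨fun t => U ⌈|t - t₀|⌉₊ t, fun t => ?_, by simp [hU0]⟩
  obtain ⟨n, hn⟩ := exists_nat_gt |t - t₀|
  have hev : ∀ᶠ r in 𝓝 t, U ⌈|r - t₀|⌉₊ r = U n r := by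
    have : ∀ᶠ r in 𝓝 t, |r - t₀| < n :=
      (continuous_abs.comp (continuous_id.sub continuous_const)).continuousAt.eventually_lt
        continuousAt_const hn
    filter_upwards [this] with r hr
    exact hle _ _ (Nat.ceil_le.mpr hr.le) r (hmem ((Nat.le_ceil _).trans_lt (lt_add_one _)))
  have h1 := (hU n t (hmem (hn.trans (lt_add_one _)))).1
  have h2 := h1.congr_of_eventuallyEq hev
  rw [← hev.self_of_nhds] at h2
  exact h2

theorem IsSolution.norm_sub_le_exp (hf₁ : Nice f₁ M) (hf₂ : Nice f₂ M) (hδ : |δ| ≤ 1)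
    {u v : ℝ → H2 H} (hu : IsSolution G f₁ f₂ δ u) (hv : IsSolution G f₁ f₂ δ v) (hu2 : ‖u 0‖ ≤ 2)
    (hv2 : ‖v 0‖ ≤ 2) (s t : ℝ) :
    ‖u t - v t‖ ^ 2 ≤ Real.exp (64 * M * |t - s|) * ‖u s - v s‖ ^ 2 :=
  norm_sq_sub_le_exp hf₁ hf₂ hδ (a := min s t - 1) (b := max s t + 1) (fun s _ => hu s)
    (fun s _ => hv s) (fun r _ => (hu.norm_eq r 0).trans_le hu2)
    (fun r _ => (hv.norm_eq r 0).trans_le hv2)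
    ⟨by linarith [min_le_left s t], by linarith [le_max_left s t]⟩
    ⟨by linarith [min_le_right s t], by linarith [le_max_right s t]⟩

theorem IsSolution.eq_of_eq (hf₁ : Nice f₁ M) (hf₂ : Nice f₂ M) (hδ : |δ| ≤ 1)
    {u v : ℝ → H2 H} (hu : IsSolution G f₁ f₂ δ u) (hv : IsSolution G f₁ f₂ δ v) (hu2 : ‖u 0‖ ≤ 2)
    {s : ℝ} (h : u s = v s) : u = v := by
  have hv2 : ‖v 0‖ ≤ 2 := by rwa [hv.norm_eq 0 s, ← h, hu.norm_eq s 0]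
  funext t
  have h1 := hu.norm_sub_le_exp hf₁ hf₂ hδ hv hu2 hv2 s t
  rw [h, sub_self, norm_zero, zero_pow two_ne_zero, mul_zero] at h1
  exact sub_eq_zero.mp (norm_eq_zero.mp (pow_eq_zero_iff two_ne_zero |>.mp
    (le_antisymm h1 (sq_nonneg _))))

end LandauZener
end

/-! ### Uniqueness of states, and adapted initial data. -/

noncomputable section
namespace LandauZener

variable {H : Type u} [NormedAddCommGroup H] [InnerProductSpace ℂ H] [CompleteSpace H]
variable {G : H →L[ℂ] H} {f₁ f₂ : ℝ × ℝ → ℝ} {δ M R : ℝ}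

theorem abs_norm_rotated_sub_le {A : H →L[ℂ] H} (hA : IsSelfAdjoint A) (r θ θ' : ℝ) (a b : H) :
    |‖a - b‖ - ‖Complex.exp (Complex.I * θ) • rot A r a - Complex.exp (Complex.I * θ') • rot A r b‖| ≤
      |θ - θ'| * ‖b‖ := by
  have e : ‖a - b‖ = ‖Complex.exp (Complex.I * θ) • rot A r (a - b)‖ := by
    rw [norm_smul, norm_cexp_I_mul, one_mul, norm_rot_apply hA]
  rw [e]
  refine (abs_norm_sub_norm_le _ _).trans ?_
  have e' : Complex.exp (Complex.I * θ) • rot A r (a - b) -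
      (Complex.exp (Complex.I * θ) • rot A r a - Complex.exp (Complex.I * θ') • rot A r b) =
      (Complex.exp (Complex.I * θ') - Complex.exp (Complex.I * θ)) • rot A r b := by
    rw [map_sub]; module
  rw [e', norm_smul, norm_rot_apply hA, abs_sub_comm]
  gcongr
  exact norm_cexp_sub_cexp_le _ _

theorem abs_norm_profile_fst_sub_le (δ ϕ s : ℝ) (α β : H2 H) :
    |‖α.fst - β.fst‖ - ‖(profile G f₁ f₂ δ ϕ α s).fst - (profile G f₁ f₂ δ ϕ β s).fst‖| ≤
      |δ| * |nlF f₁ α - nlF f₁ β| * |s| * ‖β.fst‖ := by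
  rw [profile_fst, profile_fst]
  refine (abs_norm_rotated_sub_le (isSelfAdjoint_GGs G) _ _ _ _ _).trans_eq ?_
  rw [← abs_mul, ← abs_mul]
  congr 2; ring

theorem abs_norm_profile_snd_sub_le (δ ϕ s : ℝ) (α β : H2 H) :
    |‖α.snd - β.snd‖ - ‖(profile G f₁ f₂ δ ϕ α s).snd - (profile G f₁ f₂ δ ϕ β s).snd‖| ≤
      |δ| * |nlF f₂ α - nlF f₂ β| * |s| * ‖β.snd‖ := by
  rw [profile_snd, profile_snd]
  refine (abs_norm_rotated_sub_le (isSelfAdjoint_GsG G) _ _ _ _ _).trans_eq ?_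
  rw [← abs_mul, ← abs_mul]
  congr 2; ring

/-- The frequencies depend on the state, and their difference is multiplied by `|s|`. Closeness of
profiles therefore gives closeness of states only when the populations agree to higher order. -/
theorem norm_state_sub_le (δ ϕ s : ℝ) (α β : H2 H) :
    ‖α - β‖ ≤ 2 * ‖profile G f₁ f₂ δ ϕ α s - profile G f₁ f₂ δ ϕ β s‖ +
      |δ| * |s| * ‖β‖ * (|nlF f₁ α - nlF f₁ β| + |nlF f₂ α - nlF f₂ β|) := by
  have h1 := (abs_le.mp (abs_norm_profile_fst_sub_le (G := G) (f₁ := f₁) (f₂ := f₂) δ ϕ s α β)).2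
  have h2 := (abs_le.mp (abs_norm_profile_snd_sub_le (G := G) (f₁ := f₁) (f₂ := f₂) δ ϕ s α β)).2
  have h3 := norm_fst_le (profile G f₁ f₂ δ ϕ α s - profile G f₁ f₂ δ ϕ β s)
  have h4 := norm_snd_le (profile G f₁ f₂ δ ϕ α s - profile G f₁ f₂ δ ϕ β s)
  have h5 := norm_le_add (α - β)
  rw [WithLp.sub_fst, WithLp.sub_snd] at *
  have h6 : |δ| * |nlF f₁ α - nlF f₁ β| * |s| * ‖β.fst‖ ≤
      |δ| * |nlF f₁ α - nlF f₁ β| * |s| * ‖β‖ := by gcongr; exact norm_fst_le β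
  have h7 : |δ| * |nlF f₂ α - nlF f₂ β| * |s| * ‖β.snd‖ ≤
      |δ| * |nlF f₂ α - nlF f₂ β| * |s| * ‖β‖ := by gcongr; exact norm_snd_le β
  linarith

theorem norm_profile_sub_le (δ ϕ s : ℝ) (α β : H2 H) :
    ‖profile G f₁ f₂ δ ϕ α s - profile G f₁ f₂ δ ϕ β s‖ ≤ 2 * ‖α - β‖ +
      |δ| * |s| * ‖β‖ * (|nlF f₁ α - nlF f₁ β| + |nlF f₂ α - nlF f₂ β|) := by
  have h1 := (abs_le.mp (abs_norm_profile_fst_sub_le (G := G) (f₁ := f₁) (f₂ := f₂) δ ϕ s α β)).1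
  have h2 := (abs_le.mp (abs_norm_profile_snd_sub_le (G := G) (f₁ := f₁) (f₂ := f₂) δ ϕ s α β)).1
  have h3 := norm_fst_le (α - β)
  have h4 := norm_snd_le (α - β)
  have h5 := norm_le_add (profile G f₁ f₂ δ ϕ α s - profile G f₁ f₂ δ ϕ β s)
  rw [WithLp.sub_fst, WithLp.sub_snd] at *
  have h6 : |δ| * |nlF f₁ α - nlF f₁ β| * |s| * ‖β.fst‖ ≤
      |δ| * |nlF f₁ α - nlF f₁ β| * |s| * ‖β‖ := by gcongr; exact norm_fst_le β
  have h7 : |δ| * |nlF f₂ α - nlF f₂ β| * |s| * ‖β.snd‖ ≤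
      |δ| * |nlF f₂ α - nlF f₂ β| * |s| * ‖β‖ := by gcongr; exact norm_snd_le β
  linarith

/-- Scattering states are unique. -/
theorem state_unique {l : Filter ℝ} [l.NeBot] {δ ϕ : ℝ} {α β : H2 H} {u : ℝ → H2 H}
    (hα : Tendsto (fun s => u s - profile G f₁ f₂ δ ϕ α s) l (𝓝 0))
    (hβ : Tendsto (fun s => u s - profile G f₁ f₂ δ ϕ β s) l (𝓝 0)) : α = β := by
  have h : Tendsto (fun s => profile G f₁ f₂ δ ϕ α s - profile G f₁ f₂ δ ϕ β s) l (𝓝 0) := by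
    have := hβ.sub hα
    rw [sub_zero] at this
    exact this.congr fun s => by abel
  have h0 := h.norm
  rw [norm_zero] at h0
  have n₁ : ‖α.fst‖ = ‖β.fst‖ := by
    have : ‖‖α.fst‖ - ‖β.fst‖‖ ≤ 0 := ge_of_tendsto h0 (Eventually.of_forall fun s => by
      rw [← norm_profile_fst (G := G) (f₁ := f₁) (f₂ := f₂) δ ϕ α s,
        ← norm_profile_fst (G := G) (f₁ := f₁) (f₂ := f₂) δ ϕ β s]
      refine (abs_norm_sub_norm_le _ _).trans ?_
      rw [← WithLp.sub_fst]; exact norm_fst_le _)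
    exact sub_eq_zero.mp (norm_le_zero_iff.mp this)
  have n₂ : ‖α.snd‖ = ‖β.snd‖ := by
    have : ‖‖α.snd‖ - ‖β.snd‖‖ ≤ 0 := ge_of_tendsto h0 (Eventually.of_forall fun s => by
      rw [← norm_profile_snd (G := G) (f₁ := f₁) (f₂ := f₂) δ ϕ α s,
        ← norm_profile_snd (G := G) (f₁ := f₁) (f₂ := f₂) δ ϕ β s]
      refine (abs_norm_sub_norm_le _ _).trans ?_
      rw [← WithLp.sub_snd]; exact norm_snd_le _)
    exact sub_eq_zero.mp (norm_le_zero_iff.mp this)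
  -- Equal component norms mean equal frequencies, which removes the term growing with `|s|`.
  have hF : ∀ f, nlF f α = nlF f β := fun f => by rw [nlF, nlF, n₁, n₂]
  have h1 : ‖α - β‖ ≤ 2 * 0 := ge_of_tendsto (h0.const_mul 2) (Eventually.of_forall fun s => by
    have := norm_state_sub_le (G := G) (f₁ := f₁) (f₂ := f₂) δ ϕ s α β
    simpa [hF] using this)
  exact sub_eq_zero.mp (norm_le_zero_iff.mp (by simpa using h1))

theorem hasPastState_of_le {ϕ C : ℝ} {u : ℝ → H2 H} {α : H2 H}
    (h : ∀ s ≤ -1, ‖u s - profile G f₁ f₂ δ ϕ α s‖ ≤ C / |s|) : HasPastState G f₁ f₂ δ ϕ u α := by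
  refine IsBigO.of_bound C ?_
  filter_upwards [eventually_le_atBot (-1)] with s hs
  refine (h s hs).trans_eq ?_
  rw [norm_div, norm_one, Real.norm_eq_abs, abs_abs]; ring

theorem HasPastState.tendsto {ϕ : ℝ} {u : ℝ → H2 H} {α : H2 H}
    (h : HasPastState G f₁ f₂ δ ϕ u α) :
    Tendsto (fun s => u s - profile G f₁ f₂ δ ϕ α s) atBot (𝓝 0) :=
  h.trans_tendsto (tendsto_const_div_abs_atBot 1)

theorem PastExpansion.tendsto {C : ℝ} {u : ℝ → H2 H} {α : H2 H}
    (h : PastExpansion G f₁ f₂ δ C u α) :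
    Tendsto (fun s => u s - profile G f₁ f₂ δ 0 α s) atBot (𝓝 0) :=
  (hasPastState_of_le h.sub_profile).tendsto

/-- Full asymptotic information on a solution with state `α`. -/
theorem IsSolution.pastExpansion {u : ℝ → H2 H} {α : H2 H} (hu : IsSolution G f₁ f₂ δ u)
    (hf₁ : Nice f₁ M) (hf₂ : Nice f₂ M) (hG : ‖G‖ ≤ R) (hδ : |δ| ≤ 1) (hα : ‖α‖ ≤ 2)
    (h : Tendsto (fun s => u s - profile G f₁ f₂ δ 0 α s) atBot (𝓝 0)) :
    PastExpansion G f₁ f₂ δ (pastC R M) u α ∧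
      ∀ f, Nice f M → ∃ κ, ∀ s ≤ -1,
        |(∫ t in (0 : ℝ)..s, nlF f (u t)) - nlF f α * s - κ| ≤ pastC R M / |s| := by
  have h2 : ‖u 0‖ ≤ 2 := by
    have h1 : Tendsto (fun _ : ℝ => ‖u 0‖) atBot (𝓝 ‖α‖) := by
      refine (tendsto_norm_of_norm_sub_le (Eventually.of_forall fun s => le_rfl)
        (fun s => norm_profile (G := G) (f₁ := f₁) (f₂ := f₂) δ 0 α s) ?_).congr fun s => hu.norm_eq s 0
      simpa using h.norm
    exact (tendsto_nhds_unique tendsto_const_nhds h1).trans_le hα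
  obtain ⟨β, hβ, hph⟩ := hu.exists_pastExpansion hf₁ hf₂ hG hδ h2
  obtain rfl := state_unique h hβ.tendsto
  exact ⟨hβ, hph⟩

/-- Initial data at time `s` adapted to the state with leading order profile `p`. -/
def adapted (G : H →L[ℂ] H) (s : ℝ) (p : H2 H) : H2 H :=
  vec (p.fst - ((1 / (2 * s) : ℝ) : ℂ) • G p.snd)
    (p.snd + ((1 / (2 * s) : ℝ) : ℂ) • ContinuousLinearMap.adjoint G p.fst)

theorem norm_sub_sq' {E : Type*} [NormedAddCommGroup E] [InnerProductSpace ℂ E] (a b : E) (r : ℝ) :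
    ‖a + (r : ℂ) • b‖ ^ 2 = ‖a‖ ^ 2 + 2 * r * (inner ℂ a b).re + r ^ 2 * ‖b‖ ^ 2 := by
  have h := norm_add_sq (𝕜 := ℂ) a ((r : ℂ) • b)
  rw [inner_smul_right, norm_smul, mul_pow, Complex.norm_real, Real.norm_eq_abs, sq_abs] at h
  rw [h]
  have : RCLike.re ((r : ℂ) * inner ℂ a b) = r * (inner ℂ a b).re := by
    exact Complex.re_ofReal_mul _ _
  rw [this]; ring

theorem norm_adapted_sq (G : H →L[ℂ] H) {s : ℝ} (p : H2 H) : ‖adapted G s p‖ ^ 2 =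
    ‖p‖ ^ 2 + (1 / (2 * s)) ^ 2 * (‖G p.snd‖ ^ 2 + ‖ContinuousLinearMap.adjoint G p.fst‖ ^ 2) := by
  have h1 := norm_sub_sq' p.fst (G p.snd) (-(1 / (2 * s)))
  have h2 := norm_sub_sq' p.snd (ContinuousLinearMap.adjoint G p.fst) (1 / (2 * s))
  have h3 : (inner ℂ p.snd (ContinuousLinearMap.adjoint G p.fst)).re =
      (inner ℂ p.fst (G p.snd)).re := by
    rw [ContinuousLinearMap.adjoint_inner_right]
    exact inner_re_symm (𝕜 := ℂ) _ _
  rw [h3] at h2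
  rw [norm_sq_eq, norm_sq_eq p, adapted, vec_fst, vec_snd, h2]
  rw [Complex.ofReal_neg, neg_smul, ← sub_eq_add_neg] at h1
  rw [h1]; ring

/-- Subtracting `G p₂/(2s)` from `p₁` changes its squared norm by `-Re ⟪p₁, G p₂⟫/s` at first order,
exactly compensating the oscillating term of the population expansion. The opposite sign in the
second component keeps the total norm up to `O(1/s²)`. The condition `R ≤ |s|` keeps the norm below
`2`. -/
theorem adapted_bounds (hG : ‖G‖ ≤ R) {s : ℝ} (hs : s ≤ -1) (hsR : R ≤ |s|) {p : H2 H}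
    (hp : ‖p‖ = 1) :
    ‖adapted G s p‖ ≤ 2 ∧ |‖adapted G s p‖ ^ 2 - 1| ≤ R ^ 2 / s ^ 2 ∧
    ‖adapted G s p - p‖ ≤ R / |s| ∧
    |‖(adapted G s p).fst‖ ^ 2 +
      (inner ℂ (adapted G s p).fst (G (adapted G s p).snd)).re / s - ‖p.fst‖ ^ 2| ≤
      4 * R ^ 2 / s ^ 2 := by
  have hR : 0 ≤ R := (norm_nonneg G).trans hG
  have hs0 : s ≠ 0 := by linarith
  have hs1 := one_le_abs_of_le_neg_one hs
  have p₁ : ‖p.fst‖ ≤ 1 := hp ▸ norm_fst_le p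
  have p₂ : ‖p.snd‖ ≤ 1 := hp ▸ norm_snd_le p
  have g₁ : ‖ContinuousLinearMap.adjoint G p.fst‖ ≤ R :=
    (norm_adjoint_apply_le hG _).trans (by nlinarith)
  have g₂ : ‖G p.snd‖ ≤ R := (norm_apply_le hG _).trans (by nlinarith)
  have hsq := norm_adapted_sq G (s := s) p
  rw [hp, one_pow] at hsq
  have hinv : (1 / (2 * s)) ^ 2 = 1 / 4 / s ^ 2 := by field_simp; norm_num
  have hq : |‖adapted G s p‖ ^ 2 - 1| ≤ R ^ 2 / s ^ 2 := by
    rw [hsq, add_sub_cancel_left, abs_of_nonneg (by positivity), hinv, div_mul_eq_mul_div]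
    gcongr
    have := pow_le_pow_left₀ (norm_nonneg _) g₁ 2
    have := pow_le_pow_left₀ (norm_nonneg _) g₂ 2
    nlinarith [sq_nonneg R]
  have hRs : R ^ 2 / s ^ 2 ≤ 1 := by
    rw [← sq_abs s, div_le_one (by positivity)]; gcongr
  have h2 : ‖adapted G s p‖ ≤ 2 := by
    have := (abs_le.mp hq).2
    nlinarith [norm_nonneg (adapted G s p)]
  have habs : |1 / (2 * s)| = 1 / 2 / |s| := by
    rw [abs_div, abs_one, abs_mul, abs_two]; field_simp
  have d₁ : ‖(adapted G s p).fst - p.fst‖ ≤ R / 2 / |s| := by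
    have : (adapted G s p).fst - p.fst = -(((1 / (2 * s) : ℝ) : ℂ) • G p.snd) := by
      rw [adapted, vec_fst]; abel
    rw [this, norm_neg, norm_smul, Complex.norm_real, Real.norm_eq_abs, habs]
    calc _ ≤ 1 / 2 / |s| * R := by gcongr
      _ = _ := by ring
  have d₂ : ‖(adapted G s p).snd - p.snd‖ ≤ R / 2 / |s| := by
    have : (adapted G s p).snd - p.snd =
        ((1 / (2 * s) : ℝ) : ℂ) • ContinuousLinearMap.adjoint G p.fst := by
      rw [adapted, vec_snd]; abel
    rw [this, norm_smul, Complex.norm_real, Real.norm_eq_abs, habs]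
    calc _ ≤ 1 / 2 / |s| * R := by gcongr
      _ = _ := by ring
  refine ⟨h2, hq, ?_, ?_⟩
  · refine (norm_le_add _).trans ((add_le_add d₁ d₂).trans_eq ?_)
    ring
  · have e₁ : ‖(adapted G s p).fst‖ ^ 2 = ‖p.fst‖ ^ 2 - (inner ℂ p.fst (G p.snd)).re / s +
        1 / 4 / s ^ 2 * ‖G p.snd‖ ^ 2 := by
      have h1 := norm_sub_sq' p.fst (G p.snd) (-(1 / (2 * s)))
      rw [Complex.ofReal_neg, neg_smul, ← sub_eq_add_neg] at h1
      rw [adapted, vec_fst, h1, neg_sq, hinv]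
      field_simp
      ring
    have e₂ : inner ℂ (adapted G s p).fst (G (adapted G s p).snd) - inner ℂ p.fst (G p.snd) =
        inner ℂ ((adapted G s p).fst - p.fst) (G (adapted G s p).snd) +
          inner ℂ p.fst (G ((adapted G s p).snd - p.snd)) := by
      rw [inner_sub_left, map_sub, inner_sub_right]; ring
    have e₃ : |(inner ℂ (adapted G s p).fst (G (adapted G s p).snd)).re -
        (inner ℂ p.fst (G p.snd)).re| ≤ 3 / 2 * R ^ 2 / |s| := by
      rw [← Complex.sub_re, e₂]
      refine (Complex.abs_re_le_norm _).trans ((norm_add_le _ _).trans ?_)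
      have i₁ : ‖G (adapted G s p).snd‖ ≤ R * 2 :=
        (norm_apply_le hG _).trans (by gcongr; exact (norm_snd_le _).trans h2)
      have i₂ : ‖G ((adapted G s p).snd - p.snd)‖ ≤ R * (R / 2 / |s|) :=
        (norm_apply_le hG _).trans (by gcongr)
      calc _ ≤ R / 2 / |s| * (R * 2) + 1 * (R * (R / 2 / |s|)) := by
            refine add_le_add ((norm_inner_le_norm _ _).trans ?_)
              ((norm_inner_le_norm _ _).trans ?_) <;> gcongr
        _ = _ := by ring
    have e₄ : |((inner ℂ (adapted G s p).fst (G (adapted G s p).snd)).re -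
        (inner ℂ p.fst (G p.snd)).re) / s| ≤ 3 / 2 * R ^ 2 / s ^ 2 := by
      rw [abs_div, div_le_iff₀ (by positivity), ← sq_abs s]
      refine e₃.trans_eq ?_
      field_simp
    have e₅ : |1 / 4 / s ^ 2 * ‖G p.snd‖ ^ 2| ≤ 1 / 4 * R ^ 2 / s ^ 2 := by
      rw [abs_of_nonneg (by positivity), div_mul_eq_mul_div]
      gcongr
    have e₆ : 3 / 2 * R ^ 2 / s ^ 2 + 1 / 4 * R ^ 2 / s ^ 2 ≤ 4 * R ^ 2 / s ^ 2 := by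
      rw [← add_div]; gcongr; nlinarith [sq_nonneg R]
    rw [sub_div] at e₄
    rw [e₁]
    rw [abs_le] at *
    constructor <;> linarith [e₄.1, e₄.2, e₅.1, e₅.2]

end LandauZener
end

/-! ### Existence of solutions with a prescribed past state. -/

noncomputable section
namespace LandauZener

variable {H : Type u} [NormedAddCommGroup H] [InnerProductSpace ℂ H] [CompleteSpace H]
variable {G : H →L[ℂ] H} {f₁ f₂ : ℝ × ℝ → ℝ} {δ M R : ℝ}

/-- The constant of the convergence of the states of adapted data. -/
def adaptC (R M : ℝ) : ℝ := 2 * (pastC R M + R) + 2 * M * (2 * pastC R M + 9 * R ^ 2)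

/-- At time `s`, both the adapted data and the expansion of `u` determine the limiting population up
to `O(1/s²)`. So the frequencies of `α` and `β` differ by `O(1/s²)`, and multiplication by `|s|`
costs only `O(1/|s|)`. -/
theorem norm_state_sub_le_of_adapted (hf₁ : Nice f₁ M) (hf₂ : Nice f₂ M) (hG : ‖G‖ ≤ R)
    (hδ : |δ| ≤ 1) {s : ℝ} (hs : s ≤ -1) (hsR : R ≤ |s|) {α β : H2 H} (hα : ‖α‖ = 1)
    {u : ℝ → H2 H} (hu : IsSolution G f₁ f₂ δ u)
    (hus : u s = adapted G s (profile G f₁ f₂ δ 0 α s))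
    (hβ : PastExpansion G f₁ f₂ δ (pastC R M) u β) : ‖β - α‖ ≤ adaptC R M / |s| := by
  have hs1 := one_le_abs_of_le_neg_one hs
  have hM := hf₁.nonneg
  set p := profile G f₁ f₂ δ 0 α s with hp
  have hp1 : ‖p‖ = 1 := by rw [hp, norm_profile, hα]
  obtain ⟨h2, hsq, hd, hpop⟩ := adapted_bounds hG hs hsR hp1
  have hβn : ‖β‖ = ‖adapted G s p‖ := by rw [hβ.norm_eq, hu.norm_eq 0 s, hus]
  have hpf : ‖p.fst‖ = ‖α.fst‖ := by rw [hp, norm_profile_fst]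
  have hx := hβ.population s hs
  rw [hus] at hx
  rw [hpf] at hpop
  have e₁ : |‖β.fst‖ ^ 2 - ‖α.fst‖ ^ 2| ≤ pastC R M / s ^ 2 + 4 * R ^ 2 / s ^ 2 := by
    rw [abs_le] at *
    constructor <;> linarith [hx.1, hx.2, hpop.1, hpop.2]
  have e₂ : |‖β.snd‖ ^ 2 - ‖α.snd‖ ^ 2| ≤
      pastC R M / s ^ 2 + 4 * R ^ 2 / s ^ 2 + R ^ 2 / s ^ 2 := by
    have h3 := norm_sq_eq β
    have h4 := norm_sq_eq α
    rw [hα] at h4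
    rw [← hβn] at hsq
    rw [abs_le] at *
    constructor <;> linarith [hsq.1, hsq.2, e₁.1, e₁.2]
  have hnl : ∀ f, Nice f M →
      |nlF f β - nlF f α| ≤ M * ((2 * pastC R M + 9 * R ^ 2) / s ^ 2) := fun f hf => by
    refine (hf.abs_nlF_sub_le (hβn.trans_le h2) (hα.trans_le one_le_two)).trans ?_
    gcongr
    refine (add_le_add e₁ e₂).trans_eq ?_
    ring
  have hprof : ‖profile G f₁ f₂ δ 0 β s - p‖ ≤ (pastC R M + R) / |s| := by
    have h5 := hβ.sub_profile s hs
    rw [hus, norm_sub_rev] at h5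
    calc _ ≤ _ := norm_sub_le_norm_sub_add_norm_sub _ (adapted G s p) _
      _ ≤ pastC R M / |s| + R / |s| := add_le_add h5 hd
      _ = _ := by ring
  refine (norm_state_sub_le (G := G) (f₁ := f₁) (f₂ := f₂) δ 0 s β α).trans ?_
  rw [hα, mul_one]
  have h6 := add_le_add (hnl f₁ hf₁) (hnl f₂ hf₂)
  have h7 : |δ| * |s| * (|nlF f₁ β - nlF f₁ α| + |nlF f₂ β - nlF f₂ α|) ≤
      1 * |s| * (M * ((2 * pastC R M + 9 * R ^ 2) / s ^ 2) +
        M * ((2 * pastC R M + 9 * R ^ 2) / s ^ 2)) := by gcongr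
  refine (add_le_add (mul_le_mul_of_nonneg_left hprof zero_le_two) h7).trans_eq ?_
  rw [adaptC, ← sq_abs s]
  field_simp
  ring

/-- Every unit vector is the past state of some solution. -/
theorem exists_solution_of_past_state [FiniteDimensional ℂ H] (hf₁ : Nice f₁ M) (hf₂ : Nice f₂ M)
    (hG : ‖G‖ ≤ R) (hδ : |δ| ≤ 1) {α : H2 H} (hα : ‖α‖ = 1) :
    ∃ u, IsSolution G f₁ f₂ δ u ∧ HasPastState G f₁ f₂ δ 0 u α := by
  have hR : 0 ≤ R := (norm_nonneg G).trans hG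
  -- Times tending to `-∞`, below `-1` and with `|t n| ≥ R` as required by `adapted_bounds`.
  let t : ℕ → ℝ := fun n => -(n + (1 + R))
  have ht : ∀ n, t n ≤ -1 := fun n => by
    have : (0 : ℝ) ≤ n := n.cast_nonneg
    simp only [t]; linarith
  have htR : ∀ n, |t n| = n + (1 + R) := fun n => by
    have : (0 : ℝ) ≤ n := n.cast_nonneg
    simp only [t]; rw [abs_neg, abs_of_nonneg (by linarith)]
  have hex : ∀ n, ∃ (u : ℝ → H2 H) (β : H2 H), IsSolution G f₁ f₂ δ u ∧ ‖u 0‖ ≤ 2 ∧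
      PastExpansion G f₁ f₂ δ (pastC R M) u β ∧ ‖β - α‖ ≤ adaptC R M / |t n| := fun n => by
    have hsR : R ≤ |t n| := by
      have : (0 : ℝ) ≤ n := n.cast_nonneg
      rw [htR]; linarith
    have hp1 : ‖profile G f₁ f₂ δ 0 α (t n)‖ = 1 := by rw [norm_profile, hα]
    have h2 := (adapted_bounds hG (ht n) hsR hp1).1
    obtain ⟨u, hu, hus⟩ := exists_solution G hf₁ hf₂ hδ (t n) h2
    have hu2 : ‖u 0‖ ≤ 2 := by rw [hu.norm_eq 0 (t n), hus]; exact h2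
    obtain ⟨β, hβ, -⟩ := hu.exists_pastExpansion hf₁ hf₂ hG hδ hu2
    exact ⟨u, β, hu, hu2, hβ, norm_state_sub_le_of_adapted hf₁ hf₂ hG hδ (ht n) hsR hα hu hus hβ⟩
  choose w β hw hw2 hβ hβα using hex
  have hβlim : Tendsto (fun n => ‖β n - α‖) atTop (𝓝 0) := by
    refine squeeze_zero (fun _ => norm_nonneg _) hβα ?_
    have : Tendsto (fun n : ℕ => |t n|) atTop atTop := by
      simp only [htR]
      exact tendsto_atTop_add_const_right _ _ tendsto_natCast_atTop_atTop
    exact tendsto_const_nhds.div_atTop this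
  have : ProperSpace (H2 H) := FiniteDimensional.proper ℂ (H2 H)
  -- The data at time `0` are bounded and have a convergent subsequence. The constant `pastC R M`
  -- does not depend on `n`, so at each fixed `s` the expansion passes to the limit.
  obtain ⟨y, hy, g, hg, hlim⟩ := (isCompact_closedBall (0 : H2 H) 2).tendsto_subseq
    (x := fun n => w n 0) (fun n => by rw [mem_closedBall_zero_iff]; exact hw2 n)
  rw [mem_closedBall_zero_iff] at hy
  obtain ⟨u, hu, hu0⟩ := exists_solution G hf₁ hf₂ hδ 0 hy
  refine ⟨u, hu, hasPastState_of_le (C := pastC R M) fun s hs => ?_⟩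
  have hβg : Tendsto (fun n => ‖β (g n) - α‖) atTop (𝓝 0) := hβlim.comp hg.tendsto_atTop
  have hyg : Tendsto (fun n => ‖y - w (g n) 0‖) atTop (𝓝 0) := by
    have := (tendsto_const_nhds (x := y)).sub hlim
    rw [sub_self] at this
    simpa using this.norm
  have hbound : Tendsto (fun n => Real.exp (64 * M * |s - 0|) * ‖y - w (g n) 0‖ +
      pastC R M / |s| + (2 + |s| * (16 * M)) * ‖β (g n) - α‖) atTop (𝓝 (pastC R M / |s|)) := by
    have := ((hyg.const_mul (Real.exp (64 * M * |s - 0|))).add_const (pastC R M / |s|)).add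
      (hβg.const_mul (2 + |s| * (16 * M)))
    simpa using this
  refine ge_of_tendsto hbound (Eventually.of_forall fun n => ?_)
  have b₁ : ‖u s - w (g n) s‖ ≤ Real.exp (64 * M * |s - 0|) * ‖y - w (g n) 0‖ := by
    have h1 := hu.norm_sub_le_exp hf₁ hf₂ hδ (hw (g n)) (hu0 ▸ hy) (hw2 _) 0 s
    rw [hu0] at h1
    have h2 : (1 : ℝ) ≤ Real.exp (64 * M * |s - 0|) :=
      Real.one_le_exp (mul_nonneg (mul_nonneg (by norm_num) hf₁.nonneg) (abs_nonneg _))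
    refine le_of_sq_le_sq ?_ (by positivity)
    refine h1.trans ?_
    rw [mul_pow]
    gcongr
    nlinarith
  have b₂ := (hβ (g n)).sub_profile s hs
  have b₃ : ‖profile G f₁ f₂ δ 0 (β (g n)) s - profile G f₁ f₂ δ 0 α s‖ ≤
      (2 + |s| * (16 * M)) * ‖β (g n) - α‖ := by
    refine (norm_profile_sub_le _ _ _ _ _).trans ?_
    have hβ2 : ‖β (g n)‖ ≤ 2 := (hβ (g n)).norm_eq.trans_le (hw2 _)
    have n₁ := hf₁.abs_nlF_sub_le' hβ2 (hα.trans_le one_le_two)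
    have n₂ := hf₂.abs_nlF_sub_le' hβ2 (hα.trans_le one_le_two)
    have : |δ| * |s| * ‖α‖ * (|nlF f₁ (β (g n)) - nlF f₁ α| + |nlF f₂ (β (g n)) - nlF f₂ α|) ≤
        1 * |s| * 1 * (8 * M * ‖β (g n) - α‖ + 8 * M * ‖β (g n) - α‖) := by
      rw [hα]; gcongr
    linarith
  calc _ ≤ _ := norm_sub_le_norm_sub_add_norm_sub _ (w (g n) s) _
    _ ≤ ‖u s - w (g n) s‖ + (‖w (g n) s - profile G f₁ f₂ δ 0 (β (g n)) s‖ +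
        ‖profile G f₁ f₂ δ 0 (β (g n)) s - profile G f₁ f₂ δ 0 α s‖) := by
      gcongr; exact norm_sub_le_norm_sub_add_norm_sub _ _ _
    _ ≤ _ := by linarith

end LandauZener
end

/-! ### Uniqueness for a prescribed past state. -/

noncomputable section
namespace LandauZener

variable {H : Type u} [NormedAddCommGroup H] [InnerProductSpace ℂ H] [CompleteSpace H]
variable {G : H →L[ℂ] H} {f₁ f₂ : ℝ × ℝ → ℝ} {δ M R : ℝ}

theorem abs_re_inner_apply_sub_le (hG : ‖G‖ ≤ R) {a b : H2 H} (ha : ‖a‖ ≤ 2) (hb : ‖b‖ ≤ 2) :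
    |(inner ℂ a.fst (G a.snd)).re - (inner ℂ b.fst (G b.snd)).re| ≤ 4 * R * ‖a - b‖ := by
  have hR : 0 ≤ R := (norm_nonneg G).trans hG
  have e : inner ℂ a.fst (G a.snd) - inner ℂ b.fst (G b.snd) =
      inner ℂ (a - b).fst (G a.snd) + inner ℂ b.fst (G (a - b).snd) := by
    rw [WithLp.sub_fst, WithLp.sub_snd, inner_sub_left, map_sub, inner_sub_right]; ring
  rw [← Complex.sub_re, e]
  refine (Complex.abs_re_le_norm _).trans ((norm_add_le _ _).trans ?_)
  have i₁ : ‖G a.snd‖ ≤ R * 2 :=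
    (norm_apply_le hG _).trans (by gcongr; exact (norm_snd_le _).trans ha)
  have i₂ : ‖G (a - b).snd‖ ≤ R * ‖a - b‖ :=
    (norm_apply_le hG _).trans (by gcongr; exact norm_snd_le _)
  have i₃ := norm_fst_le (a - b)
  have i₄ := (norm_fst_le b).trans hb
  calc _ ≤ ‖a - b‖ * (R * 2) + 2 * (R * ‖a - b‖) := by
        refine add_le_add ((norm_inner_le_norm _ _).trans ?_)
          ((norm_inner_le_norm _ _).trans ?_) <;> gcongr
    _ = _ := by ring

/-- Populations of two solutions that approach each other do so at second order. -/
theorem abs_population_sub_le (hf₁ : Nice f₁ M) (hf₂ : Nice f₂ M) (hG : ‖G‖ ≤ R) (hδ : |δ| ≤ 1)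
    {u v : ℝ → H2 H} (hu : IsSolution G f₁ f₂ δ u) (hv : IsSolution G f₁ f₂ δ v)
    (huv : ‖u 0‖ = ‖v 0‖) (hv2 : ‖v 0‖ ≤ 2) {D : ℝ} (hD : ∀ s ≤ -1, ‖u s - v s‖ ≤ D / |s|)
    {s : ℝ} (hs : s ≤ -1) :
    |‖(u s).fst‖ ^ 2 - ‖(v s).fst‖ ^ 2| ≤ 6 * (R + M) * D / s ^ 2 := by
  have hM := hf₁.nonneg
  have hR : 0 ≤ R := (norm_nonneg G).trans hG
  have pu := hu.pop hf₁ hf₂ hG hδ (huv.trans_le hv2)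
  have pv := hv.pop hf₁ hf₂ hG hδ hv2
  rw [huv] at pu
  have hu2 : ∀ s, ‖u s‖ ≤ 2 := fun s => by rw [hu.norm_eq s 0, huv]; exact hv2
  have hv2' : ∀ s, ‖v s‖ ≤ 2 := fun s => by rw [hv.norm_eq s 0]; exact hv2
  have hx : ∀ s, |‖(u s).fst‖ ^ 2 - ‖(v s).fst‖ ^ 2| ≤ 4 * ‖u s - v s‖ := fun s => by
    refine (abs_norm_sq_sub_le ((norm_fst_le _).trans (hu2 s))
      ((norm_fst_le _).trans (hv2' s))).trans ?_
    rw [← WithLp.sub_fst]; gcongr; exact norm_fst_le _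
  set h : ℝ → ℝ := fun a => ∫ t in (0 : ℝ)..a,
    (f₂ (t, ‖v 0‖ ^ 2 - t) - f₁ (t, ‖v 0‖ ^ 2 - t)) with hh
  have hint : ∀ s, |h (‖(u s).fst‖ ^ 2) - h (‖(v s).fst‖ ^ 2)| ≤ 8 * M * ‖u s - v s‖ := fun s =>
    (pu.abs_integral_sub_le (pu.mem s) (pv.mem s)).trans (by nlinarith [hx s])
  have hρ : ∀ s, |(inner ℂ (u s).fst (G (u s).snd)).re - (inner ℂ (v s).fst (G (v s).snd)).re| ≤
      4 * R * ‖u s - v s‖ := fun s => abs_re_inner_apply_sub_le hG (hu2 s) (hv2' s)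
  have hD0 : 0 ≤ D := by
    have := (norm_nonneg _).trans (hD (-1) le_rfl)
    rwa [abs_neg, abs_one, div_one] at this
  -- The corrected population of `Pop.hasDerivAt_corrected`. Its difference for the two solutions
  -- has a derivative of size `D/|s|³` and tends to zero, hence is `O(D/s²)`; the correction terms
  -- differ by `O(D/s²)` as well.
  set Q : (ℝ → H2 H) → ℝ → ℝ := fun u s => ‖(u s).fst‖ ^ 2 +
    (inner ℂ (u s).fst (G (u s).snd)).re / s - δ / 2 * (h (‖(u s).fst‖ ^ 2) - 0) / s with hQ
  have hcor : ∀ s, |(inner ℂ (u s).fst (G (u s).snd)).re -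
      (inner ℂ (v s).fst (G (v s).snd)).re| +
      |δ / 2 * (h (‖(u s).fst‖ ^ 2) - h (‖(v s).fst‖ ^ 2))| ≤ 4 * (R + M) * ‖u s - v s‖ :=
    fun s => by
      rw [abs_mul, abs_div, abs_two]
      have : |δ| / 2 * |h (‖(u s).fst‖ ^ 2) - h (‖(v s).fst‖ ^ 2)| ≤
        1 / 2 * (8 * M * ‖u s - v s‖) := by gcongr; exact hint s
      linarith [hρ s]
  have hQx : ∀ s ≤ -1, |(Q u s - Q v s) - (‖(u s).fst‖ ^ 2 - ‖(v s).fst‖ ^ 2)| ≤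
      4 * (R + M) * D / s ^ 2 := fun s hs => by
    have e : (Q u s - Q v s) - (‖(u s).fst‖ ^ 2 - ‖(v s).fst‖ ^ 2) =
        ((inner ℂ (u s).fst (G (u s).snd)).re - (inner ℂ (v s).fst (G (v s).snd)).re -
          δ / 2 * (h (‖(u s).fst‖ ^ 2) - h (‖(v s).fst‖ ^ 2))) / s := by
      simp only [hQ]; ring
    have hs1 := one_le_abs_of_le_neg_one hs
    rw [e, abs_div]
    calc _ ≤ 4 * (R + M) * (D / |s|) / |s| := by
          gcongr
          exact (abs_sub _ _).trans ((hcor s).trans (by gcongr; exact hD s hs))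
      _ = _ := by rw [← sq_abs s]; field_simp
  obtain ⟨l, hl, hb⟩ := exists_limit_of_deriv_le_cube (y := fun s => Q u s - Q v s)
    (C := 2 * (R + M) * D)
    (fun s hs => (pu.hasDerivAt_corrected hs 0).sub (pv.hasDerivAt_corrected hs 0))
    (fun s hs => by
      have hs1 := one_le_abs_of_le_neg_one hs
      rw [← sub_div, Real.norm_eq_abs, abs_div, abs_of_nonneg (sq_nonneg s)]
      have e : ∀ a b c d x : ℝ, -a + x * (c - 0) - (-b + x * (d - 0)) =
        x * (c - d) - (a - b) := fun a b c d x => by ring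
      rw [e]
      calc _ ≤ 4 * (R + M) * (D / |s|) / s ^ 2 := by
            gcongr
            refine (abs_sub _ _).trans ?_
            rw [add_comm]
            exact (hcor s).trans (by gcongr; exact hD s hs)
        _ = _ := by rw [← sq_abs s]; field_simp; ring)
  have hlim0 : Tendsto (fun s => Q u s - Q v s) atBot (𝓝 0) := by
    have h1 : Tendsto (fun s => (4 * (R + M) * D) / s ^ 2 + 4 * D / |s|) atBot (𝓝 (0 + 0)) :=
      (tendsto_const_div_sq_atBot _).add (tendsto_const_div_abs_atBot _)
    rw [add_zero] at h1
    refine squeeze_zero_norm' ?_ h1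
    refine eventually_atBot_of_le_neg_one fun s hs => ?_
    have h2 := hQx s hs
    have h3 := (hx s).trans (mul_le_mul_of_nonneg_left (hD s hs) (by norm_num))
    rw [← mul_div_assoc] at h3
    rw [Real.norm_eq_abs]
    rw [abs_le] at *
    constructor <;> linarith [h2.1, h2.2, h3.1, h3.2]
  obtain rfl := tendsto_nhds_unique hl hlim0
  have h4 := hb s hs
  rw [sub_zero, Real.norm_eq_abs] at h4
  have h5 := hQx s hs
  have h6 : 6 * (R + M) * D / s ^ 2 = 2 * (R + M) * D / s ^ 2 + 4 * (R + M) * D / s ^ 2 := by ring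
  rw [h6]
  rw [abs_le] at *
  constructor <;> linarith [h4.1, h4.2, h5.1, h5.2]

/-- One step of the contraction argument for uniqueness. -/
theorem norm_sub_le_of_norm_sub_le (hf₁ : Nice f₁ M) (hf₂ : Nice f₂ M) (hG : ‖G‖ ≤ R)
    (hδ : |δ| ≤ 1) {u v : ℝ → H2 H} (hu : IsSolution G f₁ f₂ δ u) (hv : IsSolution G f₁ f₂ δ v)
    (huv : ‖u 0‖ = ‖v 0‖) (hv2 : ‖v 0‖ ≤ 2) {D : ℝ} (hD : ∀ s ≤ -1, ‖u s - v s‖ ≤ D / |s|)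
    {s : ℝ} (hs : s ≤ -1) : ‖u s - v s‖ ≤ 48 * M * (R + M) * |δ| * D / |s| := by
  have hM := hf₁.nonneg
  have hR : 0 ≤ R := (norm_nonneg G).trans hG
  have hu2 : ∀ s, ‖u s‖ ≤ 2 := fun s => by rw [hu.norm_eq s 0, huv]; exact hv2
  have hv2' : ∀ s, ‖v s‖ ≤ 2 := fun s => by rw [hv.norm_eq s 0]; exact hv2
  have hD0 : 0 ≤ D := by
    have := (norm_nonneg _).trans (hD (-1) le_rfl)
    rwa [abs_neg, abs_one, div_one] at this
  have key := sqrt_energy_le_of_tendsto_zero (e := fun s => ‖u s - v s‖ ^ 2)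
    (C := 48 * M * (R + M) * |δ| * D) (fun s _ => sq_nonneg _)
    (fun s _ => hasDerivAt_norm_sq ((hu s).sub (hv s)))
    (fun s hs => by
      rw [Real.sqrt_sq (norm_nonneg _), abs_mul, abs_two, mul_assoc]
      refine mul_le_mul_of_nonneg_left ?_ zero_le_two
      refine (abs_re_inner_field_sub_le G f₁ f₂ δ s (u s) (v s)).trans ?_
      gcongr
      have hx := abs_population_sub_le hf₁ hf₂ hG hδ hu hv huv hv2 hD hs
      have hn : ∀ f, Nice f M →
          |nlF f (u s) - nlF f (v s)| ≤ 2 * M * (6 * (R + M) * D / s ^ 2) := fun f hf => by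
        refine (hf.abs_nlF_sub_le (hu2 s) (hv2' s)).trans ?_
        have e : ‖(u s).snd‖ ^ 2 - ‖(v s).snd‖ ^ 2 =
            -(‖(u s).fst‖ ^ 2 - ‖(v s).fst‖ ^ 2) := by
          have h1 := norm_sq_eq (u s)
          have h2 := norm_sq_eq (v s)
          rw [hu.norm_eq s 0, huv] at h1
          rw [hv.norm_eq s 0] at h2
          linarith
        rw [e, abs_neg]
        nlinarith
      have g₁ := (norm_fst_le (v s)).trans (hv2' s)
      have g₂ := (norm_snd_le (v s)).trans (hv2' s)
      have h1 := mul_le_mul (hn f₁ hf₁) g₁ (norm_nonneg _) (by positivity)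
      have h2 := mul_le_mul (hn f₂ hf₂) g₂ (norm_nonneg _) (by positivity)
      -- The constant is `48 = 2 · 2 · 2 · 6`: two components, each of norm at most `2`, two equal
      -- population differences in the Lipschitz bound, and the `6` of `abs_population_sub_le`.
      calc _ ≤ |δ| * (2 * M * (6 * (R + M) * D / s ^ 2) * 2 +
            2 * M * (6 * (R + M) * D / s ^ 2) * 2) := by gcongr
        _ = _ := by ring)
    (by positivity)
    (by
      have h1 : Tendsto (fun s => (D / |s|) ^ 2) atBot (𝓝 (0 ^ 2)) :=
        (tendsto_const_div_abs_atBot D).pow 2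
      rw [zero_pow two_ne_zero] at h1
      refine squeeze_zero' (Eventually.of_forall fun _ => sq_nonneg _)
        (eventually_atBot_of_le_neg_one fun s hs => ?_) h1
      gcongr
      exact hD s hs) hs
  rwa [Real.sqrt_sq (norm_nonneg _)] at key

/-- Solutions are determined by their past state when the coupling is weak. -/
theorem IsSolution.eq_of_past_state (hf₁ : Nice f₁ M) (hf₂ : Nice f₂ M) (hG : ‖G‖ ≤ R)
    (hδ : |δ| ≤ 1) (hδ' : 48 * M * (R + M) * |δ| ≤ 1 / 2) {u v : ℝ → H2 H} {α : H2 H}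
    (hα : ‖α‖ ≤ 2) (hu : IsSolution G f₁ f₂ δ u) (hv : IsSolution G f₁ f₂ δ v)
    (hu' : HasPastState G f₁ f₂ δ 0 u α) (hv' : HasPastState G f₁ f₂ δ 0 v α) : u = v := by
  have eu := (hu.pastExpansion hf₁ hf₂ hG hδ hα hu'.tendsto).1
  have ev := (hv.pastExpansion hf₁ hf₂ hG hδ hα hv'.tendsto).1
  have huv : ‖u 0‖ = ‖v 0‖ := by rw [← eu.norm_eq, ev.norm_eq]
  have hv2 : ‖v 0‖ ≤ 2 := ev.norm_eq ▸ hα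
  -- Both solutions are `pastC/|s|`-close to the same profile, and by the smallness of `δ` each
  -- contraction step halves the constant.
  have key : ∀ n : ℕ, ∀ s ≤ -1, ‖u s - v s‖ ≤ (1 / 2) ^ n * (2 * pastC R M) / |s| := by
    intro n
    induction n with
    | zero =>
      intro s hs
      have h1 := eu.sub_profile s hs
      have h2 := ev.sub_profile s hs
      rw [norm_sub_rev] at h2
      calc _ ≤ _ := norm_sub_le_norm_sub_add_norm_sub _ (profile G f₁ f₂ δ 0 α s) _
        _ ≤ pastC R M / |s| + pastC R M / |s| := add_le_add h1 h2
        _ = _ := by ring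
    | succ n ih =>
      intro s hs
      refine (norm_sub_le_of_norm_sub_le hf₁ hf₂ hG hδ hu hv huv hv2 ih hs).trans ?_
      have hC := pastC_nonneg ((norm_nonneg G).trans hG) hf₁.nonneg
      rw [pow_succ']
      have : 48 * M * (R + M) * |δ| * ((1 / 2) ^ n * (2 * pastC R M)) ≤
        1 / 2 * ((1 / 2) ^ n * (2 * pastC R M)) := by gcongr
      exact div_le_div_of_nonneg_right (by linarith) (abs_nonneg _)
  refine hu.eq_of_eq hf₁ hf₂ hδ hv (huv.trans_le hv2) (s := -1) ?_
  have h0 : Tendsto (fun n : ℕ => (1 / 2 : ℝ) ^ n * (2 * pastC R M) / |-1|) atTop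
      (𝓝 (0 * (2 * pastC R M) / |-1|)) :=
    ((tendsto_pow_atTop_nhds_zero_of_lt_one (by norm_num) (by norm_num)).mul_const _).div_const _
  rw [zero_mul, zero_div] at h0
  have := ge_of_tendsto h0 (Eventually.of_forall fun n => key n (-1) le_rfl)
  exact sub_eq_zero.mp (norm_le_zero_iff.mp this)

end LandauZener
end

/-! ### The corrector for the gauged equation. -/

noncomputable section
namespace LandauZener

/-- The corrector that removes the oscillating forcing by a slowly varying gauge factor `e`. -/
def gaugeCorr (σ δ κ s : ℝ) (e : ℂ) : ℂ :=
  -(σ : ℂ) * (e - 1) / (2 * s) + δ * κ * e / (2 * s ^ 2) - Complex.I * (e - 1) / (4 * s ^ 3)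

/-- The remainder in the equation for `gaugeCorr`. -/
def gaugeRes (δ κ κ' s : ℝ) (e : ℂ) : ℂ :=
  -(δ * (κ' * e - 2 * Complex.I * δ * κ ^ 2 * e) / (2 * s ^ 2)) + δ * κ * e / s ^ 3 +
    δ * κ * e / (2 * s ^ 3) - 3 * Complex.I * (e - 1) / (4 * s ^ 4)

/-- The corrector solves `c' = 2iσs c + i(e - 1)` approximately. Its leading term `-σ(e - 1)/(2s)`
balances the forcing; the other two terms balance the derivative of the leading one, namely the
parts from `e'` and from `1/s`. Since `e - 1` is only `O(|δ||s|)`, the last part would otherwise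
leave a nonintegrable `|δ|/|s|`. -/
theorem hasDerivAt_gaugeCorr {σ δ : ℝ} (hσ : σ * σ = 1) {κ : ℝ → ℝ} {κ' : ℝ} {e : ℝ → ℂ} {s : ℝ}
    (hs : s ≠ 0) (he : HasDerivAt e (-(2 * Complex.I * δ * κ s * e s)) s) (hκ : HasDerivAt κ κ' s) :
    HasDerivAt (fun s => gaugeCorr σ δ (κ s) s (e s))
      (2 * Complex.I * σ * s * gaugeCorr σ δ (κ s) s (e s) + Complex.I * (e s - 1) -
        gaugeRes δ (κ s) κ' s (e s)) s := by
  have hsC : (s : ℂ) ≠ 0 := Complex.ofReal_ne_zero.mpr hs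
  have hid : HasDerivAt (fun s : ℝ => (s : ℂ)) 1 s := Complex.ofRealCLM.hasDerivAt
  have hκC : HasDerivAt (fun s => (κ s : ℂ)) (κ' : ℂ) s := hκ.ofReal_comp
  have h1 := ((he.sub_const 1).const_mul (-(σ : ℂ))).fun_div (hid.const_mul 2)
    (mul_ne_zero two_ne_zero hsC)
  have h2 := ((hκC.const_mul (δ : ℂ)).fun_mul he).fun_div ((hid.fun_pow 2).const_mul 2)
    (mul_ne_zero two_ne_zero (pow_ne_zero 2 hsC))
  have h3 := ((he.sub_const 1).const_mul Complex.I).fun_div ((hid.fun_pow 3).const_mul 4)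
    (mul_ne_zero (by norm_num) (pow_ne_zero 3 hsC))
  have hσC : (σ : ℂ) * σ = 1 := by exact_mod_cast hσ
  refine ((h1.fun_add h2).fun_sub h3).congr_deriv ?_
  rw [gaugeCorr, gaugeRes]
  have e1 : 2 * Complex.I * σ * s * (-(σ : ℂ) * (e s - 1) / (2 * s) + δ * κ s * e s / (2 * s ^ 2) -
      Complex.I * (e s - 1) / (4 * s ^ 3)) = -Complex.I * (σ * σ) * (e s - 1) +
      Complex.I * σ * δ * κ s * e s / s - (Complex.I * Complex.I) * σ * (e s - 1) / (2 * s ^ 2) := by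
    field_simp
    ring
  rw [e1, hσC, Complex.I_mul_I]
  field_simp
  ring_nf
  rw [Complex.I_sq]
  ring

/-- The bound `b` is left free: `b = 2` gives decay at `-∞`, while `b` proportional to `|δ|` gives
smallness at `s = -1`. -/
theorem norm_gaugeCorr_le {σ δ κ s : ℝ} {e : ℂ} (hσ : |σ| = 1) (hs : 1 ≤ |s|) {M b : ℝ}
    (hκ : |κ| ≤ M) (he : ‖e‖ = 1) (hb : ‖e - 1‖ ≤ b) :
    ‖gaugeCorr σ δ κ s e‖ ≤ (b + |δ| * M) / |s| := by
  have hs2 : |s| ≤ |s| ^ 2 := by nlinarith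
  have hs3 : |s| ≤ |s| ^ 3 := by nlinarith [sq_nonneg |s|]
  have hb0 := (norm_nonneg _).trans hb
  have hM := (abs_nonneg _).trans hκ
  have t₁ : ‖-(σ : ℂ) * (e - 1) / (2 * s)‖ ≤ b / 2 / |s| := by
    rw [norm_div, norm_mul, norm_neg, Complex.norm_real, Real.norm_eq_abs, hσ, norm_mul,
      Complex.norm_real, Real.norm_eq_abs, Complex.norm_two, one_mul, div_div]
    gcongr
  have t₂ : ‖(δ : ℂ) * κ * e / (2 * s ^ 2)‖ ≤ |δ| * M / |s| := by
    rw [norm_div, norm_mul, norm_mul, he, Complex.norm_real, Complex.norm_real, norm_mul, norm_pow,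
      Complex.norm_real, Complex.norm_two, mul_one]
    simp only [Real.norm_eq_abs]
    gcongr
    linarith
  have t₃ : ‖Complex.I * (e - 1) / (4 * s ^ 3)‖ ≤ b / 2 / |s| := by
    rw [norm_div, norm_mul, Complex.norm_I, one_mul, norm_mul, norm_pow, Complex.norm_real,
      Complex.norm_ofNat, div_div]
    simp only [Real.norm_eq_abs]
    gcongr
    linarith
  calc _ ≤ b / 2 / |s| + |δ| * M / |s| + b / 2 / |s| :=
        (norm_sub_le _ _).trans (add_le_add ((norm_add_le _ _).trans (add_le_add t₁ t₂)) t₃)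
    _ = _ := by ring

theorem norm_gaugeRes_le {δ κ κ' s : ℝ} {e : ℂ} (hδ : |δ| ≤ 1) (hs : 1 ≤ |s|) {M L K : ℝ}
    (hκ : |κ| ≤ M) (hκ' : |κ'| ≤ L) (he : ‖e‖ = 1) (hb : ‖e - 1‖ ≤ |δ| * (K * |s|)) :
    ‖gaugeRes δ κ κ' s e‖ ≤ |δ| * (L + M ^ 2 + 2 * M + K) / s ^ 2 := by
  have hs3 : |s| ^ 2 ≤ |s| ^ 3 := by nlinarith [sq_nonneg |s|]
  have hM := (abs_nonneg _).trans hκ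
  have hL := (abs_nonneg _).trans hκ'
  have hK : 0 ≤ |δ| * K := by
    have := (norm_nonneg _).trans hb
    rw [← mul_assoc] at this
    exact nonneg_of_mul_nonneg_left this (by linarith)
  have t₁ : ‖-((δ : ℂ) * (κ' * e - 2 * Complex.I * δ * κ ^ 2 * e) / (2 * s ^ 2))‖ ≤
      |δ| * (L + M ^ 2) / s ^ 2 := by
    rw [norm_neg, norm_div, norm_mul, norm_mul, norm_pow]
    simp only [Complex.norm_real, Complex.norm_two, Real.norm_eq_abs, sq_abs]
    have : ‖(κ' : ℂ) * e - 2 * Complex.I * δ * κ ^ 2 * e‖ ≤ L + 2 * 1 * M ^ 2 := by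
      refine (norm_sub_le _ _).trans ?_
      simp only [norm_mul, norm_pow, he, Complex.norm_real, Complex.norm_two, Real.norm_eq_abs,
        Complex.norm_I, mul_one]
      gcongr
      linarith
    calc _ ≤ |δ| * (L + 2 * 1 * M ^ 2) / (2 * s ^ 2) := by gcongr
      _ = |δ| * (L / 2 + M ^ 2) / s ^ 2 := by field_simp
      _ ≤ _ := by gcongr; linarith
  have t₂ : ‖(δ : ℂ) * κ * e / s ^ 3‖ ≤ |δ| * M / s ^ 2 := by
    rw [norm_div, norm_mul, norm_mul, he, norm_pow]
    simp only [Complex.norm_real, Real.norm_eq_abs, mul_one]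
    rw [← sq_abs s]
    gcongr
  have t₃ : ‖(δ : ℂ) * κ * e / (2 * s ^ 3)‖ ≤ |δ| * M / s ^ 2 := by
    rw [norm_div, norm_mul, norm_mul, he, norm_mul, norm_pow]
    simp only [Complex.norm_real, Real.norm_eq_abs, mul_one, Complex.norm_two]
    rw [← sq_abs s]
    gcongr
    nlinarith [sq_nonneg |s|]
  have t₄ : ‖3 * Complex.I * (e - 1) / (4 * s ^ 4)‖ ≤ |δ| * K / s ^ 2 := by
    rw [norm_div, norm_mul, norm_mul, norm_mul, norm_pow]
    simp only [Complex.norm_real, Real.norm_eq_abs, mul_one, Complex.norm_ofNat, Complex.norm_I]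
    rw [← sq_abs s, div_le_div_iff₀ (by positivity) (by positivity)]
    calc 3 * ‖e - 1‖ * |s| ^ 2 ≤ 3 * (|δ| * (K * |s|)) * |s| ^ 2 := by gcongr
      _ = 3 * (|δ| * K) * |s| ^ 3 := by ring
      _ ≤ 4 * (|δ| * K) * |s| ^ 4 := by
        gcongr
        · norm_num
        · norm_num
      _ = _ := by ring
  calc _ ≤ |δ| * (L + M ^ 2) / s ^ 2 + |δ| * M / s ^ 2 + |δ| * M / s ^ 2 + |δ| * K / s ^ 2 :=
        (norm_sub_le _ _).trans (add_le_add ((norm_add_le _ _).trans (add_le_add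
          ((norm_add_le _ _).trans (add_le_add t₁ t₂)) t₃)) t₄)
    _ = _ := by ring

/-- The corrector of one component feeds into the equation of the other. As `e (e' - 1) = 1 - e`,
the leading terms of order `1/s` cancel. -/
theorem norm_gaugeCorr_cross_le {σ δ κ s : ℝ} {e e' : ℂ} (hs : 1 ≤ |s|) {M K : ℝ}
    (hκ : |κ| ≤ M) (he : ‖e‖ = 1) (hee : e * e' = 1) (hb : ‖e - 1‖ ≤ |δ| * (K * |s|)) :
    ‖e * gaugeCorr (-σ) δ (-κ) s e' - gaugeCorr σ δ κ s e‖ ≤ |δ| * (M + K) / s ^ 2 := by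
  have hM := (abs_nonneg _).trans hκ
  have hs0 : s ≠ 0 := fun h => by norm_num [h] at hs
  have hsC : (s : ℂ) ≠ 0 := Complex.ofReal_ne_zero.mpr hs0
  have e1 : e * gaugeCorr (-σ) δ (-κ) s e' - gaugeCorr σ δ κ s e =
      -(δ * κ * (1 + e) / (2 * s ^ 2)) + Complex.I * (e - 1) / (2 * s ^ 3) := by
    have : e * gaugeCorr (-σ) δ (-κ) s e' = (σ : ℂ) * (e * e' - e) / (2 * s) -
        δ * κ * (e * e') / (2 * s ^ 2) - Complex.I * (e * e' - e) / (4 * s ^ 3) := by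
      rw [gaugeCorr]; push_cast; ring
    rw [this, hee, gaugeCorr]
    field_simp
    ring
  rw [e1]
  have t₁ : ‖-((δ : ℂ) * κ * (1 + e) / (2 * s ^ 2))‖ ≤ |δ| * M / s ^ 2 := by
    rw [norm_neg, norm_div, norm_mul, norm_mul, norm_mul, norm_pow]
    simp only [Complex.norm_real, Complex.norm_two, Real.norm_eq_abs, sq_abs]
    have : ‖1 + e‖ ≤ 2 := (norm_add_le _ _).trans (by rw [norm_one, he]; norm_num)
    calc _ ≤ |δ| * M * 2 / (2 * s ^ 2) := by gcongr
      _ = _ := by field_simp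
  have t₂ : ‖Complex.I * (e - 1) / (2 * s ^ 3)‖ ≤ |δ| * K / s ^ 2 := by
    rw [norm_div, norm_mul, norm_mul, norm_pow, Complex.norm_I, one_mul]
    simp only [Complex.norm_real, Complex.norm_two, Real.norm_eq_abs]
    rw [← sq_abs s, div_le_div_iff₀ (by positivity) (by positivity)]
    have hK : 0 ≤ |δ| * K := by
      have := (norm_nonneg _).trans hb
      rw [← mul_assoc] at this
      exact nonneg_of_mul_nonneg_left this (by linarith)
    calc ‖e - 1‖ * |s| ^ 2 ≤ |δ| * (K * |s|) * |s| ^ 2 := by gcongr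
      _ = 1 * (|δ| * K * |s| ^ 3) := by ring
      _ ≤ 2 * (|δ| * K * |s| ^ 3) := by gcongr; norm_num
      _ = _ := by ring
  calc _ ≤ |δ| * M / s ^ 2 + |δ| * K / s ^ 2 := (norm_add_le _ _).trans (add_le_add t₁ t₂)
    _ = _ := by ring

variable {H : Type u} [NormedAddCommGroup H] [InnerProductSpace ℂ H] [CompleteSpace H]

theorem hasDerivAt_cexp_real {Φ : ℝ → ℝ} {Φ' s : ℝ} (h : HasDerivAt Φ Φ' s) :
    HasDerivAt (fun s => Complex.exp (Complex.I * Φ s))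
      (Complex.I * Φ' * Complex.exp (Complex.I * Φ s)) s :=
  ((h.ofReal_comp.const_mul Complex.I).cexp).congr_deriv (by ring)

/-- The phase factors absorb the potentials; only the relative phase of the two components survives,
as a factor in the coupling. -/
theorem Sys.hasDerivAt_gauged {σ : ℝ} {B : H →L[ℂ] H} {δ : ℝ} {F₁ F₂ Φ₁ Φ₂ : ℝ → ℝ}
    {y₁ y₂ : ℝ → H} (h : Sys σ B δ F₁ F₂ y₁ y₂) {s : ℝ} (h₁ : HasDerivAt Φ₁ (F₁ s) s) :
    HasDerivAt (fun s => Complex.exp (Complex.I * ((-δ * Φ₁ s : ℝ) : ℂ)) • y₁ s)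
      (Complex.I • (((σ * s : ℝ) : ℂ) • (Complex.exp (Complex.I * ((-δ * Φ₁ s : ℝ) : ℂ)) • y₁ s) +
        Complex.exp (Complex.I * ((-δ * (Φ₁ s - Φ₂ s) : ℝ) : ℂ)) •
          B (Complex.exp (Complex.I * ((-δ * Φ₂ s : ℝ) : ℂ)) • y₂ s))) s := by
  have e1 : Complex.exp (Complex.I * ((-δ * (Φ₁ s - Φ₂ s) : ℝ) : ℂ)) *
      Complex.exp (Complex.I * ((-δ * Φ₂ s : ℝ) : ℂ)) =
      Complex.exp (Complex.I * ((-δ * Φ₁ s : ℝ) : ℂ)) := by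
    rw [← Complex.exp_add]; congr 1; push_cast; ring
  rw [map_smul, smul_smul (Complex.exp _) (Complex.exp _), e1]
  refine ((hasDerivAt_cexp_real (h₁.const_mul (-δ))).fun_smul (h.fst s)).congr_deriv ?_
  push_cast
  module

/-- The corrected difference of a gauged solution and a linear solution. -/
theorem hasDerivAt_gauged_sub {σ : ℝ} (hσ : σ * σ = 1) {B : H →L[ℂ] H} {δ : ℝ}
    {A₁ A₂ κ : ℝ → ℝ} {κ' : ℝ} {a₁ a₂ v₁ v₂ : ℝ → H} {e e' : ℝ → ℂ} {s : ℝ} (hs : s ≠ 0)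
    (hv : Sys σ B 0 A₁ A₂ v₁ v₂)
    (ha : HasDerivAt a₁ (Complex.I • (((σ * s : ℝ) : ℂ) • a₁ s + e s • B (a₂ s))) s)
    (he : HasDerivAt e (-(2 * Complex.I * δ * κ s * e s)) s) (hκ : HasDerivAt κ κ' s) :
    HasDerivAt (fun s => a₁ s - v₁ s - gaugeCorr σ δ (κ s) s (e s) • B (v₂ s))
      (Complex.I • (((σ * s : ℝ) : ℂ) •
          (a₁ s - v₁ s - gaugeCorr σ δ (κ s) s (e s) • B (v₂ s)) +
        e s • B (a₂ s - v₂ s - gaugeCorr (-σ) δ (-κ s) s (e' s) •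
          ContinuousLinearMap.adjoint B (v₁ s))) +
        (gaugeRes δ (κ s) κ' s (e s) • B (v₂ s) +
          (Complex.I * (e s * gaugeCorr (-σ) δ (-κ s) s (e' s) - gaugeCorr σ δ (κ s) s (e s))) •
            B (ContinuousLinearMap.adjoint B (v₁ s)))) s := by
  have hBv := (B.restrictScalars ℝ).hasFDerivAt.comp_hasDerivAt s (hv.snd s)
  refine ((ha.fun_sub (hv.fst s)).fun_sub
    ((hasDerivAt_gaugeCorr hσ hs he hκ).fun_smul hBv)).congr_deriv ?_
  simp only [ContinuousLinearMap.coe_restrictScalars', Function.comp_apply, map_sub, map_smul,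
    zero_mul, Complex.ofReal_zero, zero_smul, add_zero]
  push_cast
  module

end LandauZener
end

/-! ### Comparison with the linear solution on the negative half-line. -/

noncomputable section
namespace LandauZener

variable {H : Type u} [NormedAddCommGroup H] [InnerProductSpace ℂ H] [CompleteSpace H]
variable {G : H →L[ℂ] H} {f₁ f₂ : ℝ × ℝ → ℝ} {δ M R : ℝ}

/-- The couplings `e B` and `ē B*` are adjoint to each other, so the homogeneous part preserves the
energy and only the remainders contribute. -/
theorem abs_energy_deriv_le (B : H →L[ℂ] H) (z₁ z₂ r₁ r₂ : H) (τ : ℝ) (e : ℂ) {D : ℝ}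
    (h₁ : ‖r₁‖ ≤ D) (h₂ : ‖r₂‖ ≤ D) :
    |2 * (inner ℂ z₁ (Complex.I • ((τ : ℂ) • z₁ + e • B z₂) + r₁)).re +
      2 * (inner ℂ z₂ (Complex.I • (((-τ : ℝ) : ℂ) • z₂ +
        (starRingEnd ℂ e) • ContinuousLinearMap.adjoint B z₁) + r₂)).re| ≤
      2 * √(‖z₁‖ ^ 2 + ‖z₂‖ ^ 2) * (2 * D) := by
  have c₁ := re_inner_smul_I_self z₁ τ
  have c₂ := re_inner_smul_I_self z₂ (-τ)
  have c₃ : (inner ℂ z₂ (Complex.I • (starRingEnd ℂ e) •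
      ContinuousLinearMap.adjoint B z₁)).re = -(inner ℂ z₁ (Complex.I • e • B z₂)).re := by
    simp only [inner_smul_right, ContinuousLinearMap.adjoint_inner_right]
    rw [← inner_conj_symm (B z₂) z₁]
    generalize inner ℂ z₁ (B z₂) = w
    simp
    ring
  simp only [smul_add, inner_add_right, Complex.add_re, c₁, c₂, c₃]
  have s₁ : ‖z₁‖ ≤ √(‖z₁‖ ^ 2 + ‖z₂‖ ^ 2) := Real.le_sqrt_of_sq_le (by linarith [sq_nonneg ‖z₂‖])
  have s₂ : ‖z₂‖ ≤ √(‖z₁‖ ^ 2 + ‖z₂‖ ^ 2) := Real.le_sqrt_of_sq_le (by linarith [sq_nonneg ‖z₁‖])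
  have hD := (norm_nonneg _).trans h₁
  have t₁ : |(inner ℂ z₁ r₁).re| ≤ √(‖z₁‖ ^ 2 + ‖z₂‖ ^ 2) * D :=
    (Complex.abs_re_le_norm _).trans ((norm_inner_le_norm _ _).trans (by gcongr))
  have t₂ : |(inner ℂ z₂ r₂).re| ≤ √(‖z₁‖ ^ 2 + ‖z₂‖ ^ 2) * D :=
    (Complex.abs_re_le_norm _).trans ((norm_inner_le_norm _ _).trans (by gcongr))
  rw [abs_le] at *
  constructor <;> linarith [t₁.1, t₁.2, t₂.1, t₂.2]

theorem norm_gauged_sub_le {A : H →L[ℂ] H} (hA : IsSelfAdjoint A) (r θ ψ ψ' : ℝ) (a y w : H) :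
    ‖Complex.exp (Complex.I * θ) • y - w‖ ≤ ‖y - Complex.exp (Complex.I * ψ) • rot A r a‖ +
      |θ + ψ - ψ'| * ‖a‖ + ‖w - Complex.exp (Complex.I * ψ') • rot A r a‖ := by
  have e : Complex.exp (Complex.I * θ) • y - w =
      Complex.exp (Complex.I * θ) • (y - Complex.exp (Complex.I * ψ) • rot A r a) +
      (Complex.exp (Complex.I * ((θ + ψ : ℝ) : ℂ)) - Complex.exp (Complex.I * ψ')) • rot A r a -
      (w - Complex.exp (Complex.I * ψ') • rot A r a) := by
    have : Complex.exp (Complex.I * ((θ + ψ : ℝ) : ℂ)) =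
        Complex.exp (Complex.I * θ) * Complex.exp (Complex.I * ψ) := by
      rw [← Complex.exp_add]; congr 1; push_cast; ring
    rw [this]; module
  rw [e]
  refine (norm_sub_le _ _).trans (add_le_add ((norm_add_le _ _).trans (add_le_add ?_ ?_)) le_rfl)
  · rw [norm_smul, norm_cexp_I_mul, one_mul]
  · rw [norm_smul, norm_rot_apply hA]
    gcongr
    exact norm_cexp_sub_cexp_le _ _

theorem norm_cexp_sub_one_le (a : ℝ) : ‖Complex.exp (Complex.I * a) - 1‖ ≤ |a| := by
  have h := norm_cexp_sub_cexp_le a 0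
  rwa [Complex.ofReal_zero, mul_zero, Complex.exp_zero, sub_zero] at h

/-- Growth constant of the phase difference. -/
def gapC (R M : ℝ) : ℝ := 2 * M + 2 * pastC R M

/-- Constant of the remainder in the comparison with the linear equation. -/
def compareC (R M : ℝ) : ℝ :=
  (M + 8 * M * R + M ^ 2 + 2 * M + gapC R M) * R + (M + gapC R M) * R ^ 2

/-- Constant of the comparison with the linear equation at time `-1`. -/
def nearC (R M : ℝ) : ℝ :=
  2 * (2 * compareC R M + (M + pastC R M) + (gapC R M + M) * R)

theorem gapC_nonneg (hR : 0 ≤ R) (hM : 0 ≤ M) : 0 ≤ gapC R M := by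
  have := pastC_nonneg hR hM
  rw [gapC]; positivity

theorem compareC_nonneg (hR : 0 ≤ R) (hM : 0 ≤ M) : 0 ≤ compareC R M := by
  have := gapC_nonneg hR hM
  rw [compareC]; positivity

theorem nearC_nonneg (hR : 0 ≤ R) (hM : 0 ≤ M) : 0 ≤ nearC R M := by
  have := gapC_nonneg hR hM
  have := pastC_nonneg hR hM
  have := compareC_nonneg hR hM
  rw [nearC]; positivity

theorem norm_remainder_le {B : H →L[ℂ] H} (hB : ‖B‖ ≤ R) (hB' : ‖ContinuousLinearMap.adjoint B‖ ≤ R)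
    {c c' : ℂ} {b b' : ℝ} {x y : H} (hx : ‖x‖ ≤ 1) (hy : ‖y‖ ≤ 1) (hc : ‖c‖ ≤ b) (hc' : ‖c'‖ ≤ b') :
    ‖c • B x + (Complex.I * c') • B (ContinuousLinearMap.adjoint B y)‖ ≤ b * R + b' * R ^ 2 := by
  have hR := (norm_nonneg _).trans hB
  have hb := (norm_nonneg _).trans hc
  have hb' := (norm_nonneg _).trans hc'
  refine (norm_add_le _ _).trans (add_le_add ?_ ?_)
  · rw [norm_smul]
    gcongr
    exact (norm_apply_le hB x).trans (by nlinarith)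
  · rw [norm_smul, norm_mul, Complex.norm_I, one_mul]
    gcongr
    have h1 := norm_apply_le hB' y
    have h2 := norm_apply_le hB (ContinuousLinearMap.adjoint B y)
    nlinarith

set_option maxHeartbeats 1000000 in
/-- A solution stays close to the linear solution with the same past state up to time `-1`. -/
theorem IsSolution.norm_sub_linear_neg_one_le (hf₁ : Nice f₁ M) (hf₂ : Nice f₂ M) (hG : ‖G‖ ≤ R)
    (hδ : |δ| ≤ 1) {u v : ℝ → H2 H} {α : H2 H} (hα : ‖α‖ = 1) (hu : IsSolution G f₁ f₂ δ u)
    (hv : IsLinSolution G v) (hu' : HasPastState G f₁ f₂ δ 0 u α) (hv' : HasLinPastState G v α) :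
    ‖u (-1) - v (-1)‖ ≤ |δ| * nearC R M := by
  have hM := hf₁.nonneg
  have hR : 0 ≤ R := (norm_nonneg G).trans hG
  have hG' : ‖ContinuousLinearMap.adjoint G‖ ≤ R :=
    (LinearIsometryEquiv.norm_map ContinuousLinearMap.adjoint G).trans_le hG
  have hC := pastC_nonneg hR hM
  have hK := gapC_nonneg hR hM
  have hα2 : ‖α‖ ≤ 2 := hα.trans_le one_le_two
  have hα₁ : ‖α.fst‖ ≤ 1 := hα ▸ norm_fst_le α
  have hα₂ : ‖α.snd‖ ≤ 1 := hα ▸ norm_snd_le α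
  obtain ⟨eu, hph⟩ := hu.pastExpansion hf₁ hf₂ hG hδ hα2 hu'.tendsto
  have ev := (IsSolution.pastExpansion hv (nice_zero hM) (nice_zero hM) hG
    (by rw [abs_zero]; exact zero_le_one) hα2 hv'.tendsto).1
  have hu1 : ∀ s, ‖u s‖ = 1 := fun s => by rw [hu.norm_eq s 0, ← eu.norm_eq, hα]
  have hv1 : ∀ s, ‖v s‖ = 1 := fun s => by rw [IsSolution.norm_eq hv s 0, ← ev.norm_eq, hα]
  have hv₁ : ∀ s, ‖(v s).fst‖ ≤ 1 := fun s => hv1 s ▸ norm_fst_le _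
  have hv₂ : ∀ s, ‖(v s).snd‖ ≤ 1 := fun s => hv1 s ▸ norm_snd_le _
  have hu2 : ‖u 0‖ ≤ 2 := (hu1 0).trans_le one_le_two
  set F₁ : ℝ → ℝ := fun s => nlF f₁ (u s) with hF₁
  set F₂ : ℝ → ℝ := fun s => nlF f₂ (u s) with hF₂
  obtain ⟨κ₁, hκ₁⟩ := hph f₁ hf₁
  obtain ⟨κ₂, hκ₂⟩ := hph f₂ hf₂
  -- With these normalisations the gauge factors convert the nonlinear profile of `α` into its
  -- linear profile up to `O(1/|s|)`, so the gauged solution and `v` approach each other.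
  set Φ₁ : ℝ → ℝ := fun s => (∫ t in (0 : ℝ)..s, F₁ t) - κ₁ with hΦ₁
  set Φ₂ : ℝ → ℝ := fun s => (∫ t in (0 : ℝ)..s, F₂ t) - κ₂ with hΦ₂
  have dΦ₁ : ∀ s, HasDerivAt Φ₁ (F₁ s) s := fun s => (hasDerivAt_integral_of_continuous
    (continuous_nlF hf₁.smooth.continuous hu.continuous) s).sub_const κ₁
  have dΦ₂ : ∀ s, HasDerivAt Φ₂ (F₂ s) s := fun s => (hasDerivAt_integral_of_continuous
    (continuous_nlF hf₂.smooth.continuous hu.continuous) s).sub_const κ₂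
  have bΦ₁ : ∀ s ≤ -1, |Φ₁ s - nlF f₁ α * s| ≤ pastC R M / |s| := fun s hs => by
    rw [hΦ₁]; convert hκ₁ s hs using 2; ring
  have bΦ₂ : ∀ s ≤ -1, |Φ₂ s - nlF f₂ α * s| ≤ pastC R M / |s| := fun s hs => by
    rw [hΦ₂]; convert hκ₂ s hs using 2; ring
  have hnα : ∀ f, Nice f M → |nlF f α| ≤ M := fun f hf => hf.bound _
    (sq_norm_mem_Icc ((norm_fst_le α).trans hα2)) _ (sq_norm_mem_Icc ((norm_snd_le α).trans hα2))
  have hgrow : ∀ {Φ : ℝ → ℝ} {m s : ℝ}, s ≤ -1 → |Φ s - m * s| ≤ pastC R M / |s| → |m| ≤ M →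
      |Φ s| ≤ (M + pastC R M) * |s| := fun {Φ m s} hs h hm => by
    have hs1 := one_le_abs_of_le_neg_one hs
    have h1 : pastC R M / |s| ≤ pastC R M * |s| := by
      rw [div_le_iff₀ (by linarith)]; nlinarith [one_le_mul_of_one_le_of_one_le hs1 hs1]
    calc |Φ s| = |(Φ s - m * s) + m * s| := by ring_nf
      _ ≤ pastC R M * |s| + M * |s| := by
        refine (abs_add_le _ _).trans (add_le_add (h.trans h1) ?_)
        rw [abs_mul]; gcongr
      _ = _ := by ring
  obtain ⟨Δ', dΔ, bΔ⟩ := hu.exists_deriv_nlF_sub hf₁ hf₂ hG hδ hu2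
  set κ : ℝ → ℝ := fun s => (F₁ s - F₂ s) / 2 with hκ
  have dκ : ∀ s, HasDerivAt κ (-(Δ' s) / 2) s := fun s =>
    ((dΔ s).fun_neg.div_const 2).congr_of_eventuallyEq
      (Eventually.of_forall fun s => by simp only [hκ, hF₁, hF₂]; ring)
  have bκ : ∀ s, |κ s| ≤ M := fun s => by
    have h1 := hu.abs_nlF_le hu2 hf₁ s
    have h2 := hu.abs_nlF_le hu2 hf₂ s
    simp only [hκ, hF₁, hF₂]
    rw [abs_le] at *
    constructor <;> linarith [h1.1, h1.2, h2.1, h2.2]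
  have bκ' : ∀ s, |-(Δ' s) / 2| ≤ M + 8 * M * R := fun s => by
    rw [abs_div, abs_neg, abs_two]; linarith [bΔ s]
  set e : ℝ → ℂ := fun s => Complex.exp (Complex.I * ((-δ * (Φ₁ s - Φ₂ s) : ℝ) : ℂ)) with he
  set e' : ℝ → ℂ := fun s => Complex.exp (Complex.I * ((-δ * (Φ₂ s - Φ₁ s) : ℝ) : ℂ)) with he'
  have de : ∀ s, HasDerivAt e (-(2 * Complex.I * δ * κ s * e s)) s := fun s =>
    (hasDerivAt_cexp_real (((dΦ₁ s).fun_sub (dΦ₂ s)).const_mul (-δ))).congr_deriv (by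
      change Complex.I * _ * e s = _
      simp only [hκ]; push_cast; ring)
  have de' : ∀ s, HasDerivAt e' (-(2 * Complex.I * δ * ((-κ s : ℝ) : ℂ) * e' s)) s := fun s =>
    (hasDerivAt_cexp_real (((dΦ₂ s).fun_sub (dΦ₁ s)).const_mul (-δ))).congr_deriv (by
      change Complex.I * _ * e' s = _
      simp only [hκ]; push_cast; ring)
  have ne : ∀ s, ‖e s‖ = 1 := fun s => norm_cexp_I_mul _
  have ne' : ∀ s, ‖e' s‖ = 1 := fun s => norm_cexp_I_mul _
  have hconj : ∀ s, e' s = starRingEnd ℂ (e s) := fun s => by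
    simp only [he, he']
    rw [← Complex.exp_conj]
    congr 1
    rw [map_mul, Complex.conj_I, Complex.conj_ofReal]; push_cast; ring
  have hee : ∀ s, e s * e' s = 1 := fun s => by
    simp only [he, he']
    rw [← Complex.exp_add, ← mul_add, ← Complex.ofReal_add]
    ring_nf
    simp
  have hgap : ∀ s ≤ -1, |Φ₁ s - Φ₂ s| ≤ gapC R M * |s| := fun s hs => by
    refine (abs_sub _ _).trans ((add_le_add (hgrow hs (bΦ₁ s hs) (hnα f₁ hf₁))
      (hgrow hs (bΦ₂ s hs) (hnα f₂ hf₂))).trans_eq ?_)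
    rw [gapC]; ring
  have be : ∀ s ≤ -1, ‖e s - 1‖ ≤ |δ| * (gapC R M * |s|) := fun s hs => by
    refine (norm_cexp_sub_one_le _).trans ?_
    rw [abs_mul, abs_neg]
    gcongr
    exact hgap s hs
  have be' : ∀ s ≤ -1, ‖e' s - 1‖ ≤ |δ| * (gapC R M * |s|) := fun s hs => by
    refine (norm_cexp_sub_one_le _).trans ?_
    rw [abs_mul, abs_neg, abs_sub_comm]
    gcongr
    exact hgap s hs
  set a₁ : ℝ → H := fun s => Complex.exp (Complex.I * ((-δ * Φ₁ s : ℝ) : ℂ)) • (u s).fst with ha₁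
  set a₂ : ℝ → H := fun s => Complex.exp (Complex.I * ((-δ * Φ₂ s : ℝ) : ℂ)) • (u s).snd with ha₂
  have hus := isSolution_iff_sys.mp hu
  have hvs := isSolution_iff_sys.mp hv
  -- The difference `a₁ - v₁` is forced by `i(e - 1) G v₂`, which may grow like `|δ||s|` but
  -- oscillates against the phase of the first component. Subtracting the corrector leaves a
  -- remainder `O(|δ|/s²)`.
  set z₁ : ℝ → H := fun s => a₁ s - (v s).fst - gaugeCorr 1 δ (κ s) s (e s) • G (v s).snd with hz₁
  set z₂ : ℝ → H := fun s => a₂ s - (v s).snd - gaugeCorr (-1) δ (-κ s) s (e' s) •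
    ContinuousLinearMap.adjoint G (v s).fst with hz₂
  have hs0 : ∀ s : ℝ, s ≤ -1 → s ≠ 0 := fun s hs => by linarith
  set r₁ : ℝ → H := fun s => gaugeRes δ (κ s) (-(Δ' s) / 2) s (e s) • G (v s).snd +
      (Complex.I * (e s * gaugeCorr (-1) δ (-κ s) s (e' s) - gaugeCorr 1 δ (κ s) s (e s))) •
        G (ContinuousLinearMap.adjoint G (v s).fst) with hr₁d
  set r₂ : ℝ → H := fun s => gaugeRes δ (-κ s) (-(-(Δ' s) / 2)) s (e' s) •
      ContinuousLinearMap.adjoint G (v s).fst +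
      (Complex.I * (e' s * gaugeCorr 1 δ (κ s) s (e s) - gaugeCorr (-1) δ (-κ s) s (e' s))) •
        ContinuousLinearMap.adjoint G (G (v s).snd) with hr₂d
  have da₁ := fun s => hus.hasDerivAt_gauged (Φ₂ := Φ₂) (dΦ₁ s)
  have da₂ := fun s => hus.swap.hasDerivAt_gauged (Φ₂ := Φ₁) (dΦ₂ s)
  have dz₁ : ∀ s ≤ -1, HasDerivAt z₁
      (Complex.I • (((1 * s : ℝ) : ℂ) • z₁ s + e s • G (z₂ s)) + r₁ s) s := fun s hs =>
    hasDerivAt_gauged_sub (a₁ := a₁) (a₂ := a₂) (e := e) (e' := e') (κ := κ) (mul_one (1 : ℝ))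
      (hs0 s hs) hvs (da₁ s) (de s) (dκ s)
  have dz₂ : ∀ s ≤ -1, HasDerivAt z₂ (Complex.I • (((-1 * s : ℝ) : ℂ) • z₂ s +
      e' s • ContinuousLinearMap.adjoint G (z₁ s)) + r₂ s) s := fun s hs => by
    have h1 := hasDerivAt_gauged_sub (a₁ := a₂) (a₂ := a₁) (e := e') (e' := e)
      (κ := fun s => -κ s) (by norm_num : (-1 : ℝ) * -1 = 1) (hs0 s hs) hvs.swap (da₂ s) (de' s)
      (dκ s).fun_neg
    simp only [neg_neg, ContinuousLinearMap.adjoint_adjoint] at h1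
    exact h1
  have hr₁ : ∀ s ≤ -1, ‖r₁ s‖ ≤ |δ| * compareC R M / s ^ 2 :=
      fun s hs => by
    have hs1 := one_le_abs_of_le_neg_one hs
    refine (norm_remainder_le hG hG' (hv₂ s) (hv₁ s)
      (norm_gaugeRes_le hδ hs1 (bκ s) (bκ' s) (ne s) (be s hs))
      (norm_gaugeCorr_cross_le hs1 (bκ s) (ne s) (hee s) (be s hs))).trans_eq ?_
    rw [compareC]; ring
  have hr₂ : ∀ s ≤ -1, ‖r₂ s‖ ≤ |δ| * compareC R M / s ^ 2 :=
      fun s hs => by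
    have hs1 := one_le_abs_of_le_neg_one hs
    have h1 := norm_gaugeCorr_cross_le (σ := -1) hs1 ((abs_neg _).trans_le (bκ s)) (ne' s)
      ((mul_comm _ _).trans (hee s)) (be' s hs)
    rw [neg_neg, neg_neg] at h1
    have h2 := norm_remainder_le hG' (by rwa [ContinuousLinearMap.adjoint_adjoint]) (hv₁ s) (hv₂ s)
      (norm_gaugeRes_le hδ hs1 ((abs_neg _).trans_le (bκ s)) ((abs_neg _).trans_le (bκ' s))
        (ne' s) (be' s hs)) h1
    rw [ContinuousLinearMap.adjoint_adjoint] at h2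
    refine h2.trans_eq ?_
    rw [compareC]; ring
  have hc₁ : ∀ s ≤ -1, ∀ b, ‖e s - 1‖ ≤ b →
      ‖gaugeCorr 1 δ (κ s) s (e s) • G (v s).snd‖ ≤ (b + |δ| * M) * R / |s| := fun s hs b hb => by
    have hb0 := (norm_nonneg _).trans hb
    have h1 := norm_gaugeCorr_le (σ := 1) (δ := δ) abs_one (one_le_abs_of_le_neg_one hs) (bκ s)
      (ne s) hb
    have h2 := (norm_apply_le hG (v s).snd).trans (mul_le_of_le_one_right hR (hv₂ s))
    rw [norm_smul]
    refine (mul_le_mul h1 h2 (norm_nonneg _) (by positivity)).trans_eq ?_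
    ring
  have hc₂ : ∀ s ≤ -1, ∀ b, ‖e' s - 1‖ ≤ b → ‖gaugeCorr (-1) δ (-κ s) s (e' s) •
      ContinuousLinearMap.adjoint G (v s).fst‖ ≤ (b + |δ| * M) * R / |s| := fun s hs b hb => by
    have hb0 := (norm_nonneg _).trans hb
    have h1 := norm_gaugeCorr_le (σ := -1) (δ := δ) (by norm_num) (one_le_abs_of_le_neg_one hs)
      ((abs_neg _).trans_le (bκ s)) (ne' s) hb
    have h2 := (norm_adjoint_apply_le hG (v s).fst).trans (mul_le_of_le_one_right hR (hv₁ s))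
    rw [norm_smul]
    refine (mul_le_mul h1 h2 (norm_nonneg _) (by positivity)).trans_eq ?_
    ring
  have hd₁ : ∀ s ≤ -1, ‖a₁ s - (v s).fst‖ ≤ 3 * pastC R M / |s| := fun s hs => by
    have h1 := norm_gauged_sub_le (isSelfAdjoint_GGs G) (Real.log s / 2) (-δ * Φ₁ s)
      (s ^ 2 / 2 + δ * (nlF f₁ α * s) + 0) (s ^ 2 / 2 + 0 * (nlF 0 α * s) + 0) α.fst (u s).fst
      (v s).fst
    rw [← profile_fst G f₁ f₂ δ 0 α s, ← profile_fst G 0 0 0 0 α s, ← WithLp.sub_fst,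
      ← WithLp.sub_fst] at h1
    have h2 : |-δ * Φ₁ s + (s ^ 2 / 2 + δ * (nlF f₁ α * s) + 0) -
        (s ^ 2 / 2 + 0 * (nlF 0 α * s) + 0)| * ‖α.fst‖ ≤ 1 * (pastC R M / |s|) * 1 := by
      have : -δ * Φ₁ s + (s ^ 2 / 2 + δ * (nlF f₁ α * s) + 0) -
        (s ^ 2 / 2 + 0 * (nlF 0 α * s) + 0) = (-δ) * (Φ₁ s - nlF f₁ α * s) := by ring
      rw [this, abs_mul, abs_neg]
      gcongr
      exact bΦ₁ s hs
    have h3 := (norm_fst_le _).trans (eu.sub_profile s hs)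
    have h4 := (norm_fst_le _).trans (ev.sub_profile s hs)
    refine h1.trans ((add_le_add (add_le_add h3 h2) h4).trans_eq ?_)
    ring
  have hd₂ : ∀ s ≤ -1, ‖a₂ s - (v s).snd‖ ≤ 3 * pastC R M / |s| := fun s hs => by
    have h1 := norm_gauged_sub_le (isSelfAdjoint_GsG G) (-(Real.log s / 2)) (-δ * Φ₂ s)
      (-(s ^ 2 / 2) + δ * (nlF f₂ α * s) - 0) (-(s ^ 2 / 2) + 0 * (nlF 0 α * s) - 0) α.snd
      (u s).snd (v s).snd
    rw [← profile_snd G f₁ f₂ δ 0 α s, ← profile_snd G 0 0 0 0 α s, ← WithLp.sub_snd,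
      ← WithLp.sub_snd] at h1
    have h2 : |-δ * Φ₂ s + (-(s ^ 2 / 2) + δ * (nlF f₂ α * s) - 0) -
        (-(s ^ 2 / 2) + 0 * (nlF 0 α * s) - 0)| * ‖α.snd‖ ≤ 1 * (pastC R M / |s|) * 1 := by
      have : -δ * Φ₂ s + (-(s ^ 2 / 2) + δ * (nlF f₂ α * s) - 0) -
        (-(s ^ 2 / 2) + 0 * (nlF 0 α * s) - 0) = (-δ) * (Φ₂ s - nlF f₂ α * s) := by ring
      rw [this, abs_mul, abs_neg]
      gcongr
      exact bΦ₂ s hs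
    have h3 := (norm_snd_le _).trans (eu.sub_profile s hs)
    have h4 := (norm_snd_le _).trans (ev.sub_profile s hs)
    refine h1.trans ((add_le_add (add_le_add h3 h2) h4).trans_eq ?_)
    ring
  have hlim : ∀ {a : ℝ → H} {b c : ℝ}, (∀ s ≤ -1, ‖a s‖ ≤ b / |s| + c / |s|) →
      Tendsto (fun s => ‖a s‖ ^ 2) atBot (𝓝 0) := fun {a b c} h => by
    have h1 : Tendsto (fun s => (b / |s| + c / |s|) ^ 2) atBot (𝓝 ((0 + 0) ^ 2)) :=
      ((tendsto_const_div_abs_atBot b).add (tendsto_const_div_abs_atBot c)).pow 2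
    rw [add_zero, zero_pow two_ne_zero] at h1
    refine squeeze_zero' (Eventually.of_forall fun _ => sq_nonneg _)
      (eventually_atBot_of_le_neg_one fun s hs => ?_) h1
    gcongr
    exact h s hs
  have h21 : ∀ {x : ℂ}, ‖x‖ = 1 → ‖x - 1‖ ≤ 2 := fun {x} hx =>
    (norm_sub_le _ _).trans (by rw [hx, norm_one]; norm_num)
  -- Only decay is needed here, so `‖e - 1‖ ≤ 2` suffices; smallness in `δ` then comes from
  -- integrating the remainders from `-∞`.
  have lz₁ : Tendsto (fun s => ‖z₁ s‖ ^ 2) atBot (𝓝 0) := hlim fun s hs =>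
    (norm_sub_le _ _).trans (add_le_add (hd₁ s hs) (hc₁ s hs 2 (h21 (ne s))))
  have lz₂ : Tendsto (fun s => ‖z₂ s‖ ^ 2) atBot (𝓝 0) := hlim fun s hs =>
    (norm_sub_le _ _).trans (add_le_add (hd₂ s hs) (hc₂ s hs 2 (h21 (ne' s))))
  have lE := lz₁.add lz₂
  rw [add_zero] at lE
  have hE := sqrt_energy_le_of_tendsto_zero (e := fun s => ‖z₁ s‖ ^ 2 + ‖z₂ s‖ ^ 2)
    (C := 2 * (|δ| * compareC R M)) (fun s _ => by positivity)
    (fun s hs => (hasDerivAt_norm_sq (dz₁ s hs)).fun_add (hasDerivAt_norm_sq (dz₂ s hs)))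
    (fun s hs => by
      have h1 := abs_energy_deriv_le G (z₁ s) (z₂ s) (r₁ s) (r₂ s) (1 * s) (e s) (hr₁ s hs) (hr₂ s hs)
      rw [← hconj, ← neg_mul] at h1
      rw [mul_div_assoc]
      exact h1)
    (by have := compareC_nonneg hR hM; positivity) lE (s := -1) le_rfl
  rw [abs_neg, abs_one, div_one] at hE
  have n₁ : ‖z₁ (-1)‖ ≤ 2 * (|δ| * compareC R M) :=
    (Real.le_sqrt_of_sq_le (by linarith [sq_nonneg ‖z₂ (-1)‖])).trans hE
  have n₂ : ‖z₂ (-1)‖ ≤ 2 * (|δ| * compareC R M) :=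
    (Real.le_sqrt_of_sq_le (by linarith [sq_nonneg ‖z₁ (-1)‖])).trans hE
  -- At `s = -1` the phases are bounded, so both removing the corrector and undoing the gauge cost
  -- only `O(|δ|)`.
  have q₁ := hc₁ (-1) le_rfl _ (be (-1) le_rfl)
  have q₂ := hc₂ (-1) le_rfl _ (be' (-1) le_rfl)
  have hga : ∀ {Φ m : ℝ} {y : H}, |Φ| ≤ (M + pastC R M) * |-1| → ‖y‖ ≤ 1 →
      ‖y - Complex.exp (Complex.I * ((-δ * Φ : ℝ) : ℂ)) • y‖ ≤ |δ| * (M + pastC R M) :=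
      fun {Φ m y} hΦ hy => by
    rw [abs_neg, abs_one, mul_one] at hΦ
    have h1 := norm_cexp_sub_one_le (-δ * Φ)
    rw [abs_mul, abs_neg] at h1
    have h2 : y - Complex.exp (Complex.I * ((-δ * Φ : ℝ) : ℂ)) • y =
        -((Complex.exp (Complex.I * ((-δ * Φ : ℝ) : ℂ)) - 1) • y) := by module
    rw [h2, norm_neg, norm_smul]
    calc _ ≤ |δ| * (M + pastC R M) * 1 := by
          gcongr
          exact h1.trans (by gcongr)
      _ = _ := mul_one _
  have g₁ := hga (m := 0) (hgrow (le_refl (-1)) (bΦ₁ _ le_rfl) (hnα f₁ hf₁))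
    ((norm_fst_le (u (-1))).trans_eq (hu1 _))
  have g₂ := hga (m := 0) (hgrow (le_refl (-1)) (bΦ₂ _ le_rfl) (hnα f₂ hf₂))
    ((norm_snd_le (u (-1))).trans_eq (hu1 _))
  rw [abs_neg, abs_one, div_one, mul_one] at q₁ q₂
  have habel : ∀ a b c d : H, a - b = (a - d) + ((d - b - c) + c) := fun a b c d => by abel
  have f₁ : ‖(u (-1) - v (-1)).fst‖ ≤ |δ| * (M + pastC R M) + (2 * (|δ| * compareC R M) +
      (|δ| * gapC R M + |δ| * M) * R) := by
    have : (u (-1) - v (-1)).fst = ((u (-1)).fst - a₁ (-1)) + (z₁ (-1) +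
        gaugeCorr 1 δ (κ (-1)) (-1) (e (-1)) • G (v (-1)).snd) := by
      rw [WithLp.sub_fst]; exact habel _ _ _ _
    rw [this]
    exact (norm_add_le _ _).trans (add_le_add g₁ ((norm_add_le _ _).trans (add_le_add n₁ q₁)))
  have f₂ : ‖(u (-1) - v (-1)).snd‖ ≤ |δ| * (M + pastC R M) + (2 * (|δ| * compareC R M) +
      (|δ| * gapC R M + |δ| * M) * R) := by
    have : (u (-1) - v (-1)).snd = ((u (-1)).snd - a₂ (-1)) + (z₂ (-1) +
        gaugeCorr (-1) δ (-κ (-1)) (-1) (e' (-1)) •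
          ContinuousLinearMap.adjoint G (v (-1)).fst) := by
      rw [WithLp.sub_snd]; exact habel _ _ _ _
    rw [this]
    exact (norm_add_le _ _).trans (add_le_add g₂ ((norm_add_le _ _).trans (add_le_add n₂ q₂)))
  refine (norm_le_add _).trans ((add_le_add f₁ f₂).trans_eq ?_)
  rw [nearC]; ring

end LandauZener
end

/-! ### The linear equation, time reversal and outgoing states. -/

noncomputable section
namespace LandauZener

variable {H : Type u} [NormedAddCommGroup H] [InnerProductSpace ℂ H] [CompleteSpace H]
variable {G : H →L[ℂ] H} {f₁ f₂ : ℝ × ℝ → ℝ} {δ M R : ℝ}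

/-- The nonlinearities drop out at zero coupling and can be replaced by any others. This allows
gauge transformations that start or end at `δ = 0`. -/
theorem isLinSolution_iff {u : ℝ → H2 H} : IsLinSolution G u ↔ IsSolution G f₁ f₂ 0 u := by
  simp only [IsLinSolution, IsSolution, Complex.ofReal_zero, zero_smul]

theorem profile_zero_coupling (ϕ : ℝ) (α : H2 H) (s : ℝ) :
    profile G 0 0 0 ϕ α s = profile G f₁ f₂ 0 ϕ α s := by
  simp only [profile, Complex.ofReal_zero, zero_mul]

theorem hasLinPastState_iff {u : ℝ → H2 H} {α : H2 H} :
    HasLinPastState G u α ↔ HasPastState G f₁ f₂ 0 0 u α := by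
  simp only [HasLinPastState, HasPastState, profile_zero_coupling (f₁ := f₁) (f₂ := f₂)]

theorem hasLinFutureState_iff {u : ℝ → H2 H} {α : H2 H} :
    HasLinFutureState G u α ↔ HasFutureState G f₁ f₂ 0 u α := by
  simp only [HasLinFutureState, HasFutureState, profile_zero_coupling (f₁ := f₁) (f₂ := f₂)]

theorem V_smul (G : H →L[ℂ] H) (s : ℝ) (c : ℂ) (u : H2 H) : V G s (c • u) = c • V G s u := by
  refine H2.ext ?_ ?_
  · simp only [V, vec_fst, WithLp.smul_fst, WithLp.smul_snd, map_smul]; module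
  · simp only [V, vec_snd, WithLp.smul_fst, WithLp.smul_snd, map_smul]; module

theorem isLinSolution_iff_hasDerivAt {u : ℝ → H2 H} :
    IsLinSolution G u ↔ ∀ s, HasDerivAt u (Complex.I • V G s (u s)) s := by
  simp only [IsLinSolution, IsSolution, Complex.ofReal_zero, zero_smul, add_zero]

theorem IsLinSolution.sub {u v : ℝ → H2 H} (hu : IsLinSolution G u) (hv : IsLinSolution G v) :
    IsLinSolution G (fun s => u s - v s) := by
  rw [isLinSolution_iff_hasDerivAt] at *
  exact fun s => ((hu s).fun_sub (hv s)).congr_deriv (by rw [V_sub, smul_sub])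

theorem IsLinSolution.smul {u : ℝ → H2 H} (hu : IsLinSolution G u) (c : ℂ) :
    IsLinSolution G (fun s => c • u s) := by
  rw [isLinSolution_iff_hasDerivAt] at *
  exact fun s => ((hu s).fun_const_smul c).congr_deriv (by rw [V_smul, smul_comm])

theorem profile_sub (s : ℝ) (α β : H2 H) :
    profile G 0 0 0 0 (α - β) s = profile G 0 0 0 0 α s - profile G 0 0 0 0 β s := by
  refine H2.ext ?_ ?_
  · simp only [WithLp.sub_fst, profile_fst, zero_mul, map_sub, smul_sub]
  · simp only [WithLp.sub_snd, profile_snd, zero_mul, map_sub, smul_sub]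

theorem nlF_smul (f : ℝ × ℝ → ℝ) {c : ℂ} (hc : ‖c‖ = 1) (α : H2 H) : nlF f (c • α) = nlF f α := by
  simp only [nlF, WithLp.smul_fst, WithLp.smul_snd, norm_smul, hc, one_mul]

theorem profile_smul (δ ϕ s : ℝ) {c : ℂ} (hc : ‖c‖ = 1) (α : H2 H) :
    profile G f₁ f₂ δ ϕ (c • α) s = c • profile G f₁ f₂ δ ϕ α s := by
  refine H2.ext ?_ ?_
  · simp only [WithLp.smul_fst, profile_fst, nlF_smul _ hc, map_smul]
    rw [smul_comm]
  · simp only [WithLp.smul_snd, profile_snd, nlF_smul _ hc, map_smul]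
    rw [smul_comm]

theorem HasPastState.smul {ϕ : ℝ} {u : ℝ → H2 H} {α : H2 H} (h : HasPastState G f₁ f₂ δ ϕ u α)
    {c : ℂ} (hc : ‖c‖ = 1) : HasPastState G f₁ f₂ δ ϕ (fun s => c • u s) (c • α) := by
  rw [HasPastState] at *
  simp only [profile_smul _ _ _ hc, ← smul_sub]
  exact h.const_smul_left c

theorem HasFutureState.smul {u : ℝ → H2 H} {α : H2 H} (h : HasFutureState G f₁ f₂ δ u α)
    {c : ℂ} (hc : ‖c‖ = 1) : HasFutureState G f₁ f₂ δ (fun s => c • u s) (c • α) := by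
  rw [HasFutureState] at *
  simp only [profile_smul _ _ _ hc, ← smul_sub]
  exact h.const_smul_left c

/-- The difference is a linear solution with state `α - β`, and its norm is conserved. This yields
both uniqueness and the isometry property, without smallness conditions. -/
theorem IsLinSolution.norm_sub_eq {l : Filter ℝ} [l.NeBot] {u v : ℝ → H2 H} {α β : H2 H}
    (hu : IsLinSolution G u) (hv : IsLinSolution G v)
    (hu' : Tendsto (fun s => u s - profile G 0 0 0 0 α s) l (𝓝 0))
    (hv' : Tendsto (fun s => v s - profile G 0 0 0 0 β s) l (𝓝 0)) (s : ℝ) :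
    ‖u s - v s‖ = ‖α - β‖ := by
  have hc : ∀ t, ‖u t - v t‖ = ‖u s - v s‖ := fun t => IsSolution.norm_eq (hu.sub hv) t s
  have h1 := (hu'.sub hv').norm
  rw [sub_zero, norm_zero] at h1
  have h2 : Tendsto (fun t => ‖u t - v t‖) l (𝓝 ‖α - β‖) :=
    tendsto_norm_of_norm_sub_le (z := fun t => profile G 0 0 0 0 (α - β) t)
      (Eventually.of_forall fun t => le_rfl) (fun t => norm_profile 0 0 _ t)
      (h1.congr fun t => by rw [profile_sub]; congr 1; abel)
  simp only [hc] at h2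
  exact tendsto_nhds_unique tendsto_const_nhds h2

theorem HasFutureState.tendsto {u : ℝ → H2 H} {ω : H2 H} (h : HasFutureState G f₁ f₂ δ u ω) :
    Tendsto (fun s => u s - profile G f₁ f₂ δ 0 ω s) atTop (𝓝 0) := by
  refine h.trans_tendsto ?_
  have := (tendsto_const_div_abs_atBot 1).comp tendsto_neg_atTop_atBot
  refine this.congr fun s => ?_
  simp

/-- The reflection of `H × H` in its second component. -/
def refl (α : H2 H) : H2 H := vec α.fst (-α.snd)

theorem refl_refl (α : H2 H) : refl (refl α) = α :=
  H2.ext rfl (neg_neg _)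

theorem refl_sub (α β : H2 H) : refl (α - β) = refl α - refl β :=
  H2.ext rfl (by simp only [refl, vec_snd, WithLp.sub_snd]; abel)

theorem nlF_refl (f : ℝ × ℝ → ℝ) (α : H2 H) : nlF f (refl α) = nlF f α := by
  simp only [nlF, refl, vec_fst, vec_snd, norm_neg]

theorem norm_refl (α : H2 H) : ‖refl α‖ = ‖α‖ := by
  rw [← pow_left_inj₀ (norm_nonneg _) (norm_nonneg _) two_ne_zero, norm_sq_eq, norm_sq_eq]
  simp only [refl, vec_fst, vec_snd, norm_neg]

theorem profile_refl (δ : ℝ) (α : H2 H) (s : ℝ) :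
    profile G f₁ f₂ (-δ) 0 (refl α) s = refl (profile G f₁ f₂ δ 0 α (-s)) := by
  refine H2.ext ?_ ?_
  · change (profile G f₁ f₂ (-δ) 0 (refl α) s).fst = (profile G f₁ f₂ δ 0 α (-s)).fst
    rw [profile_fst, profile_fst, nlF_refl, Real.log_neg_eq_log]
    congr 4
    ring
  · change (profile G f₁ f₂ (-δ) 0 (refl α) s).snd = -(profile G f₁ f₂ δ 0 α (-s)).snd
    rw [profile_snd, profile_snd, nlF_refl, Real.log_neg_eq_log, ← smul_neg,
      ← map_neg]
    congr 4
    ring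

/-- Time reversal of solutions. -/
def reversed (u : ℝ → H2 H) (s : ℝ) : H2 H := refl (u (-s))

/-- Replacing `s` by `-s` preserves the diagonal `± s` but reverses the signs of the coupling `G`
and of `δ`; the reflection restores the sign of `G`. The past theory thus applies at `+∞` with `-δ`.
-/
theorem IsSolution.reversed {u : ℝ → H2 H} (hu : IsSolution G f₁ f₂ δ u) :
    IsSolution G f₁ f₂ (-δ) (reversed u) := by
  rw [isSolution_iff_sys] at *
  have hn : ∀ s : ℝ, HasDerivAt (fun s : ℝ => -s) (-1) s := fun s => (hasDerivAt_id s).fun_neg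
  constructor
  · intro s
    refine ((hu.fst (-s)).scomp s (hn s)).congr_deriv ?_
    simp only [LandauZener.reversed, refl, vec_fst, vec_snd, nlF, norm_neg, map_neg]
    rw [← Complex.coe_smul]
    push_cast
    module
  · intro s
    refine ((hu.snd (-s)).scomp s (hn s)).fun_neg.congr_deriv ?_
    simp only [LandauZener.reversed, refl, vec_fst, vec_snd, nlF, norm_neg]
    rw [← Complex.coe_smul]
    push_cast
    module

theorem IsLinSolution.reversed {u : ℝ → H2 H} (hu : IsLinSolution G u) :
    IsLinSolution G (reversed u) := by
  have := IsSolution.reversed hu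
  rwa [neg_zero] at this

theorem hasFutureState_iff_reversed {u : ℝ → H2 H} {ω : H2 H} :
    HasFutureState G f₁ f₂ δ u ω ↔ HasPastState G f₁ f₂ (-δ) 0 (reversed u) (refl ω) := by
  have e : ∀ s, ‖reversed u s - profile G f₁ f₂ (-δ) 0 (refl ω) s‖ =
      ‖u (-s) - profile G f₁ f₂ δ 0 ω (-s)‖ := fun s => by
    rw [profile_refl, reversed, ← refl_sub, norm_refl]
  rw [HasFutureState, HasPastState, ← isBigO_norm_left, ← isBigO_norm_left (f' := fun s =>
    reversed u s - profile G f₁ f₂ (-δ) 0 (refl ω) s)]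
  simp only [e]
  constructor
  · intro h
    exact (h.comp_tendsto tendsto_neg_atBot_atTop).congr_right fun s => by simp
  · intro h
    exact (h.comp_tendsto tendsto_neg_atTop_atBot).congr (fun s => by simp) fun s => by simp

theorem IsSolution.exists_futureState (hf₁ : Nice f₁ M) (hf₂ : Nice f₂ M)
    (hδ : |δ| ≤ 1) {u : ℝ → H2 H} (hu : IsSolution G f₁ f₂ δ u) (hu2 : ‖u 0‖ ≤ 2) :
    ∃ ω, HasFutureState G f₁ f₂ δ u ω ∧ ‖ω‖ = ‖u 0‖ := by
  have h0 : ‖LandauZener.reversed u 0‖ = ‖u 0‖ := by rw [LandauZener.reversed, norm_refl, neg_zero]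
  obtain ⟨β, hβ, -⟩ := hu.reversed.exists_pastExpansion hf₁ hf₂ le_rfl ((abs_neg δ).trans_le hδ)
    (h0.trans_le hu2)
  refine ⟨refl β, ?_, ?_⟩
  · rw [hasFutureState_iff_reversed, refl_refl]
    exact hasPastState_of_le hβ.sub_profile
  · rw [norm_refl, hβ.norm_eq, h0]

/-- A solution stays close to the linear solution with the same past state up to time `1`. -/
theorem IsSolution.norm_sub_linear_one_le (hf₁ : Nice f₁ M) (hf₂ : Nice f₂ M) (hG : ‖G‖ ≤ R)
    (hδ : |δ| ≤ 1) {u v : ℝ → H2 H} {α : H2 H} (hα : ‖α‖ = 1) (hu : IsSolution G f₁ f₂ δ u)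
    (hv : IsLinSolution G v) (hu' : HasPastState G f₁ f₂ δ 0 u α) (hv' : HasLinPastState G v α) :
    ‖u 1 - v 1‖ ≤ |δ| * (nearC R M + 4 * M) := by
  have hM := hf₁.nonneg
  have h1 := hu.norm_sub_linear_neg_one_le hf₁ hf₂ hG hδ hα hv hu' hv'
  have hu1 : ∀ s, ‖u s‖ = 1 := fun s => by
    rw [hu.norm_eq s 0, ← hα, (hu.pastExpansion hf₁ hf₂ hG hδ (hα.trans_le one_le_two)
      hu'.tendsto).1.norm_eq]
  have hu2 : ‖u 0‖ ≤ 2 := (hu1 0).trans_le one_le_two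
  have hbd : ∀ s, ‖(δ : ℂ) • vec ((nlF f₁ (u s) : ℂ) • (u s).fst)
      ((nlF f₂ (u s) : ℂ) • (u s).snd)‖ ≤ |δ| * (2 * M) := fun s => by
    rw [norm_smul, Complex.norm_real, Real.norm_eq_abs]
    gcongr
    refine (norm_le_add _).trans ?_
    rw [vec_fst, vec_snd, norm_smul, norm_smul, Complex.norm_real, Complex.norm_real,
      Real.norm_eq_abs, Real.norm_eq_abs]
    have a₁ := mul_le_mul (hu.abs_nlF_le hu2 hf₁ s) (norm_fst_le (u s)) (norm_nonneg _) hM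
    have a₂ := mul_le_mul (hu.abs_nlF_le hu2 hf₂ s) (norm_snd_le (u s)) (norm_nonneg _) hM
    rw [hu1] at a₁ a₂
    linarith
  -- The common symmetric part drops out; a forcing of size at most `2M|δ|` over an interval of
  -- length `2` gives the term `4M`.
  have key := sqrt_energy_le_add (e := fun s => ‖u s - v s‖ ^ 2) (a := -1) (b := 1)
    (B := |δ| * (2 * M)) (by norm_num) (fun s => sq_nonneg _)
    (fun s => hasDerivAt_norm_sq ((hu s).fun_sub (isLinSolution_iff_hasDerivAt.mp hv s)))
    (fun s _ => by
      rw [Real.sqrt_sq (norm_nonneg _), abs_mul, abs_two, mul_assoc, smul_add, add_sub_right_comm,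
        ← smul_sub, ← V_sub, inner_add_right, Complex.add_re, re_inner_I_smul_V, zero_add]
      refine mul_le_mul_of_nonneg_left ?_ zero_le_two
      refine (Complex.abs_re_le_norm _).trans ((norm_inner_le_norm _ _).trans ?_)
      gcongr
      rw [norm_smul, Complex.norm_I, one_mul]
      exact hbd s) (by positivity)
  rw [Real.sqrt_sq (norm_nonneg _), Real.sqrt_sq (norm_nonneg _)] at key
  linarith

/-- The nonlinear and linear outgoing states of a given incoming state are close. -/
theorem norm_futureState_sub_le [FiniteDimensional ℂ H] (hf₁ : Nice f₁ M) (hf₂ : Nice f₂ M)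
    (hG : ‖G‖ ≤ R) (hδ : |δ| ≤ 1) {u v : ℝ → H2 H} {α ω ω' : H2 H} (hα : ‖α‖ = 1)
    (hu : IsSolution G f₁ f₂ δ u) (hv : IsLinSolution G v) (hu' : HasPastState G f₁ f₂ δ 0 u α)
    (hv' : HasLinPastState G v α) (hω : HasFutureState G f₁ f₂ δ u ω)
    (hω' : HasLinFutureState G v ω') : ‖ω - ω'‖ ≤ |δ| * (2 * nearC R M + 4 * M) := by
  have h1 := hu.norm_sub_linear_one_le hf₁ hf₂ hG hδ hα hv hu' hv'
  have hu1 : ‖u 0‖ = 1 := by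
    rw [← hα, (hu.pastExpansion hf₁ hf₂ hG hδ (hα.trans_le one_le_two) hu'.tendsto).1.norm_eq]
  obtain ⟨ω₁, hω₁, hω₁n⟩ := hu.exists_futureState hf₁ hf₂ hδ (hu1.trans_le one_le_two)
  obtain rfl := state_unique hω.tendsto hω₁.tendsto
  have hω1 : ‖refl ω‖ = 1 := by rw [norm_refl, hω₁n, hu1]
  -- At time `-1` the reversed `u` is close to `w`, by the comparison from `-∞`, and to the reversed
  -- `v`, by the comparison up to time `1`. Since `w` and the reversed `v` are linear, their
  -- distance there equals that of the outgoing states.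
  obtain ⟨w, hw, hw'⟩ := exists_solution_of_past_state (δ := 0) (nice_zero hf₁.nonneg)
    (nice_zero hf₁.nonneg) hG (by rw [abs_zero]; exact zero_le_one) hω1
  have h2 := hu.reversed.norm_sub_linear_neg_one_le hf₁ hf₂ hG ((abs_neg δ).trans_le hδ) hω1 hw
    (hasFutureState_iff_reversed.mp hω) hw'
  rw [abs_neg] at h2
  have hv'' : HasLinPastState G (reversed v) (refl ω') := by
    have := hasFutureState_iff_reversed.mp hω'
    rwa [neg_zero] at this
  have h3 := IsLinSolution.norm_sub_eq hw hv.reversed hw'.tendsto hv''.tendsto (-1)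
  rw [← refl_sub, norm_refl] at h3
  have h4 : ‖reversed u (-1) - reversed v (-1)‖ = ‖u 1 - v 1‖ := by
    rw [LandauZener.reversed, LandauZener.reversed, ← refl_sub, norm_refl, neg_neg]
  rw [← h3]
  have h5 := norm_sub_le_norm_sub_add_norm_sub (w (-1)) (reversed u (-1)) (reversed v (-1))
  rw [h4, norm_sub_rev (w (-1)) (reversed u (-1))] at h5
  linarith

end LandauZener
end

/-! ### Phases, weak coupling and gauge transformations. -/

noncomputable section
namespace LandauZener

variable {H : Type u} [NormedAddCommGroup H] [InnerProductSpace ℂ H] [CompleteSpace H]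
variable {G : H →L[ℂ] H} {f₁ f₂ : ℝ × ℝ → ℝ} {δ M R : ℝ}

/-- The state `(e^{iϕ} α₁, e^{-iϕ} α₂)`. -/
def twist (ϕ : ℝ) (α : H2 H) : H2 H :=
  vec (Complex.exp (Complex.I * ϕ) • α.fst) (Complex.exp (Complex.I * ((-ϕ : ℝ) : ℂ)) • α.snd)

theorem nlF_twist (f : ℝ × ℝ → ℝ) (ϕ : ℝ) (α : H2 H) : nlF f (twist ϕ α) = nlF f α := by
  simp only [nlF, twist, vec_fst, vec_snd, norm_smul, norm_cexp_I_mul, one_mul]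

theorem norm_twist (ϕ : ℝ) (α : H2 H) : ‖twist ϕ α‖ = ‖α‖ := by
  rw [← pow_left_inj₀ (norm_nonneg _) (norm_nonneg _) two_ne_zero, norm_sq_eq, norm_sq_eq]
  simp only [twist, vec_fst, vec_snd, norm_smul, norm_cexp_I_mul, one_mul]

theorem norm_twist_sub_le (ϕ : ℝ) (α : H2 H) : ‖twist ϕ α - α‖ ≤ 2 * |ϕ| * ‖α‖ := by
  have h₁ : ‖(twist ϕ α - α).fst‖ ≤ |ϕ| * ‖α‖ := by
    have : (twist ϕ α - α).fst = (Complex.exp (Complex.I * ϕ) - 1) • α.fst := by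
      rw [WithLp.sub_fst, twist, vec_fst]; module
    rw [this, norm_smul]
    exact mul_le_mul (norm_cexp_sub_one_le ϕ) (norm_fst_le α) (norm_nonneg _) (abs_nonneg _)
  have h₂ : ‖(twist ϕ α - α).snd‖ ≤ |ϕ| * ‖α‖ := by
    have : (twist ϕ α - α).snd = (Complex.exp (Complex.I * ((-ϕ : ℝ) : ℂ)) - 1) • α.snd := by
      rw [WithLp.sub_snd, twist, vec_snd]; module
    rw [this, norm_smul]
    exact mul_le_mul ((norm_cexp_sub_one_le (-ϕ)).trans_eq (abs_neg ϕ)) (norm_snd_le α)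
      (norm_nonneg _) (abs_nonneg _)
  linarith [norm_le_add (twist ϕ α - α)]

/-- A twist does not change component norms, hence not the frequencies. The phase `ϕ` can thus be
absorbed in the state, every question reduces to `ϕ = 0`, and every real `ϕ` is admissible for weak
coupling. -/
theorem profile_twist (δ ϕ : ℝ) (α : H2 H) (s : ℝ) :
    profile G f₁ f₂ δ 0 (twist ϕ α) s = profile G f₁ f₂ δ ϕ α s := by
  refine H2.ext ?_ ?_
  · rw [profile_fst, profile_fst, nlF_twist, twist, vec_fst, map_smul, smul_smul,
      ← Complex.exp_add]
    congr 2; push_cast; ring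
  · rw [profile_snd, profile_snd, nlF_twist, twist, vec_snd, map_smul, smul_smul,
      ← Complex.exp_add]
    congr 2; push_cast; ring

theorem hasPastState_twist {ϕ : ℝ} {u : ℝ → H2 H} {α : H2 H} :
    HasPastState G f₁ f₂ δ 0 u (twist ϕ α) ↔ HasPastState G f₁ f₂ δ ϕ u α := by
  simp only [HasPastState, profile_twist]

theorem scatteringDefined_twist {ϕ : ℝ} {α : H2 H} :
    ScatteringDefined G f₁ f₂ δ 0 (twist ϕ α) ↔ ScatteringDefined G f₁ f₂ δ ϕ α := by
  simp only [ScatteringDefined, IsScatteringPair, hasPastState_twist]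

theorem scatteringOp_twist {ϕ : ℝ} {α : H2 H} :
    scatteringOp G f₁ f₂ δ 0 (twist ϕ α) = scatteringOp G f₁ f₂ δ ϕ α := by
  simp only [scatteringOp, IsScatteringPair, hasPastState_twist]

/-- Uniqueness of the solution together with uniqueness of states leaves one possible outgoing
state, so the choice in `scatteringOp` is forced. -/
theorem scattering_of_unique {ϕ : ℝ} {u : ℝ → H2 H} {α ω : H2 H} (hu : IsSolution G f₁ f₂ δ u)
    (hα : HasPastState G f₁ f₂ δ ϕ u α) (hω : HasFutureState G f₁ f₂ δ u ω)
    (h : ∀ v, IsSolution G f₁ f₂ δ v → HasPastState G f₁ f₂ δ ϕ v α → v = u) :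
    ScatteringDefined G f₁ f₂ δ ϕ α ∧ scatteringOp G f₁ f₂ δ ϕ α = ω := by
  have key : ∀ ω', IsScatteringPair G f₁ f₂ δ ϕ α ω' → ω' = ω := by
    rintro ω' ⟨v, hv, hv', hv''⟩
    obtain rfl := h v hv hv'
    exact state_unique hv''.tendsto hω.tendsto
  have hex : ∃ ω', IsScatteringPair G f₁ f₂ δ ϕ α ω' := ⟨ω, u, hu, hα, hω⟩
  exact ⟨⟨⟨u, ⟨hu, hα⟩, fun v hv => h v hv.1 hv.2⟩, ω, ⟨u, hu, hα, hω⟩, key⟩,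
    key _ (Classical.epsilon_spec hex)⟩

theorem IsLinSolution.eq_of_past_state {u v : ℝ → H2 H} {α : H2 H} (hu : IsLinSolution G u)
    (hv : IsLinSolution G v) (hu' : HasLinPastState G u α) (hv' : HasLinPastState G v α) :
    u = v := funext fun s => by
  have := hu.norm_sub_eq hv hu'.tendsto hv'.tendsto s
  rw [sub_self, norm_zero] at this
  exact sub_eq_zero.mp (norm_eq_zero.mp this)

theorem IsSolution.norm_eq_of_past_state {u : ℝ → H2 H} {α : H2 H} (hu : IsSolution G f₁ f₂ δ u)
    (h : HasPastState G f₁ f₂ δ 0 u α) (s : ℝ) : ‖u s‖ = ‖α‖ := by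
  have h1 : Tendsto (fun _ : ℝ => ‖u s‖) atBot (𝓝 ‖α‖) := by
    refine (tendsto_norm_of_norm_sub_le (Eventually.of_forall fun s => le_rfl)
      (fun s => norm_profile (G := G) (f₁ := f₁) (f₂ := f₂) δ 0 α s) ?_).congr
      fun t => hu.norm_eq t s
    simpa using h.tendsto.norm
  exact tendsto_nhds_unique tendsto_const_nhds h1

theorem exists_lin_scattering [FiniteDimensional ℂ H] (G : H →L[ℂ] H) {α : H2 H} (hα : ‖α‖ = 1) :
    ∃ v ω, IsLinSolution G v ∧ HasLinPastState G v α ∧ HasLinFutureState G v ω ∧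
      LinScatteringDefined G α ∧ linScatteringOp G α = ω := by
  have h0 : |(0 : ℝ)| ≤ 1 := by rw [abs_zero]; exact zero_le_one
  obtain ⟨v, hv, hv'⟩ := exists_solution_of_past_state (nice_zero le_rfl) (nice_zero le_rfl)
    (le_refl ‖G‖) h0 hα
  have h2 : ‖v 0‖ ≤ 2 := by rw [hv.norm_eq_of_past_state hv', hα]; exact one_le_two
  obtain ⟨ω, hω, -⟩ := hv.exists_futureState (nice_zero le_rfl) (nice_zero le_rfl) h0 h2
  obtain ⟨h3, h4⟩ := scattering_of_unique hv hv' hω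
    fun w hw hw' => IsLinSolution.eq_of_past_state hw hv hw' hv'
  exact ⟨v, ω, hv, hv', hω, h3, h4⟩

theorem norm_linScatteringOp_sub [FiniteDimensional ℂ H] {α β : H2 H} (hα : ‖α‖ = 1)
    (hβ : ‖β‖ = 1) : ‖linScatteringOp G α - linScatteringOp G β‖ = ‖α - β‖ := by
  obtain ⟨v, ω, hv, hv', hω, -, rfl⟩ := exists_lin_scattering G hα
  obtain ⟨w, ω', hw, hw', hω', -, rfl⟩ := exists_lin_scattering G hβ
  rw [← hv.norm_sub_eq hw hv'.tendsto hw'.tendsto 0,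
    hv.norm_sub_eq hw hω.tendsto hω'.tendsto 0]

/-- The scattering operator for weak coupling is well defined and close to the linear one. -/
theorem scattering_weak_coupling [FiniteDimensional ℂ H] (hf₁ : Nice f₁ M) (hf₂ : Nice f₂ M)
    (hG : ‖G‖ ≤ R) (hδ : |δ| ≤ 1) (hδ' : 48 * M * (R + M) * |δ| ≤ 1 / 2) (ϕ : ℝ) {α : H2 H}
    (hα : ‖α‖ = 1) : Admissible G f₁ f₂ δ ϕ α ∧ ScatteringDefined G f₁ f₂ δ ϕ α ∧
      ‖scatteringOp G f₁ f₂ δ ϕ α - linScatteringOp G α‖ ≤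
        |δ| * (2 * nearC R M + 4 * M) + 2 * |ϕ| := by
  have hβ : ‖twist ϕ α‖ = 1 := by rw [norm_twist, hα]
  obtain ⟨u, hu, hu'⟩ := exists_solution_of_past_state hf₁ hf₂ hG hδ hβ
  have h2 : ‖u 0‖ ≤ 2 := by rw [hu.norm_eq_of_past_state hu', hβ]; exact one_le_two
  obtain ⟨ω, hω, -⟩ := hu.exists_futureState hf₁ hf₂ hδ h2
  obtain ⟨h3, h4⟩ := scattering_of_unique hu hu' hω
    fun w hw hw' => hw.eq_of_past_state hf₁ hf₂ hG hδ hδ' (hβ.trans_le one_le_two) hu hw' hu'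
  refine ⟨⟨u, hu, hasPastState_twist.mp hu'⟩, scatteringDefined_twist.mp h3, ?_⟩
  obtain ⟨v, ω', hv, hv', hω', -, h5⟩ := exists_lin_scattering G hβ
  have h6 := norm_futureState_sub_le hf₁ hf₂ hG hδ hβ hu hv hu' hv' hω hω'
  have h7 := norm_linScatteringOp_sub (G := G) hβ hα
  have h8 := norm_twist_sub_le ϕ α
  rw [hα, mul_one] at h8
  rw [← scatteringOp_twist, h4]
  rw [h5] at h7
  linarith [norm_sub_le_norm_sub_add_norm_sub ω ω' (linScatteringOp G α)]

/-- A gauge transformation changes the coupling when the two nonlinearities agree. -/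
def gauged (f : ℝ × ℝ → ℝ) (δ c : ℝ) (u : ℝ → H2 H) (s : ℝ) : H2 H :=
  Complex.exp (Complex.I * ((δ * ((∫ t in (0 : ℝ)..s, nlF f (u t)) + c) : ℝ) : ℂ)) • u s

theorem nlF_gauged (f g : ℝ × ℝ → ℝ) (δ c : ℝ) (u : ℝ → H2 H) (s : ℝ) :
    nlF g (gauged f δ c u s) = nlF g (u s) := nlF_smul g (norm_cexp_I_mul _) _

/-- A common scalar phase commutes with `V(s)` and leaves `F(u)` unchanged, while its derivative
contributes `δ' F(u)`. No smallness of `δ'` is needed. -/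
theorem IsSolution.gauged (hF : ∀ v : H2 H, nlF f₁ v = nlF f₂ v) (hf : Continuous f₁)
    {u : ℝ → H2 H} (hu : IsSolution G f₁ f₂ δ u) (δ' c : ℝ) :
    IsSolution G f₁ f₂ (δ + δ') (gauged f₁ δ' c u) := by
  intro s
  have hΦ := ((hasDerivAt_integral_of_continuous (continuous_nlF hf hu.continuous) s).add_const
    c).const_mul δ'
  have hv : ∀ (a : ℂ) (w : H2 H), vec (a • w.fst) (a • w.snd) = a • w := fun a w =>
    H2.ext rfl rfl
  refine ((hasDerivAt_cexp_real hΦ).fun_smul (hu s)).congr_deriv ?_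
  simp only [← hF, hv, nlF_gauged]
  rw [LandauZener.gauged, V_smul]
  push_cast
  module

theorem profile_add_coupling (hF : ∀ v : H2 H, nlF f₁ v = nlF f₂ v) (δ δ' : ℝ) (α : H2 H) (s : ℝ) :
    profile G f₁ f₂ (δ + δ') 0 α s =
      Complex.exp (Complex.I * ((δ' * (nlF f₁ α * s) : ℝ) : ℂ)) • profile G f₁ f₂ δ 0 α s := by
  refine H2.ext ?_ ?_
  · rw [WithLp.smul_fst, profile_fst, profile_fst, smul_smul, ← Complex.exp_add]
    congr 2; push_cast; ring
  · rw [WithLp.smul_snd, profile_snd, profile_snd, smul_smul, ← Complex.exp_add, ← hF]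
    congr 2; push_cast; ring

/-- The asymptotics `F(α) s + κ` of the phase integral split the gauge factor into the frequency
change `δ' F(α)` and a constant phase. The choice `c = -κ` leaves the state unchanged. -/
theorem isBigO_gauged_sub (hF : ∀ v : H2 H, nlF f₁ v = nlF f₂ v) {l : Filter ℝ} {g : ℝ → ℝ}
    {u : ℝ → H2 H} {α : H2 H} {κ c : ℝ} (δ' : ℝ)
    (hu : (fun s => u s - profile G f₁ f₂ δ 0 α s) =O[l] g)
    (hκ : (fun s => (∫ t in (0 : ℝ)..s, nlF f₁ (u t)) - nlF f₁ α * s - κ) =O[l] g) :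
    (fun s => gauged f₁ δ' c u s - profile G f₁ f₂ (δ + δ') 0
      (Complex.exp (Complex.I * ((δ' * (κ + c) : ℝ) : ℂ)) • α) s) =O[l] g := by
  set E : ℝ → ℂ := fun s =>
    Complex.exp (Complex.I * ((δ' * ((∫ t in (0 : ℝ)..s, nlF f₁ (u t)) + c) : ℝ) : ℂ)) with hE
  set E' : ℝ → ℂ := fun s =>
    Complex.exp (Complex.I * ((δ' * (nlF f₁ α * s + (κ + c)) : ℝ) : ℂ)) with hE'
  have e : ∀ s, gauged f₁ δ' c u s - profile G f₁ f₂ (δ + δ') 0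
      (Complex.exp (Complex.I * ((δ' * (κ + c) : ℝ) : ℂ)) • α) s =
      E s • (u s - profile G f₁ f₂ δ 0 α s) + (E s - E' s) • profile G f₁ f₂ δ 0 α s :=
      fun s => by
    have : E' s = Complex.exp (Complex.I * ((δ' * (κ + c) : ℝ) : ℂ)) *
        Complex.exp (Complex.I * ((δ' * (nlF f₁ α * s) : ℝ) : ℂ)) := by
      rw [hE', ← Complex.exp_add]; push_cast; ring_nf
    rw [profile_smul _ _ _ (norm_cexp_I_mul _), profile_add_coupling hF, this, smul_smul]
    change E s • u s - _ = _
    module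
  simp only [e]
  refine IsBigO.add ?_ ?_
  · refine (IsBigO.of_bound 1 (Eventually.of_forall fun s => ?_)).trans hu
    rw [norm_smul, norm_cexp_I_mul]
  · refine (IsBigO.of_bound (|δ'| * ‖α‖) (Eventually.of_forall fun s => ?_)).trans hκ
    rw [norm_smul, norm_profile]
    have h1 := norm_cexp_sub_cexp_le (δ' * ((∫ t in (0 : ℝ)..s, nlF f₁ (u t)) + c))
      (δ' * (nlF f₁ α * s + (κ + c)))
    rw [← mul_sub, abs_mul] at h1
    calc _ ≤ |δ'| * |(∫ t in (0 : ℝ)..s, nlF f₁ (u t)) + c - (nlF f₁ α * s + (κ + c))| * ‖α‖ := by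
          gcongr
      _ = _ := by rw [Real.norm_eq_abs]; ring_nf

end LandauZener
end

/-! ### Equal nonlinearities. -/

noncomputable section
namespace LandauZener

variable {H : Type u} [NormedAddCommGroup H] [InnerProductSpace ℂ H] [CompleteSpace H]
variable {G : H →L[ℂ] H} {f₁ f₂ : ℝ × ℝ → ℝ} {δ M R : ℝ}

/-- Bound for the phase shifts. -/
def shiftC (R M : ℝ) : ℝ := pastC R M + 2 * M

theorem IsLinSolution.exists_past_shift {f : ℝ × ℝ → ℝ} (hf : Nice f M) (hG : ‖G‖ ≤ R)
    {v : ℝ → H2 H} {α : H2 H} (hα : ‖α‖ = 1) (hv : IsLinSolution G v) (hv' : HasLinPastState G v α) :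
    ∃ κ, |κ| ≤ shiftC R M ∧ (fun s => (∫ t in (0 : ℝ)..s, nlF f (v t)) - nlF f α * s - κ)
      =O[atBot] (fun s : ℝ => 1 / |s|) := by
  have hα2 : ‖α‖ ≤ 2 := hα.trans_le one_le_two
  obtain ⟨-, h⟩ := IsSolution.pastExpansion hv (nice_zero hf.nonneg) (nice_zero hf.nonneg) hG
    (by rw [abs_zero]; exact zero_le_one) hα2 hv'.tendsto
  obtain ⟨κ, hκ⟩ := h f hf
  refine ⟨κ, ?_, ?_⟩
  · have h1 := hκ (-1) le_rfl
    rw [abs_neg, abs_one, div_one] at h1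
    have hv2 : ‖v 0‖ ≤ 2 := (IsSolution.norm_eq_of_past_state hv hv' 0).trans_le hα2
    have h2 : |∫ t in (0 : ℝ)..(-1), nlF f (v t)| ≤ M := by
      have := intervalIntegral.norm_integral_le_of_norm_le_const (a := 0) (b := -1) (C := M)
        (f := fun t => nlF f (v t)) (fun t _ => IsSolution.abs_nlF_le hv hv2 hf t)
      simpa using this
    have h3 : |nlF f α| ≤ M := hf.bound _ (sq_norm_mem_Icc ((norm_fst_le α).trans hα2)) _
      (sq_norm_mem_Icc ((norm_snd_le α).trans hα2))
    rw [shiftC]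
    rw [abs_le] at *
    constructor <;> linarith [h1.1, h1.2, h2.1, h2.2, h3.1, h3.2]
  · refine IsBigO.of_bound (pastC R M) (eventually_atBot_of_le_neg_one fun s hs => ?_)
    refine (hκ s hs).trans_eq ?_
    rw [norm_div, norm_one, Real.norm_eq_abs, abs_abs]; ring

theorem IsLinSolution.exists_future_shift {f : ℝ × ℝ → ℝ} (hf : Nice f M) (hG : ‖G‖ ≤ R)
    {v : ℝ → H2 H} {ω : H2 H} (hω : ‖ω‖ = 1) (hv : IsLinSolution G v)
    (hv' : HasLinFutureState G v ω) :
    ∃ κ, |κ| ≤ shiftC R M ∧ (fun s => (∫ t in (0 : ℝ)..s, nlF f (v t)) - nlF f ω * s - κ)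
      =O[atTop] (fun s : ℝ => 1 / |s|) := by
  have hv'' : HasLinPastState G (LandauZener.reversed v) (refl ω) := by
    have := hasFutureState_iff_reversed.mp hv'
    rwa [neg_zero] at this
  obtain ⟨κ, hκ, h⟩ := hv.reversed.exists_past_shift hf hG ((norm_refl ω).trans hω) hv''
  refine ⟨-κ, (abs_neg κ).trans_le hκ, ?_⟩
  have e : ∀ s : ℝ, ∫ t in (0 : ℝ)..-s, nlF f (LandauZener.reversed v t) =
      -∫ t in (0 : ℝ)..s, nlF f (v t) := fun s => by
    simp only [LandauZener.reversed, nlF_refl]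
    rw [intervalIntegral.integral_comp_neg (fun t => nlF f (v t)), neg_neg, neg_zero,
      intervalIntegral.integral_symm]
  refine (h.comp_tendsto tendsto_neg_atTop_atBot).neg_left.congr (fun s => ?_) fun s => ?_
  · simp only [Function.comp_apply, e, nlF_refl]; ring
  · simp

theorem tendsto_integral_sub_const {F : ℝ → ℝ} (hF : Continuous F) {c κ : ℝ}
    (h : (fun s => (∫ t in (0 : ℝ)..s, F t) - c * s - κ) =O[atTop] (fun s : ℝ => 1 / |s|)) :
    Tendsto (fun T : ℝ => ∫ t in (0 : ℝ)..T, (F t - c)) atTop (𝓝 κ) := by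
  have h1 : Tendsto (fun s : ℝ => 1 / |s|) atTop (𝓝 0) :=
    ((tendsto_const_div_abs_atBot 1).comp tendsto_neg_atTop_atBot).congr fun s => by simp
  have h2 := (h.trans_tendsto h1).add_const κ
  rw [zero_add] at h2
  refine h2.congr fun s => ?_
  rw [intervalIntegral.integral_sub (hF.intervalIntegrable _ _) intervalIntegrable_const,
    intervalIntegral.integral_const, smul_eq_mul]
  ring

theorem tendsto_integral_neg_sub_const {F : ℝ → ℝ} (hF : Continuous F) {c κ : ℝ}
    (h : (fun s => (∫ t in (0 : ℝ)..s, F t) - c * s - κ) =O[atBot] (fun s : ℝ => 1 / |s|)) :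
    Tendsto (fun T : ℝ => ∫ t in (-T)..0, (F t - c)) atTop (𝓝 (-κ)) := by
  have h2 := ((h.trans_tendsto (tendsto_const_div_abs_atBot 1)).comp
    tendsto_neg_atTop_atBot).add_const κ
  rw [zero_add] at h2
  refine h2.neg.congr fun s => ?_
  rw [intervalIntegral.integral_sub (hF.intervalIntegrable _ _) intervalIntegrable_const,
    intervalIntegral.integral_const, smul_eq_mul, intervalIntegral.integral_symm]
  simp only [Function.comp_apply]
  ring

theorem gauged_gauged (f : ℝ × ℝ → ℝ) (δ c : ℝ) (u : ℝ → H2 H) :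
    gauged f δ c (gauged f (-δ) c u) = u := funext fun s => by
  rw [gauged]
  simp only [nlF_gauged]
  rw [gauged, smul_smul, ← Complex.exp_add]
  push_cast
  ring_nf
  simp

/-- Solutions with a given past state are gauge transforms of the linear solution. -/
theorem eq_gauged_of_past_state [FiniteDimensional ℂ H] (hF : ∀ v : H2 H, nlF f₁ v = nlF f₂ v)
    (hf₁ : Nice f₁ M) {u v : ℝ → H2 H} {α : H2 H} (hα : ‖α‖ = 1) {κ : ℝ}
    (hv : IsLinSolution G v) (hv' : HasLinPastState G v α)
    (hκ : (fun s => (∫ t in (0 : ℝ)..s, nlF f₁ (v t)) - nlF f₁ α * s - κ)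
      =O[atBot] (fun s : ℝ => 1 / |s|))
    (hu : IsSolution G f₁ f₂ δ u) (hu' : HasPastState G f₁ f₂ δ 0 u α) :
    u = gauged f₁ δ (-κ) v := by
  -- For large `δ` the asymptotics of `∫ F(u)` are not available directly. This preliminary gauge
  -- leads to a linear solution with the same component norms, whose state `β` provides them.
  have hw := hu.gauged hF hf₁.smooth.continuous (-δ) 0
  rw [add_neg_cancel, ← isLinSolution_iff] at hw
  have hn : ∀ s, ‖(gauged f₁ (-δ) 0 u s).fst‖ = ‖(u s).fst‖ := fun s => by
    rw [gauged, WithLp.smul_fst, norm_smul, norm_cexp_I_mul, one_mul]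
  have hn' : ∀ s, ‖(gauged f₁ (-δ) 0 u s).snd‖ = ‖(u s).snd‖ := fun s => by
    rw [gauged, WithLp.smul_snd, norm_smul, norm_cexp_I_mul, one_mul]
  have hw0 : ‖gauged f₁ (-δ) 0 u 0‖ = 1 := by
    rw [gauged, norm_smul, norm_cexp_I_mul, one_mul, hu.norm_eq_of_past_state hu', hα]
  obtain ⟨β, hβ, -⟩ := IsSolution.exists_pastExpansion hw (nice_zero hf₁.nonneg)
    (nice_zero hf₁.nonneg) (le_refl ‖G‖) (by rw [abs_zero]; exact zero_le_one)
    (hw0.trans_le one_le_two)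
  have hβ1 : ‖β‖ = 1 := by rw [hβ.norm_eq, hw0]
  obtain ⟨κ', -, hκ'⟩ := hw.exists_past_shift hf₁ (le_refl ‖G‖) hβ1
    (hasPastState_of_le hβ.sub_profile)
  simp only [nlF_gauged] at hκ'
  have hu0 := hu'.tendsto.norm
  have hβ0 := hβ.tendsto.norm
  rw [norm_zero] at hu0 hβ0
  have e₁ : ‖β.fst‖ = ‖α.fst‖ := by
    have h1 : Tendsto (fun s => ‖(u s).fst‖) atBot (𝓝 ‖α.fst‖) :=
      tendsto_norm_of_norm_sub_le (Eventually.of_forall fun s => by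
        rw [← WithLp.sub_fst]; exact norm_fst_le _)
        (fun s => norm_profile_fst (G := G) (f₁ := f₁) (f₂ := f₂) δ 0 α s) hu0
    have h2 : Tendsto (fun s => ‖(gauged f₁ (-δ) 0 u s).fst‖) atBot (𝓝 ‖β.fst‖) :=
      tendsto_norm_of_norm_sub_le (Eventually.of_forall fun s => by
        rw [← WithLp.sub_fst]; exact norm_fst_le _)
        (fun s => norm_profile_fst (G := G) (f₁ := 0) (f₂ := 0) 0 0 β s) hβ0
    simp only [hn] at h2
    exact tendsto_nhds_unique h2 h1
  have e₂ : ‖β.snd‖ = ‖α.snd‖ := by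
    have h1 : Tendsto (fun s => ‖(u s).snd‖) atBot (𝓝 ‖α.snd‖) :=
      tendsto_norm_of_norm_sub_le (Eventually.of_forall fun s => by
        rw [← WithLp.sub_snd]; exact norm_snd_le _)
        (fun s => norm_profile_snd (G := G) (f₁ := f₁) (f₂ := f₂) δ 0 α s) hu0
    have h2 : Tendsto (fun s => ‖(gauged f₁ (-δ) 0 u s).snd‖) atBot (𝓝 ‖β.snd‖) :=
      tendsto_norm_of_norm_sub_le (Eventually.of_forall fun s => by
        rw [← WithLp.sub_snd]; exact norm_snd_le _)
        (fun s => norm_profile_snd (G := G) (f₁ := 0) (f₂ := 0) 0 0 β s) hβ0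
    simp only [hn'] at h2
    exact tendsto_nhds_unique h2 h1
  have hFβ : nlF f₁ β = nlF f₁ α := by rw [nlF, nlF, e₁, e₂]
  rw [hFβ] at hκ'
  -- The second gauge is normalised by `κ'`, so the resulting linear solution has the state `α`
  -- itself and must be `v`.
  have hz := hu.gauged hF hf₁.smooth.continuous (-δ) (-κ')
  have hz' := isBigO_gauged_sub (c := -κ') hF (-δ) hu' hκ'
  rw [add_neg_cancel, add_neg_cancel, mul_zero, Complex.ofReal_zero, mul_zero, Complex.exp_zero,
    one_smul] at hz'
  rw [add_neg_cancel, ← isLinSolution_iff] at hz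
  obtain rfl := IsLinSolution.eq_of_past_state hv hz hv' (hasLinPastState_iff.mpr hz')
  simp only [nlF_gauged] at hκ
  have hκκ : κ = κ' := by
    have h1 := (hκ'.sub hκ).trans_tendsto (tendsto_const_div_abs_atBot 1)
    have h2 := tendsto_nhds_unique (h1.congr fun s => by ring : Tendsto
      (fun _ : ℝ => κ - κ') atBot (𝓝 0)) tendsto_const_nhds
    linarith
  rw [hκκ, gauged_gauged]

/-- The scattering theory in the case of equal nonlinearities. -/
theorem equal_nonlinearities [FiniteDimensional ℂ H] (hF : ∀ v : H2 H, nlF f₁ v = nlF f₂ v)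
    (hf₁ : Nice f₁ M) (hG : ‖G‖ ≤ R) {α : H2 H} (hα : ‖α‖ = 1) :
    ∃ Λm Λp : ℝ, |Λm| ≤ shiftC R M ∧ |Λp| ≤ shiftC R M ∧ ∀ δ : ℝ,
      ScatteringDefined G f₁ f₂ δ 0 α ∧
      (∀ u : ℝ → H2 H, IsSolution G f₁ f₂ δ u → HasPastState G f₁ f₂ δ 0 u α →
        ∃ ulin : ℝ → H2 H, IsLinSolution G ulin ∧ ulin 0 = u 0 ∧
          HasLinPastState G ulin (Complex.exp (Complex.I * δ * Λm) • α) ∧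
          HasLinFutureState G ulin (Complex.exp (Complex.I * δ * Λm) • linScatteringOp G α) ∧
          Tendsto (fun T : ℝ => ∫ τ in (-T)..0, (nlF f₁ (ulin τ) -
            nlF f₁ (Complex.exp (Complex.I * δ * Λm) • α))) atTop (𝓝 Λm) ∧
          Tendsto (fun T : ℝ => ∫ τ in (0 : ℝ)..T, (nlF f₁ (ulin τ) -
            nlF f₁ (Complex.exp (Complex.I * δ * Λm) • linScatteringOp G α))) atTop (𝓝 Λp)) ∧
      scatteringOp G f₁ f₂ δ 0 α = Complex.exp (Complex.I * δ * Λp) •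
        linScatteringOp G (Complex.exp (Complex.I * δ * Λm) • α) ∧
      scatteringOp G f₁ f₂ δ 0 α = Complex.exp (Complex.I * δ * (Λp + Λm)) •
        linScatteringOp G α ∧ ‖linScatteringOp G α‖ = 1 := by
  obtain ⟨v, ω, hv, hv', hω, -, h4⟩ := exists_lin_scattering G hα
  rw [h4]
  have hω1 : ‖ω‖ = 1 := by
    have h2 : ‖v 0‖ = 1 := by rw [IsSolution.norm_eq_of_past_state hv hv', hα]
    obtain ⟨ω₁, hω₁, hn⟩ := IsSolution.exists_futureState (nice_zero le_rfl) (nice_zero le_rfl)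
      (by rw [abs_zero]; exact zero_le_one) hv (h2.trans_le one_le_two)
    rw [state_unique hω.tendsto hω₁.tendsto, hn, h2]
  obtain ⟨κ, hκ, hκ'⟩ := hv.exists_past_shift hf₁ hG hα hv'
  obtain ⟨Λp, hp, hp'⟩ := hv.exists_future_shift hf₁ hG hω1 hω
  have hcont : Continuous fun s => nlF f₁ (v s) :=
    continuous_nlF hf₁.smooth.continuous (IsSolution.continuous hv)
  -- `κ` is the limit of integrals from `0` to `s → -∞`, so the integral over the negative half-line
  -- is `-κ`. Both shifts come from the linear solution `v` with state `α` and do not involve `δ`.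
  refine ⟨-κ, Λp, (abs_neg κ).trans_le hκ, hp, fun δ => ?_⟩
  have hu := (isLinSolution_iff (f₁ := f₁) (f₂ := f₂)).mp hv |>.gauged hF
    hf₁.smooth.continuous δ (-κ)
  have hu' := isBigO_gauged_sub (c := -κ) hF δ (hasLinPastState_iff.mp hv') hκ'
  have hu'' := isBigO_gauged_sub (c := -κ) hF δ (hasLinFutureState_iff.mp hω) hp'
  rw [add_neg_cancel, mul_zero, Complex.ofReal_zero, mul_zero, Complex.exp_zero, one_smul] at hu'
  rw [zero_add] at hu hu' hu''
  obtain ⟨h5, h6⟩ := scattering_of_unique hu hu' hu''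
    fun w hw hw' => eq_gauged_of_past_state hF hf₁ hα hv hv' hκ' hw hw'
  have hc : ∀ x : ℝ, Complex.exp (Complex.I * δ * x) =
      Complex.exp (Complex.I * ((δ * x : ℝ) : ℂ)) := fun x => by
    congr 1; push_cast; ring
  have hc1 : ‖Complex.exp (Complex.I * δ * ((-κ : ℝ) : ℂ))‖ = 1 := by
    rw [hc]; exact norm_cexp_I_mul _
  have h7 := hv.smul (Complex.exp (Complex.I * δ * ((-κ : ℝ) : ℂ)))
  have h8 := HasPastState.smul hv' hc1
  have h9 := HasFutureState.smul hω hc1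
  have h10 : linScatteringOp G (Complex.exp (Complex.I * δ * ((-κ : ℝ) : ℂ)) • α) =
      Complex.exp (Complex.I * δ * ((-κ : ℝ) : ℂ)) • ω :=
    (scattering_of_unique h7 h8 h9
      fun w hw hw' => IsLinSolution.eq_of_past_state hw h7 hw' h8).2
  -- The solution `u` is `v` times a phase that equals `e^{iδΛ⁻}` at time `0`, so `ulin` is
  -- `e^{iδΛ⁻} v`. A unimodular constant does not affect the nonlinearity, which is why the
  -- integrals do not depend on `δ`.
  refine ⟨h5, fun u hu₁ hu₂ => ⟨_, h7, ?_, h8, h9, ?_, ?_⟩, ?_, ?_, hω1⟩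
  · rw [eq_gauged_of_past_state hF hf₁ hα hv hv' hκ' hu₁ hu₂, gauged,
      intervalIntegral.integral_same, zero_add, hc]
  · simp only [nlF_smul f₁ hc1]
    exact tendsto_integral_neg_sub_const hcont hκ'
  · simp only [nlF_smul f₁ hc1]
    exact tendsto_integral_sub_const hcont hp'
  · rw [h6, h10, smul_smul, ← Complex.exp_add]
    congr 2; push_cast; ring
  · rw [h6]
    congr 2; push_cast; ring

end LandauZener
end

/-! ### Estimates for bounded interaction, and invariant subspaces. -/

noncomputable section
namespace LandauZener

variable {H : Type u} [NormedAddCommGroup H] [InnerProductSpace ℂ H] [CompleteSpace H]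
variable {G G' P₁ P₂ : H →L[ℂ] H} {f₁ f₂ : ℝ × ℝ → ℝ} {δ M R : ℝ}

/-- The scattering estimates at a state `α`. -/
def ScatteringEstimates (G : H →L[ℂ] H) (f₁ f₂ : ℝ × ℝ → ℝ) (δ₀ C : ℝ) (α : H2 H) : Prop :=
  LinScatteringDefined G α ∧
    (∀ δ : ℝ, |δ| ≤ δ₀ →
      (∃ ϕ ∈ Set.Ico 0 (2 * Real.pi), Admissible G f₁ f₂ δ ϕ α ∧ ϕ ≤ C * |δ| ∧
        ‖scatteringOp G f₁ f₂ δ ϕ α - linScatteringOp G α‖ ≤ C * |δ|) ∧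
      (∀ ϕ : ℝ, Admissible G f₁ f₂ δ ϕ α →
        ScatteringDefined G f₁ f₂ δ ϕ α ∧
        ‖scatteringOp G f₁ f₂ δ ϕ α - linScatteringOp G α‖ ≤ C * (|δ| + |ϕ|))) ∧
    ((∀ v : H2 H, nlF f₁ v = nlF f₂ v) →
      ∃ Λm Λp : ℝ, ∀ δ : ℝ,
        ScatteringDefined G f₁ f₂ δ 0 α ∧
        (∀ u : ℝ → H2 H, IsSolution G f₁ f₂ δ u → HasPastState G f₁ f₂ δ 0 u α →
          ∃ (ulin : ℝ → H2 H) (αlin ωlin : H2 H),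
            IsLinSolution G ulin ∧ ulin 0 = u 0 ∧
            HasLinPastState G ulin αlin ∧ HasLinFutureState G ulin ωlin ∧
            Tendsto (fun T : ℝ => ∫ τ in (-T)..0, (nlF f₁ (ulin τ) - nlF f₁ αlin))
              atTop (𝓝 Λm) ∧
            Tendsto (fun T : ℝ => ∫ τ in (0 : ℝ)..T, (nlF f₁ (ulin τ) - nlF f₁ ωlin))
              atTop (𝓝 Λp)) ∧
        scatteringOp G f₁ f₂ δ 0 α =
          Complex.exp (Complex.I * δ * Λp) •
            linScatteringOp G (Complex.exp (Complex.I * δ * Λm) • α) ∧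
        (|δ| ≤ δ₀ →
          ‖scatteringOp G f₁ f₂ δ 0 α - linScatteringOp G α
            - (Complex.I * δ * (Λp + Λm)) • linScatteringOp G α‖ ≤ C * δ ^ 2))

/-- The admissible range of the coupling. -/
def couplingBound (R M : ℝ) : ℝ := 1 / (1 + 96 * M * (R + M) + 2 * shiftC R M)

/-- The constant of the scattering estimates. -/
def estimateC (R M : ℝ) : ℝ := 2 * nearC R M + 4 * M + 2 + (2 * shiftC R M) ^ 2

theorem shiftC_nonneg (hR : 0 ≤ R) (hM : 0 ≤ M) : 0 ≤ shiftC R M := by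
  have := pastC_nonneg hR hM
  rw [shiftC]; positivity

theorem couplingBound_pos (hR : 0 ≤ R) (hM : 0 ≤ M) : 0 < couplingBound R M := by
  have := shiftC_nonneg hR hM
  rw [couplingBound]; positivity

/-- The three requirements on `δ`: the standing bound of the expansions, the contraction for
uniqueness, and `‖x‖ ≤ 1` in the second order expansion of the exponential. -/
theorem mul_le_one_of_le_couplingBound (hR : 0 ≤ R) (hM : 0 ≤ M) (h : |δ| ≤ couplingBound R M) :
    |δ| ≤ 1 ∧ 48 * M * (R + M) * |δ| ≤ 1 / 2 ∧ |δ| * (2 * shiftC R M) ≤ 1 := by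
  have hs := shiftC_nonneg hR hM
  have h1 : |δ| * (1 + 96 * M * (R + M) + 2 * shiftC R M) ≤ 1 := by
    rwa [couplingBound, le_div_iff₀ (by positivity)] at h
  have a := abs_nonneg δ
  have b : 0 ≤ |δ| * (M * (R + M)) := by positivity
  have c : 0 ≤ |δ| * shiftC R M := by positivity
  refine ⟨?_, ?_, ?_⟩ <;> linarith

/-- The scattering estimates for bounded interaction. -/
theorem scatteringEstimates_of_norm_le [FiniteDimensional ℂ H] (hf₁ : Nice f₁ M) (hf₂ : Nice f₂ M)
    (hG : ‖G‖ ≤ R) {α : H2 H} (hα : ‖α‖ = 1) :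
    ScatteringEstimates G f₁ f₂ (couplingBound R M) (estimateC R M) α := by
  have hM := hf₁.nonneg
  have hR : 0 ≤ R := (norm_nonneg G).trans hG
  have hN := nearC_nonneg hR hM
  have hS := shiftC_nonneg hR hM
  have hC : 2 * nearC R M + 4 * M ≤ estimateC R M := by
    rw [estimateC]; linarith [sq_nonneg (2 * shiftC R M)]
  have hC2 : 2 ≤ estimateC R M := by
    rw [estimateC]; linarith [sq_nonneg (2 * shiftC R M)]
  have hCs : (2 * shiftC R M) ^ 2 ≤ estimateC R M := by
    rw [estimateC]; linarith
  refine ⟨?_, fun δ hδ => ?_, fun hF => ?_⟩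
  · obtain ⟨-, -, -, -, -, h, -⟩ := exists_lin_scattering G hα
    exact h
  · obtain ⟨h1, h2, -⟩ := mul_le_one_of_le_couplingBound hR hM hδ
    have key := fun ϕ => scattering_weak_coupling hf₁ hf₂ hG h1 h2 ϕ hα
    have hm : |δ| * (2 * nearC R M + 4 * M) ≤ estimateC R M * |δ| := by
      rw [mul_comm]; gcongr
    -- The phase `0` is always admissible and serves as the required choice.
    refine ⟨⟨0, ⟨le_rfl, by positivity⟩, (key 0).1, by positivity, ?_⟩, fun ϕ _ =>
      ⟨(key ϕ).2.1, ?_⟩⟩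
    · have := (key 0).2.2
      rw [abs_zero, mul_zero, add_zero] at this
      exact this.trans hm
    · have hϕ : 2 * |ϕ| ≤ estimateC R M * |ϕ| := by gcongr
      linarith [(key ϕ).2.2]
  · obtain ⟨Λm, Λp, hm, hp, h⟩ := equal_nonlinearities hF hf₁ hG hα
    refine ⟨Λm, Λp, fun δ => ?_⟩
    obtain ⟨h1, h2, h3, h4, h5⟩ := h δ
    refine ⟨h1, fun u hu hu' => ?_, h3, fun hδ => ?_⟩
    · obtain ⟨ulin, h6⟩ := h2 u hu hu'
      exact ⟨ulin, _, _, h6⟩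
    · obtain ⟨-, -, h6⟩ := mul_le_one_of_le_couplingBound hR hM hδ
      set x : ℂ := Complex.I * δ * (Λp + Λm) with hx
      have hn : ‖x‖ ≤ |δ| * (2 * shiftC R M) := by
        rw [hx, ← Complex.ofReal_add, norm_mul, norm_mul, Complex.norm_I, one_mul,
          Complex.norm_real, Complex.norm_real, Real.norm_eq_abs, Real.norm_eq_abs]
        gcongr
        linarith [abs_add_le Λp Λm]
      have e : Complex.exp x • linScatteringOp G α - linScatteringOp G α -
          x • linScatteringOp G α = (Complex.exp x - 1 - x) • linScatteringOp G α := by module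
      rw [h4, e, norm_smul, h5, mul_one]
      refine (Complex.norm_exp_sub_one_sub_id_le (hn.trans h6)).trans ?_
      calc ‖x‖ ^ 2 ≤ (|δ| * (2 * shiftC R M)) ^ 2 := by gcongr
        _ = (2 * shiftC R M) ^ 2 * δ ^ 2 := by rw [mul_pow, sq_abs]; ring
        _ ≤ _ := by gcongr

/-- `G` intertwines `P₂` with `P₁`. -/
structure Intertwines (G P₁ P₂ : H →L[ℂ] H) : Prop where
  map : ∀ x, P₁ (G x) = G (P₂ x)
  map_adjoint : ∀ x, P₂ (ContinuousLinearMap.adjoint G x) = ContinuousLinearMap.adjoint G (P₁ x)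

/-- `G` and `G'` agree on the fixed spaces of `P₁` and `P₂`. -/
structure AgreesOn (G G' P₁ P₂ : H →L[ℂ] H) : Prop where
  map : ∀ x, P₂ x = x → G x = G' x
  map_adjoint : ∀ x, P₁ x = x →
    ContinuousLinearMap.adjoint G x = ContinuousLinearMap.adjoint G' x

theorem AgreesOn.symm (h : AgreesOn G G' P₁ P₂) : AgreesOn G' G P₁ P₂ :=
  ⟨fun x hx => (h.map x hx).symm, fun x hx => (h.map_adjoint x hx).symm⟩

/-- The states in the range of the projection `diag(P₁, P₂)`. -/
def Fixed (P₁ P₂ : H →L[ℂ] H) (α : H2 H) : Prop := P₁ α.fst = α.fst ∧ P₂ α.snd = α.snd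

theorem Fixed.smul {α : H2 H} (h : Fixed P₁ P₂ α) (c : ℂ) : Fixed P₁ P₂ (c • α) :=
  ⟨by rw [WithLp.smul_fst, map_smul, h.1], by rw [WithLp.smul_snd, map_smul, h.2]⟩

theorem rot_apply_comm {A P : H →L[ℂ] H} (h : ∀ x, P (A x) = A (P x)) (r : ℝ) (x : H) :
    P (rot A r x) = rot A r (P x) := by
  have hc : Commute P (r • (Complex.I • A)) :=
    ((show Commute P A from ContinuousLinearMap.ext h).smul_right Complex.I).smul_right r
  exact DFunLike.congr_fun hc.exp_right.eq x

/-- The orbit of `x` under the second group stays in the fixed space, where the generators agree;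
hence undoing it with the first group is constant in time. -/
theorem rot_apply_eq {A A' P : H →L[ℂ] H} (hA' : ∀ x, P (A' x) = A' (P x))
    (h : ∀ x, P x = x → A x = A' x) (r : ℝ) {x : H} (hx : P x = x) : rot A r x = rot A' r x := by
  have hd : ∀ t : ℝ, HasDerivAt (fun t => rot A (-t) (rot A' t x)) 0 t := fun t => by
    have h1 := hasDerivAt_rot_apply A' (hasDerivAt_id t) (hasDerivAt_const t x)
    have h2 := hasDerivAt_rot_apply A (hasDerivAt_id t).fun_neg h1
    refine h2.congr_deriv ?_
    have h3 : P (rot A' t x) = rot A' t x := by rw [rot_apply_comm hA', hx]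
    have h4 : A' (rot A' t x) = rot A' t (A' x) := rot_apply_comm (fun _ => rfl) t x
    simp only [id]
    rw [h _ h3, h4]
    simp
  have h1 : rot A (-r) (rot A' r x) = x := by
    have := is_const_of_deriv_eq_zero (fun t => (hd t).differentiableAt) (fun t => (hd t).deriv) r 0
    simpa [rot_zero] using this
  rw [← rot_neg_rot A r (rot A' r x), h1]

theorem Intertwines.map_GGs (h : Intertwines G P₁ P₂) (x : H) : P₁ (GGs G x) = GGs G (P₁ x) := by
  simp only [GGs, mul_apply_eq_comp]
  rw [h.map, h.map_adjoint]

theorem Intertwines.map_GsG (h : Intertwines G P₁ P₂) (x : H) : P₂ (GsG G x) = GsG G (P₂ x) := by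
  simp only [GsG, mul_apply_eq_comp]
  rw [h.map_adjoint, h.map]

theorem Intertwines.map_profile_fst (h : Intertwines G P₁ P₂) (δ ϕ : ℝ) (α : H2 H) (s : ℝ) :
    (profile G f₁ f₂ δ ϕ α s).fst - P₁ (profile G f₁ f₂ δ ϕ α s).fst =
      Complex.exp (Complex.I * ((s ^ 2 / 2 + δ * (nlF f₁ α * s) + ϕ : ℝ) : ℂ)) •
        rot (GGs G) (Real.log s / 2) (α.fst - P₁ α.fst) := by
  rw [profile_fst, map_smul, rot_apply_comm h.map_GGs, map_sub, smul_sub]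

theorem Intertwines.map_profile_snd (h : Intertwines G P₁ P₂) (δ ϕ : ℝ) (α : H2 H) (s : ℝ) :
    (profile G f₁ f₂ δ ϕ α s).snd - P₂ (profile G f₁ f₂ δ ϕ α s).snd =
      Complex.exp (Complex.I * ((-(s ^ 2 / 2) + δ * (nlF f₂ α * s) - ϕ : ℝ) : ℂ)) •
        rot (GsG G) (-(Real.log s / 2)) (α.snd - P₂ α.snd) := by
  rw [profile_snd, map_smul, rot_apply_comm h.map_GsG, map_sub, smul_sub]

theorem Intertwines.profile_eq (h' : Intertwines G' P₁ P₂) (hGG' : AgreesOn G G' P₁ P₂) {α : H2 H} (hα : Fixed P₁ P₂ α) (δ ϕ s : ℝ) :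
    profile G f₁ f₂ δ ϕ α s = profile G' f₁ f₂ δ ϕ α s := by
  refine H2.ext ?_ ?_
  · rw [profile_fst, profile_fst]
    congr 1
    refine rot_apply_eq h'.map_GGs (fun x hx => ?_) _ hα.1
    simp only [GGs, mul_apply_eq_comp]
    rw [hGG'.map_adjoint x hx]
    exact hGG'.map _ (by rw [h'.map_adjoint, hx])
  · rw [profile_snd, profile_snd]
    congr 1
    refine rot_apply_eq h'.map_GsG (fun x hx => ?_) _ hα.2
    simp only [GsG, mul_apply_eq_comp]
    rw [hGG'.map x hx]
    exact hGG'.map_adjoint _ (by rw [h'.map, hx])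

theorem AgreesOn.isSolution (hGG' : AgreesOn G G' P₁ P₂) {u : ℝ → H2 H}
    (hu : ∀ s, Fixed P₁ P₂ (u s)) (h : IsSolution G f₁ f₂ δ u) : IsSolution G' f₁ f₂ δ u := by
  intro s
  have : V G s (u s) = V G' s (u s) := by
    simp only [V]
    rw [hGG'.map _ (hu s).2, hGG'.map_adjoint _ (hu s).1]
  rw [← this]
  exact h s

theorem norm_sub_map_le (P : H →L[ℂ] H) (x : H) : ‖x - P x‖ ≤ (1 + ‖P‖) * ‖x‖ :=
  (norm_sub_le _ _).trans (by linarith [P.le_opNorm x])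

/-- The distance of `α` to the fixed states of `diag(P₁, P₂)`. -/
def defect (P₁ P₂ : H →L[ℂ] H) (α : H2 H) : ℝ :=
  ‖α.fst - P₁ α.fst‖ ^ 2 + ‖α.snd - P₂ α.snd‖ ^ 2

theorem defect_eq_zero {α : H2 H} : defect P₁ P₂ α = 0 ↔ Fixed P₁ P₂ α := by
  rw [defect, add_eq_zero_iff_of_nonneg (sq_nonneg _) (sq_nonneg _), sq_eq_zero_iff,
    sq_eq_zero_iff, norm_eq_zero, norm_eq_zero, sub_eq_zero, sub_eq_zero, Fixed, eq_comm,
    eq_comm (a := α.snd)]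

/-- The complementary part `(1 - P) u` solves the same two-component system with the same prescribed
real potentials, so its norm is conserved although the equation is nonlinear. -/
theorem Intertwines.defect_eq (h : Intertwines G P₁ P₂) {u : ℝ → H2 H}
    (hu : IsSolution G f₁ f₂ δ u) (s t : ℝ) : defect P₁ P₂ (u s) = defect P₁ P₂ (u t) := by
  have hs := isSolution_iff_sys.mp hu
  have hw : Sys 1 G δ (fun s => nlF f₁ (u s)) (fun s => nlF f₂ (u s))
      (fun s => (u s).fst - P₁ (u s).fst) (fun s => (u s).snd - P₂ (u s).snd) := by
    constructor
    · intro t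
      refine ((hs.fst t).fun_sub ((P₁.restrictScalars ℝ).hasFDerivAt.comp_hasDerivAt t
        (hs.fst t))).congr_deriv ?_
      simp only [ContinuousLinearMap.coe_restrictScalars', map_smul, map_add, map_sub, h.map]
      module
    · intro t
      refine ((hs.snd t).fun_sub ((P₂.restrictScalars ℝ).hasFDerivAt.comp_hasDerivAt t
        (hs.snd t))).congr_deriv ?_
      simp only [ContinuousLinearMap.coe_restrictScalars', map_smul, map_add, map_sub,
        h.map_adjoint]
      module
  have hd := hw.hasDerivAt_norm_sq
  exact is_const_of_deriv_eq_zero (fun t => (hd t).differentiableAt) (fun t => (hd t).deriv) s t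

theorem Intertwines.fixed_of_fixed (h : Intertwines G P₁ P₂) {u : ℝ → H2 H}
    (hu : IsSolution G f₁ f₂ δ u) {s : ℝ} (hs : Fixed P₁ P₂ (u s)) (t : ℝ) :
    Fixed P₁ P₂ (u t) := by
  rw [← defect_eq_zero] at *
  rw [h.defect_eq hu t s, hs]

/-- The range of `diag(P₁, P₂)` is invariant under the flow. -/
theorem Intertwines.fixed_of_past_state (h : Intertwines G P₁ P₂) {ϕ : ℝ} {u : ℝ → H2 H} {α : H2 H}
    (hα : Fixed P₁ P₂ α) (hu : IsSolution G f₁ f₂ δ u) (hu' : HasPastState G f₁ f₂ δ ϕ u α) (s : ℝ) :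
    Fixed P₁ P₂ (u s) := by
  have h0 := hu'.tendsto.norm
  rw [norm_zero] at h0
  have l₁ : Tendsto (fun t => ‖(u t).fst - P₁ (u t).fst‖ ^ 2) atBot (𝓝 (((1 + ‖P₁‖) * 0) ^ 2)) := by
    refine squeeze_zero (fun _ => sq_nonneg _) (fun t => ?_) (by
      simpa using (h0.const_mul (1 + ‖P₁‖)).pow 2) |>.trans_eq (by simp)
    have e : (u t).fst - P₁ (u t).fst = (u t - profile G f₁ f₂ δ ϕ α t).fst -
        P₁ (u t - profile G f₁ f₂ δ ϕ α t).fst := by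
      have := h.map_profile_fst (f₁ := f₁) (f₂ := f₂) δ ϕ α t
      rw [hα.1, sub_self, map_zero, smul_zero] at this
      rw [WithLp.sub_fst, map_sub, sub_sub_sub_comm, this, sub_zero]
    rw [e]
    have := norm_sub_map_le P₁ (u t - profile G f₁ f₂ δ ϕ α t).fst
    gcongr
    exact this.trans (by gcongr; exact norm_fst_le _)
  have l₂ : Tendsto (fun t => ‖(u t).snd - P₂ (u t).snd‖ ^ 2) atBot (𝓝 (((1 + ‖P₂‖) * 0) ^ 2)) := by
    refine squeeze_zero (fun _ => sq_nonneg _) (fun t => ?_) (by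
      simpa using (h0.const_mul (1 + ‖P₂‖)).pow 2) |>.trans_eq (by simp)
    have e : (u t).snd - P₂ (u t).snd = (u t - profile G f₁ f₂ δ ϕ α t).snd -
        P₂ (u t - profile G f₁ f₂ δ ϕ α t).snd := by
      have := h.map_profile_snd (f₁ := f₁) (f₂ := f₂) δ ϕ α t
      rw [hα.2, sub_self, map_zero, smul_zero] at this
      rw [WithLp.sub_snd, map_sub, sub_sub_sub_comm, this, sub_zero]
    rw [e]
    have := norm_sub_map_le P₂ (u t - profile G f₁ f₂ δ ϕ α t).snd
    gcongr
    exact this.trans (by gcongr; exact norm_snd_le _)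
  -- The defect is constant in time and tends to zero at `-∞`, so it vanishes.
  have l := l₁.add l₂
  have l' : Tendsto (fun _ : ℝ => defect P₁ P₂ (u s)) atBot _ :=
    l.congr fun t => h.defect_eq hu t s
  have hz := tendsto_nhds_unique tendsto_const_nhds l'
  rw [← defect_eq_zero, hz]
  simp

theorem Intertwines.fixed_of_tendsto (h : Intertwines G P₁ P₂) {l : Filter ℝ} [l.NeBot]
    {u : ℝ → H2 H} {ω : H2 H} (hu : ∀ s, Fixed P₁ P₂ (u s))
    (hω : Tendsto (fun s => u s - profile G f₁ f₂ δ 0 ω s) l (𝓝 0)) : Fixed P₁ P₂ ω := by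
  have h0 := hω.norm
  rw [norm_zero] at h0
  have z₁ : ‖ω.fst - P₁ ω.fst‖ ≤ (1 + ‖P₁‖) * 0 := by
    refine ge_of_tendsto (h0.const_mul (1 + ‖P₁‖)) (Eventually.of_forall fun s => ?_)
    have e := h.map_profile_fst (f₁ := f₁) (f₂ := f₂) δ 0 ω s
    have n : ‖ω.fst - P₁ ω.fst‖ =
        ‖(u s - profile G f₁ f₂ δ 0 ω s).fst - P₁ (u s - profile G f₁ f₂ δ 0 ω s).fst‖ := by
      rw [WithLp.sub_fst, map_sub, (hu s).1, sub_sub_sub_cancel_left,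
        norm_sub_rev (P₁ (profile G f₁ f₂ δ 0 ω s).fst), e, norm_smul, norm_cexp_I_mul, one_mul, norm_rot_apply (isSelfAdjoint_GGs G)]
    rw [n]
    refine (norm_sub_map_le _ _).trans ?_
    gcongr
    exact norm_fst_le _
  have z₂ : ‖ω.snd - P₂ ω.snd‖ ≤ (1 + ‖P₂‖) * 0 := by
    refine ge_of_tendsto (h0.const_mul (1 + ‖P₂‖)) (Eventually.of_forall fun s => ?_)
    have e := h.map_profile_snd (f₁ := f₁) (f₂ := f₂) δ 0 ω s
    have n : ‖ω.snd - P₂ ω.snd‖ =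
        ‖(u s - profile G f₁ f₂ δ 0 ω s).snd - P₂ (u s - profile G f₁ f₂ δ 0 ω s).snd‖ := by
      rw [WithLp.sub_snd, map_sub, (hu s).2, sub_sub_sub_cancel_left,
        norm_sub_rev (P₂ (profile G f₁ f₂ δ 0 ω s).snd), e, norm_smul, norm_cexp_I_mul, one_mul, norm_rot_apply (isSelfAdjoint_GsG G)]
    rw [n]
    refine (norm_sub_map_le _ _).trans ?_
    gcongr
    exact norm_snd_le _
  rw [mul_zero, norm_le_zero_iff, sub_eq_zero] at z₁ z₂
  exact ⟨z₁.symm, z₂.symm⟩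

end LandauZener
end

/-! ### Transfer of the estimates to the truncated operator. -/

noncomputable section
namespace LandauZener

variable {H : Type u} [NormedAddCommGroup H] [InnerProductSpace ℂ H] [CompleteSpace H]
variable {G G' P₁ P₂ : H →L[ℂ] H} {f₁ f₂ : ℝ × ℝ → ℝ} {δ M R : ℝ}

theorem AgreesOn.past_imp (h : Intertwines G P₁ P₂) (h' : Intertwines G' P₁ P₂)
    (hGG' : AgreesOn G G' P₁ P₂) {α : H2 H} (hα : Fixed P₁ P₂ α) {ϕ : ℝ} {u : ℝ → H2 H}
    (hu : IsSolution G f₁ f₂ δ u ∧ HasPastState G f₁ f₂ δ ϕ u α) :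
    IsSolution G' f₁ f₂ δ u ∧ HasPastState G' f₁ f₂ δ ϕ u α := by
  refine ⟨hGG'.isSolution (h.fixed_of_past_state hα hu.1 hu.2) hu.1, ?_⟩
  have := hu.2
  simp only [HasPastState, h'.profile_eq hGG' hα] at this ⊢
  exact this

theorem AgreesOn.past_iff (h : Intertwines G P₁ P₂) (h' : Intertwines G' P₁ P₂)
    (hGG' : AgreesOn G G' P₁ P₂) {α : H2 H} (hα : Fixed P₁ P₂ α) {ϕ : ℝ} {u : ℝ → H2 H} :
    IsSolution G f₁ f₂ δ u ∧ HasPastState G f₁ f₂ δ ϕ u α ↔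
      IsSolution G' f₁ f₂ δ u ∧ HasPastState G' f₁ f₂ δ ϕ u α :=
  ⟨hGG'.past_imp h h' hα, hGG'.symm.past_imp h' h hα⟩

theorem AgreesOn.future_imp (h : Intertwines G P₁ P₂) (h' : Intertwines G' P₁ P₂)
    (hGG' : AgreesOn G G' P₁ P₂) {u : ℝ → H2 H} (hu : ∀ s, Fixed P₁ P₂ (u s)) {ω : H2 H}
    (hω : HasFutureState G f₁ f₂ δ u ω) : HasFutureState G' f₁ f₂ δ u ω := by
  have hf := h.fixed_of_tendsto hu hω.tendsto
  simp only [HasFutureState, h'.profile_eq hGG' hf] at hω ⊢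
  exact hω

theorem AgreesOn.pair_imp (h : Intertwines G P₁ P₂) (h' : Intertwines G' P₁ P₂)
    (hGG' : AgreesOn G G' P₁ P₂) {α ω : H2 H} (hα : Fixed P₁ P₂ α) {ϕ : ℝ}
    (hp : IsScatteringPair G f₁ f₂ δ ϕ α ω) : IsScatteringPair G' f₁ f₂ δ ϕ α ω := by
  obtain ⟨u, hu, hu', hω⟩ := hp
  obtain ⟨h1, h2⟩ := hGG'.past_imp h h' hα ⟨hu, hu'⟩
  exact ⟨u, h1, h2, hGG'.future_imp h h' (h.fixed_of_past_state hα hu hu') hω⟩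

theorem AgreesOn.isScatteringPair_eq (h : Intertwines G P₁ P₂) (h' : Intertwines G' P₁ P₂)
    (hGG' : AgreesOn G G' P₁ P₂) {α : H2 H} (hα : Fixed P₁ P₂ α) (ϕ : ℝ) :
    IsScatteringPair G f₁ f₂ δ ϕ α = IsScatteringPair G' f₁ f₂ δ ϕ α :=
  funext fun _ => propext ⟨hGG'.pair_imp h h' hα, hGG'.symm.pair_imp h' h hα⟩

/-- The scattering estimates only depend on the restriction of `G` to an invariant subspace. -/
theorem AgreesOn.scatteringEstimates (h : Intertwines G P₁ P₂) (h' : Intertwines G' P₁ P₂)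
    (hGG' : AgreesOn G G' P₁ P₂) {α : H2 H} (hα : Fixed P₁ P₂ α) {δ₀ C : ℝ}
    (hE : ScatteringEstimates G' f₁ f₂ δ₀ C α) : ScatteringEstimates G f₁ f₂ δ₀ C α := by
  have hadm : ∀ δ ϕ, Admissible G f₁ f₂ δ ϕ α = Admissible G' f₁ f₂ δ ϕ α := fun δ ϕ =>
    propext (exists_congr fun u => hGG'.past_iff h h' hα)
  have hop : ∀ (g₁ g₂ : ℝ × ℝ → ℝ) δ ϕ β, Fixed P₁ P₂ β →
      scatteringOp G g₁ g₂ δ ϕ β = scatteringOp G' g₁ g₂ δ ϕ β := fun g₁ g₂ δ ϕ β hβ => by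
    simp only [scatteringOp, hGG'.isScatteringPair_eq h h' hβ]
  have hdef : ∀ (g₁ g₂ : ℝ × ℝ → ℝ) δ ϕ,
      ScatteringDefined G g₁ g₂ δ ϕ α = ScatteringDefined G' g₁ g₂ δ ϕ α := fun g₁ g₂ δ ϕ => by
    simp only [ScatteringDefined, hGG'.isScatteringPair_eq h h' hα, hGG'.past_iff h h' hα]
  have hlin : ∀ β, Fixed P₁ P₂ β → linScatteringOp G β = linScatteringOp G' β := fun β hβ =>
    hop 0 0 0 0 β hβ
  obtain ⟨h1, h2, h3⟩ := hE
  refine ⟨(hdef 0 0 0 0).mpr h1, fun δ hδ => ?_, fun hF => ?_⟩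
  · simp only [hadm, hop f₁ f₂ δ _ α hα, hdef, hlin α hα]
    exact h2 δ hδ
  · obtain ⟨Λm, Λp, h4⟩ := h3 hF
    refine ⟨Λm, Λp, fun δ => ?_⟩
    obtain ⟨h5, h6, h7, h8⟩ := h4 δ
    rw [hdef, hop f₁ f₂ δ 0 α hα, hlin α hα, hlin _ (hα.smul _)]
    refine ⟨h5, fun u hu hu' => ?_, h7, h8⟩
    obtain ⟨hv, hv'⟩ := hGG'.past_imp h h' hα ⟨hu, hu'⟩
    have hfix := h'.fixed_of_past_state hα hv hv'
    obtain ⟨ulin, αlin, ωlin, a1, a2, a3, a4, a5⟩ := h6 u hv hv'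
    -- Starting from `u 0`, the linear solution stays in the invariant subspace. Its states
    -- therefore lie there too and can be transferred back to `G`.
    have hul : ∀ s, Fixed P₁ P₂ (ulin s) := h'.fixed_of_fixed a1 (s := 0) (a2 ▸ hfix 0)
    have hαl := h'.fixed_of_tendsto hul a3.tendsto
    have a3' := hGG'.symm.past_imp h' h hαl ⟨a1, a3⟩
    exact ⟨ulin, αlin, ωlin, a3'.1, a2, a3'.2, hGG'.symm.future_imp h' h hul a4, a5⟩

/-! ### The spectral cut-off. -/

section Cutoff

variable [FiniteDimensional ℂ H]

/-- In finite dimension an annihilating polynomial exists and vanishes on the spectrum. Consequently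
every function, even the discontinuous `lowPass`, is continuous on the spectrum. -/
theorem finite_real_spectrum (A : H →L[ℂ] H) : (spectrum ℝ A).Finite := by
  have : FiniteDimensional ℝ (H →L[ℂ] H) := FiniteDimensional.complexToReal _
  obtain ⟨p, hp, hpA⟩ := Algebra.IsAlgebraic.isAlgebraic (R := ℝ) A
  refine (p.rootSet_finite ℝ).subset fun x hx => ?_
  rw [Polynomial.mem_rootSet]
  refine ⟨hp, ?_⟩
  have h1 := spectrum.subset_polynomial_aeval A p ⟨x, hx, rfl⟩
  rw [hpA] at h1
  by_contra h2
  have h3 : (Polynomial.aeval x p) = Polynomial.eval x p := by simp [Polynomial.aeval_def]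
  rw [h3] at h2
  rw [spectrum.mem_iff, sub_zero] at h1
  exact h1 ((IsUnit.mk0 _ h2).map (algebraMap ℝ (H →L[ℂ] H)))

theorem continuousOn_spectrum (g : ℝ → ℝ) (A : H →L[ℂ] H) : ContinuousOn g (spectrum ℝ A) :=
  (finite_real_spectrum A).continuousOn g

/-- On the two finite spectra `g` agrees with one interpolation polynomial, and polynomials respect
the relation `A T = T B`. -/
theorem cfc_mul_eq_mul_cfc {A B T : H →L[ℂ] H} (hA : IsSelfAdjoint A) (hB : IsSelfAdjoint B)
    (h : A * T = T * B) (g : ℝ → ℝ) : cfc g A * T = T * cfc g B := by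
  classical
  set S : Finset ℝ := (finite_real_spectrum A).toFinset ∪ (finite_real_spectrum B).toFinset with hS
  set p : Polynomial ℝ := Lagrange.interpolate S id g with hp
  have hev : ∀ x ∈ S, p.eval x = g x := fun x hx =>
    Lagrange.eval_interpolate_at_node (v := id) g Function.injective_id.injOn hx
  have eA : cfc g A = Polynomial.aeval A p := by
    rw [← cfc_polynomial p A hA]
    exact cfc_congr fun x hx => (hev x (by simp [hS, hx])).symm
  have eB : cfc g B = Polynomial.aeval B p := by
    rw [← cfc_polynomial p B hB]
    exact cfc_congr fun x hx => (hev x (by simp [hS, hx])).symm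
  have hs : SemiconjBy T B A := h.symm
  rw [eA, eB, Polynomial.aeval_eq_sum_range, Polynomial.aeval_eq_sum_range, Finset.sum_mul,
    Finset.mul_sum]
  refine Finset.sum_congr rfl fun i _ => ?_
  rw [smul_mul_assoc, mul_smul_comm, (hs.pow_right i).eq]

/-- The spectral cut-off `1_{|x| ≤ R²}`. -/
def lowPass (R x : ℝ) : ℝ := if |x| ≤ R ^ 2 then 1 else 0

/-- The spectral projections of `G G*` and `G* G` for `|x| ≤ R²` are intertwined by `G`, and their
range contains `α` by the cut-off condition. The truncation `G P₂` agrees with `G` there. -/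
theorem exists_reduction (G : H →L[ℂ] H) (hR : 0 < R) {θ : ℝ → ℝ} (hθ : IsCutoff θ) {α : H2 H}
    (hα : Theta G θ R α = α) : ∃ G' P₁ P₂ : H →L[ℂ] H, ‖G'‖ ≤ R ∧ Intertwines G P₁ P₂ ∧
      Intertwines G' P₁ P₂ ∧ AgreesOn G G' P₁ P₂ ∧ Fixed P₁ P₂ α := by
  set A := GGs G with hAdef
  set B := GsG G with hBdef
  have hA : IsSelfAdjoint A := isSelfAdjoint_GGs G
  have hB : IsSelfAdjoint B := isSelfAdjoint_GsG G
  set P₁ := cfc (lowPass R) A with hP₁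
  set P₂ := cfc (lowPass R) B with hP₂
  have hint : P₁ * G = G * P₂ := cfc_mul_eq_mul_cfc hA hB (by
    rw [hAdef, hBdef, GGs, GsG, mul_assoc]) _
  have sP₁ : star P₁ = P₁ := cfc_predicate (lowPass R) A
  have sP₂ : star P₂ = P₂ := cfc_predicate (lowPass R) B
  have hint' : P₂ * star G = star G * P₁ := by
    have := congrArg star hint
    rw [star_mul, star_mul, sP₁, sP₂] at this
    exact this.symm
  have hlow : (fun x => lowPass R x * lowPass R x) = lowPass R := funext fun x => by
    unfold lowPass; split_ifs <;> simp
  have idem : P₂ * P₂ = P₂ := by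
    rw [hP₂, ← cfc_mul _ _ _ (continuousOn_spectrum _ _) (continuousOn_spectrum _ _), hlow]
  have i₁ : Intertwines G P₁ P₂ := ⟨fun x => DFunLike.congr_fun hint x,
    fun x => DFunLike.congr_fun hint' x⟩
  have sG' : star (G * P₂) = star G * P₁ := by rw [star_mul, sP₂, hint']
  have hfix : ∀ (D : H →L[ℂ] H), IsSelfAdjoint D → ∀ x : H,
      cfc (fun x : ℝ => θ (x / R ^ 2)) D x = x → cfc (lowPass R) D x = x := fun D hD x hx => by
    -- The cut-off vanishes where `lowPass` does, so multiplying by `lowPass` does not change it;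
    -- fixed vectors of the smooth cut-off are thus fixed by the projection.
    have e : (fun x => lowPass R x * θ (x / R ^ 2)) = fun x => θ (x / R ^ 2) := funext fun x => by
      unfold lowPass
      split_ifs with h
      · rw [one_mul]
      · rw [hθ.zero_of_one_lt, mul_zero]
        rw [abs_div, abs_of_pos (by positivity : 0 < R ^ 2), one_lt_div (by positivity)]
        exact not_le.mp h
    have e2 : cfc (lowPass R) D * cfc (fun x : ℝ => θ (x / R ^ 2)) D =
        cfc (fun x : ℝ => θ (x / R ^ 2)) D := by
      rw [← cfc_mul _ _ _ (continuousOn_spectrum _ _) (continuousOn_spectrum _ _), e]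
    have e3 := DFunLike.congr_fun e2 x
    rw [mul_apply_eq_comp, hx] at e3
    exact e3
  refine ⟨G * P₂, P₁, P₂, ?_, i₁, ⟨fun x => ?_, fun x => ?_⟩, ⟨fun x hx => ?_, fun x hx => ?_⟩,
    hfix A hA _ (congrArg WithLp.fst hα), hfix B hB _ (congrArg WithLp.snd hα)⟩
  -- The square of the truncated operator is `G G*` restricted to spectral values at most `R²`,
  -- whence the norm bound by the `C*`-identity.
  · have e : (G * P₂) * star (G * P₂) = cfc (fun x => lowPass R x * x) A := by
      rw [cfc_mul _ _ _ (continuousOn_spectrum _ _) (continuousOn_spectrum _ _), cfc_id' ℝ A hA,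
        sG', ← hint, mul_assoc, ← mul_assoc G]
      change P₁ * (A * P₁) = P₁ * A
      have hc : A * P₁ = P₁ * A := (cfc_mul_eq_mul_cfc hA hA rfl _).symm
      rw [hc, ← mul_assoc]
      congr 1
      rw [hP₁, ← cfc_mul _ _ _ (continuousOn_spectrum _ _) (continuousOn_spectrum _ _), hlow]
    have n : ‖cfc (fun x => lowPass R x * x) A‖ ≤ R ^ 2 := norm_cfc_le (by positivity) fun x _ => by
      unfold lowPass
      split_ifs with h
      · rw [one_mul]; exact h
      · rw [zero_mul, norm_zero]; positivity
    rw [← e, CStarRing.norm_self_mul_star] at n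
    nlinarith [norm_nonneg (G * P₂)]
  · rw [mul_apply_eq_comp, mul_apply_eq_comp]
    exact i₁.map _
  · change P₂ (star (G * P₂) x) = star (G * P₂) (P₁ x)
    rw [sG', mul_apply_eq_comp, mul_apply_eq_comp]
    exact i₁.map_adjoint _
  · rw [mul_apply_eq_comp, hx]
  · change star G x = star (G * P₂) x
    rw [sG', mul_apply_eq_comp, hx]

end Cutoff

end LandauZener
end

theorem theorem1p8 (f₁ f₂ : ℝ × ℝ → ℝ)
    (hf₁ : ContDiff ℝ 2 f₁) (hf₂ : ContDiff ℝ 2 f₂)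
    (hb₁ : ∃ M : ℝ, ∀ x, ‖iteratedFDeriv ℝ 2 f₁ x‖ ≤ M)
    (hb₂ : ∃ M : ℝ, ∀ x, ‖iteratedFDeriv ℝ 2 f₂ x‖ ≤ M)
    (R : ℝ) (hR : 0 < R) :
    ∃ δ₀ > (0 : ℝ), ∃ C : ℝ,
      ∀ (H : Type u) [NormedAddCommGroup H] [InnerProductSpace ℂ H] [CompleteSpace H]
        [FiniteDimensional ℂ H] (G : H →L[ℂ] H) (θ : ℝ → ℝ), IsCutoff θ →
      ∀ α : H2 H, ‖α‖ = 1 → Theta G θ R α = α →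
        LinScatteringDefined G α ∧
        -- the general case
        (∀ δ : ℝ, |δ| ≤ δ₀ →
          (∃ ϕ ∈ Set.Ico 0 (2 * Real.pi), Admissible G f₁ f₂ δ ϕ α ∧ ϕ ≤ C * |δ| ∧
            ‖scatteringOp G f₁ f₂ δ ϕ α - linScatteringOp G α‖ ≤ C * |δ|) ∧
          (∀ ϕ : ℝ, Admissible G f₁ f₂ δ ϕ α →
            ScatteringDefined G f₁ f₂ δ ϕ α ∧
            ‖scatteringOp G f₁ f₂ δ ϕ α - linScatteringOp G α‖ ≤ C * (|δ| + |ϕ|))) ∧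
        -- the case of equal nonlinearities
        ((∀ v : H2 H, nlF f₁ v = nlF f₂ v) →
          ∃ Λm Λp : ℝ, ∀ δ : ℝ,
            ScatteringDefined G f₁ f₂ δ 0 α ∧
            (∀ u : ℝ → H2 H, IsSolution G f₁ f₂ δ u → HasPastState G f₁ f₂ δ 0 u α →
              ∃ (ulin : ℝ → H2 H) (αlin ωlin : H2 H),
                IsLinSolution G ulin ∧ ulin 0 = u 0 ∧
                HasLinPastState G ulin αlin ∧ HasLinFutureState G ulin ωlin ∧
                Tendsto (fun T : ℝ => ∫ τ in (-T)..0, (nlF f₁ (ulin τ) - nlF f₁ αlin))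
                  atTop (𝓝 Λm) ∧
                Tendsto (fun T : ℝ => ∫ τ in (0 : ℝ)..T, (nlF f₁ (ulin τ) - nlF f₁ ωlin))
                  atTop (𝓝 Λp)) ∧
            scatteringOp G f₁ f₂ δ 0 α =
              Complex.exp (Complex.I * δ * Λp) •
                linScatteringOp G (Complex.exp (Complex.I * δ * Λm) • α) ∧
            (|δ| ≤ δ₀ →
              ‖scatteringOp G f₁ f₂ δ 0 α - linScatteringOp G α
                - (Complex.I * δ * (Λp + Λm)) • linScatteringOp G α‖ ≤ C * δ ^ 2)) := by
  obtain ⟨M₁, h₁⟩ := exists_nice hf₁ hb₁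
  obtain ⟨M₂, h₂⟩ := exists_nice hf₂ hb₂
  have n₁ := h₁ (max M₁ M₂) (le_max_left _ _)
  have n₂ := h₂ (max M₁ M₂) (le_max_right _ _)
  refine ⟨couplingBound R (max M₁ M₂), couplingBound_pos hR.le n₁.nonneg,
    estimateC R (max M₁ M₂), fun H _ _ _ _ G θ hθ α hα hΘ => ?_⟩
  obtain ⟨G', P₁, P₂, hG', i₁, i₂, hGG', hfix⟩ := exists_reduction G hR hθ hΘ
  exact hGG'.scatteringEstimates i₁ i₂ hfix (scatteringEstimates_of_norm_le n₁ n₂ hG' hα)
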